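/- **Setting.** Let $X$ be a random variable with law $\mu$ on a measurable space $\mathcal X$, let $Y$ be a real random variable, and let $\mathcal D_N=(X_i,Y_i)_{i=1}^N$ be independent copies of $(X,Y)$. Write $\|f\|_{L_p}=(\mathbb E|f(X)|^p)^{1/p}$ and $D=\{f:\|f\|_{L_2}\le 1\}$. Let $\mathcal F\subset L_2(\mu)$ be a class of measurable functions $\mathcal X\to\mathbb R$, and for $h\in\mathcal F$, $r>0$ put $$\mathcal F_{h,r}=\{\lambda (f-h): f\in\mathcal F,\ 0\le\lambda\le 1\}\cap rD .$$ For a set $H$ and $\varepsilon>0$ let $\mathcal M(H,\varepsilon D)$ be the maximal cardinality of a subset of $H$ whose points are pairwise at $L_2(\mu)$-distance at least $\varepsilon$. Let $\varepsilon_1,\dots,\varepsilon_N$ be independent uniform signs, independent of the sample. For $\kappa>0$ and $0<\eta<1$ define (infima over $r>0$, with values in $[0,\infty]$) $$\lambda_{\mathbb Q}(\kappa,\eta,h)=\inf\{r:\log\mathcal M(\mathcal F_{h,r},\eta rD)\le\kappa^2N\},\qquad \lambda_{\mathbb M}(\kappa,\eta,h)=\inf\{r:\log\mathcal M(\mathcal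 F_{h,r},\eta rD)\le\kappa^2Nr^2\},$$ $$r_E(\kappa,h)=\inf\Big\{r:\mathbb E\sup_{u\in\mathcal F_{h,r}}\Big|\tfrac1{\sqrt N}\sum_{i=1}^N\varepsilon_iu(X_i)\Big|\le\kappa\sqrt N\,r\Big\},$$ $$\overline r_{\mathbb M}(\kappa,h)=\inf\Big\{r:\mathbb E\sup_{u\in\mathcal F_{h,r}}\Big|\tfrac1{\sqrt N}\sum_{i=1}^N\varepsilon_iu(X_i)(h(X_i)-Y_i)\Big|\le\kappa\sqrt N\,r^2\Big\}.$$ (Expectations of suprema are outer expectations and, for events that need not be measurable, probability is inner probability.) For constants $c_1,c_2,\sigma>0$ let $$r^*(h)=\max\{\lambda_{\mathbb Q}(c_1,c_2,h),\ \lambda_{\mathbb M}(c_1/\sigma,c_2,h),\ r_E(c_1,h),\ \overline r_{\mathbb M}(c_1,h)\}.$$ **The tournament** with parameters $\ell\in\mathbb N$, $\beta>1$, $\theta\in(0,1/4)$ and level $r$. Let $K=\lfloor N/3\rfloor$. Split $X_1,\dots,X_K$ into $\lfloor K/\ell\rfloor$ consecutive blocks of length $\ell$ (dropping a remainder). For $f,h\in\mathcal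 F$ the match between $f$ and $h$ takes place if the (smallest) median over these blocks of the block means of $|f(X_i)-h(X_i)|$ is at least $\beta r$. Let $n=\lfloor\theta K\min\{1,r^2/\sigma^2\}\rfloor$ and split $(X_i,Y_i)_{i=K+1}^{2K}$ into $n$ consecutive blocks of length $\lfloor K/n\rfloor$ (dropping a remainder; if $n=0$ there are no blocks and every match is drawn). In a match that takes place, $h$ defeats $f$ if on more than $n/2$ of these blocks the block mean of $(f(X_i)-Y_i)^2-(h(X_i)-Y_i)^2$ is positive. The qualifiers are the functions in $\mathcal F$ that are defeated in no match. **Theorem.** Let $q>2$ and $L>1$. There exist positive constants $c,c_0,c_1$ and $c_2<1$, and tournament parameters $\ell\ge1$, $\beta>1$, $0<\theta<1/4$, all depending only on $q$ and $L$, for which the following holds. Let $\sigma>0$, $r\ge 0$ and $N\in\mathbb N$. For every nonempty class $\mathcal F$ of measurable functions on $\mathcal X$ there is a procedure, that is, a map that assigns to each sample $\mathcal D_N$ a function $\hat f\in\mathcal F$ and that depends only on $\mathcal F,N,q,L,\sigma,r$ (not on $\mu$, the law of $W$, or $f_0$), which selects a qualifier of the tournament whenever there is one, such that the following is true for all $X$,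 $f_0$, $W$ satisfying: * $\mathcal F$ is a locally compact subset of $L_2(\mu)$ (not necessarily convex), and $\|f\|_{L_q}\le L\|f\|_{L_2}$ for every $f\in\mathrm{span}(\mathcal F)$; * $Y=f_0(X)+W$, where $f_0\in\mathcal F$ and $W$ is mean-zero, independent of $X$, with $\|W\|_{L_2}\le\sigma$; * $r\ge 2r^*(f^*)$, where $f^*\in\mathcal F$ is a minimizer of $\mathbb E(f(X)-Y)^2$ over $\mathcal F$ (so $f^*=f_0$ $\mu$-almost everywhere). With probability at least $1-\exp\big(-c_0N\min\{1,r^2/\sigma^2\}\big)$, $$\|\hat f-f_0\|_{L_2}\le cr\qquad\text{and}\qquad \mathbb E\big((\hat f(X)-Y)^2\,\big|\,\mathcal D_N\big)\le\mathbb E(f_0(X)-Y)^2+(cr)^2 .$$ -/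

import Mathlib

open MeasureTheory ProbabilityTheory
open scoped ENNReal

universe u v

noncomputable section

namespace MoMTournament

variable {𝒳 : Type u} [MeasurableSpace 𝒳]

/-! ### The class, its localizations and its packing numbers -/

/-- The subset of the Hilbert space `L₂(μ)` formed by the (classes of the) functions of `F`. -/
def l2Class (F : Set (𝒳 → ℝ)) (μ : Measure 𝒳) : Set (Lp ℝ 2 μ) :=
  {g | ∃ f ∈ F, g =ᵐ[μ] f}

/-- The star-shaped hull of `F` around `h`. -/
def starHull (F : Set (𝒳 → ℝ)) (h : 𝒳 → ℝ) : Set (𝒳 → ℝ) :=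
  {g | ∃ f ∈ F, ∃ t ∈ Set.Icc (0 : ℝ) 1, g = t • f + (1 - t) • h}

/-- The closed ball `rD` of `L₂(μ)` centred at `0`. -/
def l2Ball (μ : Measure 𝒳) (r : ℝ) : Set (𝒳 → ℝ) :=
  {u | eLpNorm u 2 μ ≤ ENNReal.ofReal r}

/-- The localization `F_{h,r} = star(F - h, 0) ∩ rD`. -/
def localization (μ : Measure 𝒳) (F : Set (𝒳 → ℝ)) (h : 𝒳 → ℝ) (r : ℝ) : Set (𝒳 → ℝ) :=
  starHull ((fun f => f - h) '' F) 0 ∩ l2Ball μ r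

/-- The packing number `M(H, εD)`: the largest cardinality of a subset of `H` whose points are
pairwise at `L₂(μ)` distance at least `ε` (possibly infinite). -/
def packingNumber (μ : Measure 𝒳) (H : Set (𝒳 → ℝ)) (ε : ℝ) : ℕ∞ :=
  ⨆ (T : Set (𝒳 → ℝ)) (_ : T ⊆ H ∧
    T.Pairwise fun f g => ENNReal.ofReal ε ≤ eLpNorm (f - g) 2 μ), T.encard

/-- `log M(H, εD)`. -/
def logPacking (μ : Measure 𝒳) (H : Set (𝒳 → ℝ)) (ε : ℝ) : EReal :=
  ENNReal.log (packingNumber μ H ε : ℝ≥0∞)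

/-! ### Expectations of suprema -/

/-- The outer expectation of a nonnegative function: the infimum of the expectations of its
measurable majorants. It is the usual expectation if the function is measurable; a supremum over an
uncountable class need not be. -/
def outerExpectation {Z : Type*} [MeasurableSpace Z] (P : Measure Z) (g : Z → ℝ≥0∞) : ℝ≥0∞ :=
  ⨅ (G : Z → ℝ≥0∞) (_ : Measurable G ∧ g ≤ G), ∫⁻ z, G z ∂P

/-- `E sup_{v ∈ V} |N^{-1/2} ∑ᵢ εᵢ v(Zᵢ)|`, where `Z₁, …, Z_N` are independent with law `P` and
`ε₁, …, ε_N` are independent uniform signs, independent of `(Zᵢ)`. -/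
def signedSup {Z : Type*} [MeasurableSpace Z] (P : Measure Z) (N : ℕ) (V : Set (Z → ℝ)) : ℝ≥0∞ :=
  (∑ s : Fin N → ℤˣ, outerExpectation (Measure.pi fun _ : Fin N => P) fun z =>
    ⨆ v ∈ V, ENNReal.ofReal |1 / √(N : ℝ) * ∑ i, ((s i : ℤ) : ℝ) * v (z i)|) / 2 ^ N

/-! ### The complexity parameters -/

/-- `inf {r > 0 : p r}` in `[0, ∞]` (the infimum of the empty set is `∞`). -/
def critLevel (p : ℝ → Prop) : ℝ≥0∞ :=
  ⨅ (r : ℝ) (_ : 0 < r ∧ p r), ENNReal.ofReal r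

/-- `λ_Q(κ, η, h)`. -/
def lambdaQ (μ : Measure 𝒳) (F : Set (𝒳 → ℝ)) (N : ℕ) (κ η : ℝ) (h : 𝒳 → ℝ) : ℝ≥0∞ :=
  critLevel fun r => logPacking μ (localization μ F h r) (η * r) ≤ ((κ ^ 2 * N : ℝ) : EReal)

/-- `λ_M(κ, η, h)`. -/
def lambdaM (μ : Measure 𝒳) (F : Set (𝒳 → ℝ)) (N : ℕ) (κ η : ℝ) (h : 𝒳 → ℝ) : ℝ≥0∞ :=
  critLevel fun r =>
    logPacking μ (localization μ F h r) (η * r) ≤ ((κ ^ 2 * N * r ^ 2 : ℝ) : EReal)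

/-- `r_E(κ, h)`. -/
def rE (μ : Measure 𝒳) (F : Set (𝒳 → ℝ)) (N : ℕ) (κ : ℝ) (h : 𝒳 → ℝ) : ℝ≥0∞ :=
  critLevel fun r =>
    signedSup μ N (localization μ F h r) ≤ ENNReal.ofReal (κ * √(N : ℝ) * r)

/-- `r̄_M(κ, h)`; here `P` is the law of `(X, Y)` and `μ` the law of `X`. -/
def rM (μ : Measure 𝒳) (P : Measure (𝒳 × ℝ)) (F : Set (𝒳 → ℝ)) (N : ℕ) (κ : ℝ)
    (h : 𝒳 → ℝ) : ℝ≥0∞ :=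
  critLevel fun r =>
    signedSup P N ((fun (w : 𝒳 → ℝ) (z : 𝒳 × ℝ) => w z.1 * (h z.1 - z.2)) ''
      localization μ F h r) ≤ ENNReal.ofReal (κ * √(N : ℝ) * r ^ 2)

/-- `r*(h) = max {λ_Q(c₁, c₂, h), λ_M(c₁/σ, c₂, h), r_E(c₁, h), r̄_M(c₁, h)}`. -/
def rStar (μ : Measure 𝒳) (P : Measure (𝒳 × ℝ)) (F : Set (𝒳 → ℝ)) (N : ℕ) (σ c₁ c₂ : ℝ)
    (h : 𝒳 → ℝ) : ℝ≥0∞ :=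
  max (max (lambdaQ μ F N c₁ c₂ h) (lambdaM μ F N (c₁ / σ) c₂ h))
    (max (rE μ F N c₁ h) (rM μ P F N c₁ h))

/-- The risk `E (f(X) - Y)²`, where `P` is the law of `(X, Y)`. -/
def risk (P : Measure (𝒳 × ℝ)) (f : 𝒳 → ℝ) : ℝ :=
  ∫ z, (f z.1 - z.2) ^ 2 ∂P

/-! ### The tournament

The sample `D` of size `N` is split into three parts of size `N / 3` (and a remainder): the first
one serves the distance oracle and the second one the preliminary round. The third one is reserved
for a further round, which is not played here. -/

/-- The smallest median of `k` real numbers. -/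
def median {k : ℕ} (a : Fin k → ℝ) : ℝ :=
  sInf {x | k ≤ 2 * (Finset.univ.filter fun j => a j ≤ x).card ∧
    k ≤ 2 * (Finset.univ.filter fun j => x ≤ a j).card}

/-- The mean of `g` over the `j`-th block of `m` consecutive sample points, the blocks (`j = 0, 1,
2, …`) being laid out from position `s` on. -/
def blockMean {N : ℕ} (D : Fin N → 𝒳 × ℝ) (s m j : ℕ) (g : 𝒳 × ℝ → ℝ) : ℝ :=
  (∑ i ∈ (Finset.univ : Finset (Fin N)).filter
    fun i => s + j * m ≤ i.val ∧ i.val < s + (j + 1) * m, g (D i)) / m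

/-- The distance functional: the median, over the blocks of length `ℓ` of the first part of the
sample, of the block means of `|f(Xᵢ) - h(Xᵢ)|`. -/
def medDist {N : ℕ} (ℓ : ℕ) (D : Fin N → 𝒳 × ℝ) (f h : 𝒳 → ℝ) : ℝ :=
  median fun j : Fin (N / 3 / ℓ) => blockMean D 0 ℓ j fun z => |f z.1 - h z.1|

/-- The verdict of the distance oracle that the match between `f` and `h` takes place. -/
def Allowed {N : ℕ} (ℓ : ℕ) (β r : ℝ) (D : Fin N → 𝒳 × ℝ) (f h : 𝒳 → ℝ) : Prop :=
  β * r ≤ medDist ℓ D f h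

/-- The number of blocks of the preliminary round. -/
def numBlocks (N : ℕ) (θ σ r : ℝ) : ℕ :=
  ⌊θ * (N / 3 : ℕ) * min 1 ((r / σ) ^ 2)⌋₊

/-- `h` beats `f` on more than half of the `n` blocks of the second part of the sample: on each of
these blocks the empirical squared loss of `h` is smaller than that of `f`. -/
def Beats {N : ℕ} (n : ℕ) (D : Fin N → 𝒳 × ℝ) (h f : 𝒳 → ℝ) : Prop :=
  n < 2 * (Finset.univ.filter fun j : Fin n =>
    0 < blockMean D (N / 3) (N / 3 / n) j
      fun z => (f z.1 - z.2) ^ 2 - (h z.1 - z.2) ^ 2).card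

/-- The set `H` of the functions of `F` that lose no match of the preliminary round. -/
def qualifiers {N : ℕ} (F : Set (𝒳 → ℝ)) (ℓ : ℕ) (β θ σ r : ℝ) (D : Fin N → 𝒳 × ℝ) :
    Set (𝒳 → ℝ) :=
  {f ∈ F | ∀ h ∈ F, Allowed ℓ β r D f h → ¬ Beats (numBlocks N θ σ r) D h f}

end MoMTournament

end

open MoMTournament

/-! Write `h` for the risk minimizer and γ for `l1Ratio q L`. As the noise is centred and
independent of `X`, the excess risk of `f` is ‖f - f₀‖² (`risk_eq`). Hence `h = f₀` almost
everywhere, and it suffices that no function at distance more than 4r/γ from `h` is selected.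

The comparison of the L_q and L₂ norms yields E|u| ≥ γ‖u‖ on the span
(`l1Ratio_mul_le_integral_abs`). Suppose that, for every `u` in the localization at level `r`, most
block means of |u| are within γr/2 of E|u| and most block means of u·(h - Y) are within γ²r²/16 of
their expectation 0. If ‖f - h‖ ≥ r, then f - h = c·u with c ≥ 1 and ‖u‖ = r, and the difference of
squared losses on a block is c²·mean(u²) + 2c·mean(u(h - Y)). By Cauchy-Schwarz mean(u²) ≥ γ²r²/4,
so the quadratic part wins and `h` beats `f` (`beats_of_uniform`). The same estimate on the first
part of the sample shows that matches take place only at distance at least `r`, and always at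
distance at least 4r/γ (`medDist_of_uniform`). So `h` loses no match, is a qualifier, and eliminates
all functions at distance at least 4r/γ.

The uniform estimate is `measure_blockDeviation_le`. The number of bad blocks is dominated by a sum
of clipped squares of block deviations. The expectation of its supremum is bounded by Chebyshev,
symmetrization and contraction, and its fluctuation by bounded differences, which gives failure
probability exp(-n/128). The Rademacher terms in `rStar` control the expectation. Suprema need not
be measurable, so symmetrization and McDiarmid's inequality are proved for outer expectations.

If there are fewer than 512 blocks, these bounds are too weak. Then one of the two packing
thresholds is below log 2, the localized class contains no separated pair, and the whole class lies
within `r` of `h` (`eLpNorm_sub_le_of_rStar_le`), so every choice is good. -/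

namespace MoMTournament

/-! ### Outer expectations -/

section OuterExpectation

variable {Z : Type*} [MeasurableSpace Z] {P : Measure Z}

theorem outerExpectation_le_lintegral {g G : Z → ℝ≥0∞} (hG : Measurable G) (h : g ≤ G) :
    outerExpectation P g ≤ ∫⁻ z, G z ∂P :=
  iInf₂_le G ⟨hG, h⟩

theorem outerExpectation_mono {f g : Z → ℝ≥0∞} (h : f ≤ g) :
    outerExpectation P f ≤ outerExpectation P g :=
  le_iInf₂ fun _ hG => outerExpectation_le_lintegral hG.1 (h.trans hG.2)

/-- The outer expectation is attained by a measurable majorant. -/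
theorem exists_measurable_majorant (P : Measure Z) (g : Z → ℝ≥0∞) :
    ∃ G : Z → ℝ≥0∞, Measurable G ∧ g ≤ G ∧ ∫⁻ z, G z ∂P = outerExpectation P g := by
  by_cases htop : outerExpectation P g = ⊤
  · refine ⟨fun _ => ⊤, measurable_const, fun _ => le_top, ?_⟩
    refine le_antisymm (by rw [htop]; exact le_top)
      (outerExpectation_le_lintegral measurable_const fun _ => le_top)
  have key : ∀ n : ℕ, ∃ G : Z → ℝ≥0∞, (Measurable G ∧ g ≤ G) ∧
      ∫⁻ z, G z ∂P < outerExpectation P g + (n + 1 : ℝ≥0∞)⁻¹ := by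
    intro n
    have h : outerExpectation P g < outerExpectation P g + (n + 1 : ℝ≥0∞)⁻¹ :=
      ENNReal.lt_add_right htop (by simp)
    conv_lhs at h => unfold outerExpectation
    obtain ⟨G, hG⟩ := iInf_lt_iff.1 h
    obtain ⟨hG1, hG2⟩ := iInf_lt_iff.1 hG
    exact ⟨G, hG1, hG2⟩
  choose G hG hlt using key
  -- A countable infimum of nearly optimal majorants is still a measurable majorant.
  have hm : Measurable fun z => ⨅ n, G n z := Measurable.iInf fun n => (hG n).1
  have hge : g ≤ fun z => ⨅ n, G n z := fun z => le_iInf fun n => (hG n).2 z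
  refine ⟨_, hm, hge, le_antisymm ?_ (outerExpectation_le_lintegral hm hge)⟩
  refine ENNReal.le_of_forall_pos_le_add fun ε hε _ => ?_
  obtain ⟨n, hn⟩ := ENNReal.exists_inv_nat_lt (a := (ε : ℝ≥0∞)) (by simpa using hε.ne')
  calc ∫⁻ z, ⨅ n, G n z ∂P ≤ ∫⁻ z, G n z ∂P := lintegral_mono fun z => iInf_le _ n
    _ ≤ outerExpectation P g + (n + 1 : ℝ≥0∞)⁻¹ := (hlt n).le
    _ ≤ outerExpectation P g + ε := by
      gcongr
      exact (ENNReal.inv_le_inv.2 (by simp)).trans hn.le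

theorem outerExpectation_add_le (f g : Z → ℝ≥0∞) :
    outerExpectation P (fun z => f z + g z) ≤ outerExpectation P f + outerExpectation P g := by
  obtain ⟨F, hF, hfF, hF'⟩ := exists_measurable_majorant P f
  obtain ⟨G, hG, hgG, hG'⟩ := exists_measurable_majorant P g
  rw [← hF', ← hG', ← lintegral_add_left hF]
  exact outerExpectation_le_lintegral (hF.add hG) fun z => add_le_add (hfF z) (hgG z)

theorem outerExpectation_const_mul_le (c : ℝ≥0∞) (f : Z → ℝ≥0∞) :
    outerExpectation P (fun z => c * f z) ≤ c * outerExpectation P f := by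
  obtain ⟨F, hF, hfF, hF'⟩ := exists_measurable_majorant P f
  rw [← hF', ← lintegral_const_mul _ hF]
  exact outerExpectation_le_lintegral (hF.const_mul c) fun z => by gcongr; exact hfF z

/-- Majorants pull back along `T`. The converse inequality fails in general, since a majorant of the
composition need not factor through `T`. -/
theorem outerExpectation_comp_le {Z' : Type*} [MeasurableSpace Z'] {P' : Measure Z'} {T : Z → Z'}
    (hT : MeasurePreserving T P P') (f : Z' → ℝ≥0∞) :
    outerExpectation P (fun z => f (T z)) ≤ outerExpectation P' f := by
  obtain ⟨F, hF, hfF, hF'⟩ := exists_measurable_majorant P' f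
  rw [← hF', ← hT.lintegral_comp hF]
  exact outerExpectation_le_lintegral (hF.comp hT.measurable) fun z => hfF _

/-- Comparison of outer expectations on a product: integrating out one factor of a majorant. -/
theorem outerExpectation_le_of_section {Z' : Type*} [MeasurableSpace Z'] {P' : Measure Z'}
    [SFinite P'] {f : Z → ℝ≥0∞} {g : Z × Z' → ℝ≥0∞} (c : ℝ≥0∞) [IsProbabilityMeasure P]
    (h : ∀ G : Z × Z' → ℝ≥0∞, Measurable G → g ≤ G → ∀ z, f z ≤ c + ∫⁻ z', G (z, z') ∂P')
    [SFinite P] :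
    outerExpectation P f ≤ c + outerExpectation (P.prod P') g := by
  obtain ⟨G, hG, hgG, hG'⟩ := exists_measurable_majorant (P.prod P') g
  rw [← hG', lintegral_prod _ hG.aemeasurable]
  have hm : Measurable fun z => ∫⁻ z', G (z, z') ∂P' := hG.lintegral_prod_right'
  calc outerExpectation P f ≤ ∫⁻ z, (c + ∫⁻ z', G (z, z') ∂P') ∂P :=
        outerExpectation_le_lintegral (measurable_const.add hm) (h G hG hgG)
    _ = _ := by rw [lintegral_add_left measurable_const]; simp

end OuterExpectation

/-! ### The contraction principle -/

section Contraction

variable {κ J : Type*} [Fintype J] [DecidableEq J]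

/-- This is contraction in a single sign. For a pair `k`, `k'`, the difference `f k - f k'` is at
most `|g k - g k'|`, and the sign of `g k - g k'` decides which index serves which supremum. If one
positive part vanishes, the bound `|f| ≤ |g|` handles the other alone. -/
theorem iSup_ofReal_add_iSup_ofReal_sub_le (A f g : κ → ℝ)
    (hfg : ∀ k k', |f k - f k'| ≤ |g k - g k'|) (h0 : ∀ k, |f k| ≤ |g k|) :
    (⨆ k, ENNReal.ofReal (A k + f k)) + (⨆ k, ENNReal.ofReal (A k - f k)) ≤
      (⨆ k, ENNReal.ofReal (A k + g k)) + ⨆ k, ENNReal.ofReal (A k - g k) := by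
  rcases isEmpty_or_nonempty κ with hκ | hκ
  · simp
  have hp : ∀ k, ENNReal.ofReal (A k + g k) ≤ ⨆ k, ENNReal.ofReal (A k + g k) :=
    fun k => le_iSup (fun k => ENNReal.ofReal (A k + g k)) k
  have hm : ∀ k, ENNReal.ofReal (A k - g k) ≤ ⨆ k, ENNReal.ofReal (A k - g k) :=
    fun k => le_iSup (fun k => ENNReal.ofReal (A k - g k)) k
  have hsingle : ∀ k (x : ℝ), x ≤ A k + |g k| → ENNReal.ofReal x ≤
      (⨆ k, ENNReal.ofReal (A k + g k)) + ⨆ k, ENNReal.ofReal (A k - g k) := by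
    intro k x hx
    rcases abs_cases (g k) with ⟨h, _⟩ | ⟨h, _⟩
    · exact ((ENNReal.ofReal_le_ofReal (by linarith)).trans (hp k)).trans le_self_add
    · exact ((ENNReal.ofReal_le_ofReal (by linarith)).trans (hm k)).trans le_add_self
  refine ENNReal.iSup_add_iSup_le fun k k' => ?_
  rcases le_total (A k + f k) 0 with h1 | h1
  · rw [ENNReal.ofReal_of_nonpos h1, zero_add]
    exact hsingle k' _ (by have := h0 k'; have := neg_abs_le (f k'); linarith)
  rcases le_total (A k' - f k') 0 with h2 | h2
  · rw [ENNReal.ofReal_of_nonpos h2, add_zero]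
    exact hsingle k _ (by have := h0 k; have := le_abs_self (f k); linarith)
  rw [← ENNReal.ofReal_add h1 h2]
  have h3 := (le_abs_self _).trans (hfg k k')
  rcases abs_cases (g k - g k') with ⟨h, _⟩ | ⟨h, _⟩
  · refine le_trans (ENNReal.ofReal_le_ofReal (q := (A k + g k) + (A k' - g k')) (by linarith)) ?_
    exact ENNReal.ofReal_add_le.trans (add_le_add (hp k) (hm k'))
  · refine le_trans (ENNReal.ofReal_le_ofReal (q := (A k' + g k') + (A k - g k)) (by linarith)) ?_
    exact ENNReal.ofReal_add_le.trans (add_le_add (hp k') (hm k))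

/-- Flipping one sign permutes the sign patterns. -/
theorem sum_update_neg (F : (J → ℤˣ) → ℝ≥0∞) (j : J) :
    ∑ ρ, F (Function.update ρ j (-ρ j)) = ∑ ρ, F ρ := by
  have hinv : Function.Involutive fun ρ : J → ℤˣ => Function.update ρ j (-ρ j) := by
    intro ρ; simp
  exact Equiv.sum_comp hinv.toPerm F

/-- Pairing each pattern with its flip at `j` counts every pattern twice, so an inequality for pairs
sums up to twice the claim. -/
theorem sum_le_sum_of_flip {F G : (J → ℤˣ) → ℝ≥0∞} (j : J)
    (h : ∀ ρ, ρ j = 1 → F ρ + F (Function.update ρ j (-1)) ≤ G ρ + G (Function.update ρ j (-1))) :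
    ∑ ρ, F ρ ≤ ∑ ρ, G ρ := by
  have hpair : ∀ ρ, F ρ + F (Function.update ρ j (-ρ j)) ≤
      G ρ + G (Function.update ρ j (-ρ j)) := by
    intro ρ
    rcases Int.units_eq_one_or (ρ j) with h1 | h1
    · rw [h1]; exact h ρ h1
    · have h2 := h (Function.update ρ j 1) (by simp)
      have h3 : Function.update ρ j (-1) = ρ := by rw [← h1]; simp
      simp only [Function.update_idem, h3] at h2
      rw [h1, neg_neg, add_comm (F _), add_comm (G _)]
      exact h2
  have hsum := Finset.sum_le_sum fun ρ (_ : ρ ∈ Finset.univ) => hpair ρ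
  rw [Finset.sum_add_distrib, Finset.sum_add_distrib, sum_update_neg, sum_update_neg,
    ← two_mul, ← two_mul] at hsum
  exact (ENNReal.mul_le_mul_iff_right (by simp) (by simp)).1 hsum

/-- The contraction principle for the positive parts of Rademacher sums. -/
theorem sum_signs_iSup_le (f g : κ → J → ℝ)
    (hfg : ∀ k k' j, |f k j - f k' j| ≤ |g k j - g k' j|) (h0 : ∀ k j, |f k j| ≤ |g k j|) :
    ∑ ρ : J → ℤˣ, ⨆ k, ENNReal.ofReal (∑ j, ((ρ j : ℤ) : ℝ) * f k j) ≤
      ∑ ρ : J → ℤˣ, ⨆ k, ENNReal.ofReal (∑ j, ((ρ j : ℤ) : ℝ) * g k j) := by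
  -- `S` collects the coordinates at which `f` has already been replaced by `g`; they are exchanged
  -- one at a time.
  suffices H : ∀ S : Finset J,
      ∑ ρ : J → ℤˣ, ⨆ k, ENNReal.ofReal (∑ j, ((ρ j : ℤ) : ℝ) * f k j) ≤
      ∑ ρ : J → ℤˣ, ⨆ k, ENNReal.ofReal
        (∑ j, ((ρ j : ℤ) : ℝ) * if j ∈ S then g k j else f k j) by
    simpa using H Finset.univ
  intro S
  induction S using Finset.induction_on with
  | empty => simp
  | insert i S hi ih =>
    refine ih.trans (sum_le_sum_of_flip i fun ρ hρ => ?_)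
    have e1 : ∀ (k : κ) (ρ' : J → ℤˣ) (T : Finset J), (∀ j, j ≠ i → ρ' j = ρ j) →
        (∀ j, j ≠ i → (j ∈ T ↔ j ∈ S)) →
        (∑ j, ((ρ' j : ℤ) : ℝ) * if j ∈ T then g k j else f k j) =
        (∑ j ∈ Finset.univ.erase i, ((ρ j : ℤ) : ℝ) * if j ∈ S then g k j else f k j) +
          ((ρ' i : ℤ) : ℝ) * if i ∈ T then g k i else f k i := by
      intro k ρ' T h1 h2
      rw [← Finset.sum_erase_add _ _ (Finset.mem_univ i)]
      congr 1
      refine Finset.sum_congr rfl fun j hj => ?_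
      have hj' := Finset.ne_of_mem_erase hj
      rw [h1 j hj']
      simp only [h2 j hj']
    have hne : ∀ j, j ≠ i → Function.update ρ i (-1) j = ρ j := fun j hj => by simp [hj]
    have hT : ∀ j, j ≠ i → (j ∈ insert i S ↔ j ∈ S) := fun j hj => by simp [hj]
    simp only [e1 _ ρ S (fun _ _ => rfl) fun _ _ => Iff.rfl, e1 _ ρ _ (fun _ _ => rfl) hT,
      e1 _ _ S hne fun _ _ => Iff.rfl, e1 _ _ _ hne hT, hρ, hi, Function.update_self,
      Finset.mem_insert_self, if_true, if_false, Units.val_one, Units.val_neg, Int.cast_one,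
      Int.cast_neg, one_mul, neg_one_mul, ← sub_eq_add_neg]
    exact iSup_ofReal_add_iSup_ofReal_sub_le _ _ _ (fun k k' => hfg k k' i) fun k => h0 k i

end Contraction

/-! ### Symmetrization without measurability -/

section Symmetrization

variable {ι J B : Type*}

/-- Select coordinatewise from a pair of samples. -/
def select (τ : J → ℤˣ) (p : (J → B) × (J → B)) : J → B :=
  fun j => if τ j = 1 then p.1 j else p.2 j

/-- Exchange the coordinates of a pair of samples where the sign is `-1`. -/
def exchange (ρ : J → ℤˣ) (p : (J → B) × (J → B)) : (J → B) × (J → B) :=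
  (select ρ p, select (-ρ) p)

/-- Exchanges act on the selections through multiplication of sign patterns. Data attached to all
selections at once are therefore only reindexed by an exchange. -/
theorem select_exchange (τ ρ : J → ℤˣ) (p : (J → B) × (J → B)) :
    select τ (exchange ρ p) = select (τ * ρ) p := by
  funext j
  rcases Int.units_eq_one_or (τ j) with h | h <;> rcases Int.units_eq_one_or (ρ j) with h' | h' <;>
    simp [select, exchange, h, h']

theorem select_one (p : (J → B) × (J → B)) : select 1 p = p.1 := by
  funext j; simp [select]

theorem select_neg_one (p : (J → B) × (J → B)) : select (-1) p = p.2 := by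
  funext j; simp [select]

theorem exchange_exchange (ρ : J → ℤˣ) (p : (J → B) × (J → B)) :
    exchange ρ (exchange ρ p) = p := by
  have h : ρ * ρ = 1 := by funext j; simp
  refine Prod.ext ?_ ?_
  · change select ρ (exchange ρ p) = _
    rw [select_exchange, h]; rfl
  · change select (-ρ) (exchange ρ p) = _
    rw [select_exchange, neg_mul, h]; rfl

/-- An integer code for a value in `[0, ∞]`, up to the precision `δ`. -/
noncomputable def roundCode (δ : ℝ) (y : ℝ≥0∞) : ℕ :=
  -- The code `0` is reserved for `⊤`, whence the shift by one in the other codes.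
  if y = ⊤ then 0 else ⌈y.toReal / δ⌉₊ + 1

/-- The value, rounded up, with a given code. -/
noncomputable def roundVal (δ : ℝ) (k : ℕ) : ℝ≥0∞ :=
  if k = 0 then ⊤ else ENNReal.ofReal (δ * (k - 1 : ℕ))

theorem measurable_roundCode (δ : ℝ) : Measurable (roundCode δ) := by
  refine Measurable.ite (measurableSet_singleton ⊤) measurable_const ?_
  exact (Nat.measurable_ceil.comp (ENNReal.measurable_toReal.div_const δ)).add_const 1

theorem le_roundVal_roundCode {δ : ℝ} (hδ : 0 < δ) (y : ℝ≥0∞) : y ≤ roundVal δ (roundCode δ y) := by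
  unfold roundVal roundCode
  split_ifs with h1 h2 h2
  · exact le_top
  · simp at h2
  · exact le_top
  · refine (ENNReal.le_ofReal_iff_toReal_le h1 (by positivity)).2 ?_
    have := Nat.le_ceil (y.toReal / δ)
    rw [div_le_iff₀ hδ] at this
    simpa [mul_comm] using this

theorem roundVal_roundCode_le {δ : ℝ} (hδ : 0 < δ) (y : ℝ≥0∞) :
    roundVal δ (roundCode δ y) ≤ y + ENNReal.ofReal δ := by
  by_cases h1 : y = ⊤
  · simp [h1]
  · simp only [roundVal, roundCode, h1, if_false, Nat.add_eq_zero_iff, one_ne_zero, and_false,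
      Nat.add_sub_cancel]
    rw [← ENNReal.ofReal_toReal h1, ← ENNReal.ofReal_add ENNReal.toReal_nonneg hδ.le,
      ENNReal.ofReal_toReal h1]
    refine ENNReal.ofReal_le_ofReal ?_
    have := (Nat.ceil_lt_add_one (div_nonneg (ENNReal.toReal_nonneg (a := y)) hδ.le)).le
    calc δ * (⌈y.toReal / δ⌉₊ : ℝ) ≤ δ * (y.toReal / δ + 1) := by gcongr
      _ = y.toReal + δ := by field_simp

section Select

variable [MeasurableSpace B]

theorem measurable_select (τ : J → ℤˣ) : Measurable (select (B := B) τ) := by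
  refine measurable_pi_lambda _ fun j => ?_
  by_cases h : τ j = 1
  · simp only [select, h, if_true]
    exact (measurable_pi_apply j).comp measurable_fst
  · simp only [select, h, if_false]
    exact (measurable_pi_apply j).comp measurable_snd

end Select

variable [Fintype J]

/-- `sup_u |∑ⱼ σⱼ a_u(xⱼ)|`. -/
noncomputable def signedSumSup (a : ι → B → ℝ) (σ : J → ℤˣ) (x : J → B) : ℝ≥0∞ :=
  ⨆ u, ENNReal.ofReal |∑ j, ((σ j : ℤ) : ℝ) * a u (x j)|

/-- `sup_u (∑ⱼ φⱼ(a_u(xⱼ)) - φⱼ(a_u(x'ⱼ)))₊`, for a pair of samples `(x, x')`. -/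
noncomputable def ghostSup (φ : J → ℝ → ℝ) (a : ι → B → ℝ) (p : (J → B) × (J → B)) : ℝ≥0∞ :=
  ⨆ u, ENNReal.ofReal (∑ j, (φ j (a u (p.1 j)) - φ j (a u (p.2 j))))

theorem ghostSup_exchange (φ : J → ℝ → ℝ) (a : ι → B → ℝ) (ρ : J → ℤˣ)
    (p : (J → B) × (J → B)) :
    ghostSup φ a (exchange ρ p) ≤
      ⨆ u, ENNReal.ofReal (∑ j, ((ρ j : ℤ) : ℝ) * (φ j (a u (p.1 j)) - φ j (a u (p.2 j)))) := by
  refine iSup_mono fun u => ENNReal.ofReal_le_ofReal (le_of_eq ?_)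
  refine Finset.sum_congr rfl fun j _ => ?_
  rcases Int.units_eq_one_or (ρ j) with h | h <;> simp [exchange, select, h]

section Signs

variable [DecidableEq J]

/-- The sign-summed contraction estimate along all pairs of samples that have the same codes. -/
theorem sum_iSup_ghost_le {φ : J → ℝ → ℝ} {L : ℝ} (hL : 0 ≤ L)
    (hφ : ∀ j s t, |φ j s - φ j t| ≤ L * |s - t|) (hφ0 : ∀ j, φ j 0 = 0)
    {κ : Type*} (t t' : κ → J → ℝ) (c c' : (J → ℤˣ) → ℝ≥0∞)
    (hc : ∀ k ρ, ENNReal.ofReal |∑ j, ((ρ j : ℤ) : ℝ) * t k j| ≤ c ρ)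
    (hc' : ∀ k ρ, ENNReal.ofReal |∑ j, ((ρ j : ℤ) : ℝ) * t' k j| ≤ c' ρ) :
    ∑ ρ : J → ℤˣ, ⨆ k, ENNReal.ofReal
        (∑ j, ((ρ j : ℤ) : ℝ) * (φ j (t k j) - φ j (t' k j))) ≤
      ENNReal.ofReal L * (∑ ρ, c ρ + ∑ ρ, c' ρ) := by
  have hone : ∀ (s : κ → J → ℝ) (d : (J → ℤˣ) → ℝ≥0∞),
      (∀ k ρ, ENNReal.ofReal |∑ j, ((ρ j : ℤ) : ℝ) * s k j| ≤ d ρ) →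
      ∑ ρ : J → ℤˣ, ⨆ k, ENNReal.ofReal (∑ j, ((ρ j : ℤ) : ℝ) * φ j (s k j)) ≤
        ENNReal.ofReal L * ∑ ρ, d ρ := by
    intro s d hd
    refine (sum_signs_iSup_le (fun k j => φ j (s k j)) (fun k j => L * s k j) ?_ ?_).trans ?_
    · intro k k' j
      rw [← mul_sub, abs_mul, abs_of_nonneg hL]
      exact hφ j _ _
    · intro k j
      rw [abs_mul, abs_of_nonneg hL]
      simpa [hφ0 j] using hφ j (s k j) 0
    · rw [Finset.mul_sum]
      refine Finset.sum_le_sum fun ρ _ => iSup_le fun k => ?_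
      have : ∑ j, ((ρ j : ℤ) : ℝ) * (L * s k j) = L * ∑ j, ((ρ j : ℤ) : ℝ) * s k j := by
        rw [Finset.mul_sum]; exact Finset.sum_congr rfl fun j _ => by ring
      rw [this, ENNReal.ofReal_mul hL]
      gcongr
      exact (ENNReal.ofReal_le_ofReal (le_abs_self _)).trans (hd k ρ)
  -- The two samples are treated separately. The minus sign of the second one is absorbed by `ρ ↦
  -- -ρ`, which permutes the sign patterns.
  have hsplit : ∀ ρ : J → ℤˣ, (⨆ k, ENNReal.ofReal
        (∑ j, ((ρ j : ℤ) : ℝ) * (φ j (t k j) - φ j (t' k j)))) ≤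
      (⨆ k, ENNReal.ofReal (∑ j, ((ρ j : ℤ) : ℝ) * φ j (t k j))) +
        ⨆ k, ENNReal.ofReal (∑ j, (((-ρ) j : ℤ) : ℝ) * φ j (t' k j)) := by
    intro ρ
    refine iSup_le fun k => ?_
    have : ∑ j, ((ρ j : ℤ) : ℝ) * (φ j (t k j) - φ j (t' k j)) =
        ∑ j, ((ρ j : ℤ) : ℝ) * φ j (t k j) + ∑ j, (((-ρ) j : ℤ) : ℝ) * φ j (t' k j) := by
      rw [← Finset.sum_add_distrib]
      refine Finset.sum_congr rfl fun j _ => ?_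
      simp only [Pi.neg_apply, Units.val_neg, Int.cast_neg]; ring
    rw [this]
    refine ENNReal.ofReal_add_le.trans (add_le_add ?_ ?_)
    · exact le_iSup (fun k => ENNReal.ofReal (∑ j, ((ρ j : ℤ) : ℝ) * φ j (t k j))) k
    · exact le_iSup (fun k => ENNReal.ofReal (∑ j, (((-ρ) j : ℤ) : ℝ) * φ j (t' k j))) k
  refine (Finset.sum_le_sum fun ρ _ => hsplit ρ).trans ?_
  rw [Finset.sum_add_distrib, mul_add]
  refine add_le_add (hone t c hc) ?_
  refine (Equiv.sum_comp (Equiv.neg (J → ℤˣ)) fun ρ : J → ℤˣ =>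
    ⨆ k, ENNReal.ofReal (∑ j, ((ρ j : ℤ) : ℝ) * φ j (t' k j))).trans_le ?_
  exact hone t' c' hc'

end Signs

variable [MeasurableSpace B]

/-- The average over all sign patterns of the outer expectation of `signedSumSup`. -/
noncomputable def rademacherSup (Q : Measure B) (J : Type*) [Fintype J] [DecidableEq J]
    (a : ι → B → ℝ) : ℝ≥0∞ :=
  (∑ σ : J → ℤˣ, outerExpectation (Measure.pi fun _ : J => Q) (signedSumSup a σ)) /
    2 ^ Fintype.card J

/-- Boxes suffice: the preimage of a product of two boxes is again one, with the sides swapped at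
the coordinates of sign `-1`. -/
theorem measurePreserving_exchange (Q : Measure B) [IsProbabilityMeasure Q] (ρ : J → ℤˣ) :
    MeasurePreserving (exchange (B := B) ρ)
      ((Measure.pi fun _ : J => Q).prod (Measure.pi fun _ : J => Q))
      ((Measure.pi fun _ : J => Q).prod (Measure.pi fun _ : J => Q)) := by
  have hm : Measurable (exchange (B := B) ρ) := (measurable_select ρ).prodMk (measurable_select _)
  refine ⟨hm, ?_⟩
  refine (Measure.prod_eq_generateFrom generateFrom_pi generateFrom_pi isPiSystem_pi isPiSystem_pi
    (Measure.FiniteSpanningSetsIn.pi fun _ => Q.toFiniteSpanningSetsIn)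
    (Measure.FiniteSpanningSetsIn.pi fun _ => Q.toFiniteSpanningSetsIn) ?_).symm
  rintro _ ⟨s, hs, rfl⟩ _ ⟨t, ht, rfl⟩
  have hs' : ∀ j, MeasurableSet (s j) := fun j => hs j trivial
  have ht' : ∀ j, MeasurableSet (t j) := fun j => ht j trivial
  rw [Measure.map_apply hm
    ((MeasurableSet.univ_pi hs').prod (MeasurableSet.univ_pi ht'))]
  have hpre : exchange ρ ⁻¹' (Set.univ.pi s ×ˢ Set.univ.pi t) =
      (Set.univ.pi fun j => if ρ j = 1 then s j else t j) ×ˢ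
        (Set.univ.pi fun j => if ρ j = 1 then t j else s j) := by
    ext p
    simp only [Set.mem_preimage, Set.mem_prod, Set.mem_univ_pi, exchange, select]
    rw [← forall_and, ← forall_and]
    refine forall_congr' fun j => ?_
    rcases Int.units_eq_one_or (ρ j) with h | h <;> simp [h, and_comm]
  rw [hpre, Measure.prod_prod, Measure.pi_pi, Measure.pi_pi, Measure.pi_pi, Measure.pi_pi,
    ← Finset.prod_mul_distrib, ← Finset.prod_mul_distrib]
  refine Finset.prod_congr rfl fun j _ => ?_
  split_ifs
  · rfl
  · exact mul_comm _ _

variable [DecidableEq J]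

/-- Symmetrization and contraction for a class that need not be measurable. Measurable majorants of
the signed sums are rounded to countably many values; the supremum over all pairs of samples with
the same codes is then a measurable majorant that exchanges of coordinates respect. -/
theorem outerExpectation_ghostSup_le (Q : Measure B) [IsProbabilityMeasure Q] (a : ι → B → ℝ)
    {φ : J → ℝ → ℝ} {L : ℝ} (hL : 0 < L) (hφ : ∀ j s t, |φ j s - φ j t| ≤ L * |s - t|)
    (hφ0 : ∀ j, φ j 0 = 0) :
    outerExpectation ((Measure.pi fun _ : J => Q).prod (Measure.pi fun _ : J => Q))
      (ghostSup φ a) ≤ 2 * ENNReal.ofReal L * rademacherSup Q J a := by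
  choose H hH hle hint using fun σ : J → ℤˣ =>
    exists_measurable_majorant (Measure.pi fun _ : J => Q) (signedSumSup a σ)
  refine ENNReal.le_of_forall_pos_le_add fun ε hε _ => ?_
  -- The total rounding error is `2 * L * δ = ε`.
  set δ : ℝ := ε / (2 * L) with hδdef
  have hδ : 0 < δ := by positivity
  set κ : (J → B) → (J → ℤˣ) → ℕ := fun x σ => roundCode δ (H σ x)
  have hκ : Measurable κ := measurable_pi_lambda _ fun σ => (measurable_roundCode δ).comp (hH σ)
  -- `K` records the codes of all selections of the pair, including both samples themselves (`τ = 1`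
  -- and `τ = -1`), so that an exchange merely translates the index `τ`.
  set K : (J → B) × (J → B) → (J → ℤˣ) → (J → ℤˣ) → ℕ := fun p τ => κ (select τ p)
  have hK : Measurable K := measurable_pi_lambda _ fun τ => hκ.comp (measurable_select τ)
  have hKex : ∀ ρ p, K (exchange ρ p) = fun τ => K p (τ * ρ) := by
    intro ρ p; funext τ; simp only [K, select_exchange]
  -- `Φ` lives on a countable discrete space and hence is measurable, whatever the class is.
  set Φ : ((J → ℤˣ) → (J → ℤˣ) → ℕ) → ℝ≥0∞ := fun k =>
    ⨆ q : {q : (J → B) × (J → B) // K q = k}, ghostSup φ a q.1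
  have hΦ : Measurable fun p => Φ (K p) := (Measurable.of_discrete (f := Φ)).comp hK
  have hge : ghostSup φ a ≤ fun p => Φ (K p) := fun p =>
    le_iSup (fun q : {q : (J → B) × (J → B) // K q = K p} => ghostSup φ a q.1) ⟨p, rfl⟩
  set M := (Measure.pi fun _ : J => Q).prod (Measure.pi fun _ : J => Q)
  set c : (J → B) → (J → ℤˣ) → ℝ≥0∞ := fun x ρ => roundVal δ (κ x ρ)
  have hcm : ∀ ρ, Measurable fun x => c x ρ := fun ρ =>
    (Measurable.of_discrete (f := roundVal δ)).comp ((measurable_pi_apply ρ).comp hκ)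
  have hpt : ∀ p, ∑ ρ : J → ℤˣ, Φ (K (exchange ρ p)) ≤
      ENNReal.ofReal L * (∑ ρ, c p.1 ρ + ∑ ρ, c p.2 ρ) := by
    intro p
    -- The exchange by `ρ` maps the fibre of `K` through `exchange ρ p` into the fibre through `p`.
    -- All patterns thus share one index set, as contraction requires, and on it the signed sums are
    -- bounded by the common rounded majorants.
    let κ' := ι × {q : (J → B) × (J → B) // K q = K p}
    have hbound : ∀ (τ : J → ℤˣ) (k : κ') (ρ : J → ℤˣ),
        ENNReal.ofReal |∑ j, ((ρ j : ℤ) : ℝ) * a k.1 (select τ k.2.1 j)| ≤ c (select τ p) ρ := by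
      intro τ k ρ
      have h1 : c (select τ p) ρ = roundVal δ (roundCode δ (H ρ (select τ k.2.1))) := by
        have h2 : κ (select τ k.2.1) ρ = κ (select τ p) ρ := congrFun (congrFun k.2.2 τ) ρ
        simp only [c, ← h2]; rfl
      rw [h1]
      refine le_trans ?_ (le_roundVal_roundCode hδ _)
      exact (le_iSup (fun u => ENNReal.ofReal
        |∑ j, ((ρ j : ℤ) : ℝ) * a u (select τ k.2.1 j)|) k.1).trans (hle ρ _)
    have hb1 := hbound 1
    have hb2 := hbound (-1)
    simp only [select_one] at hb1
    simp only [select_neg_one] at hb2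
    have := sum_iSup_ghost_le hL.le hφ hφ0 (κ := κ') (fun k j => a k.1 (k.2.1.1 j))
      (fun k j => a k.1 (k.2.1.2 j)) (c p.1) (c p.2) hb1 hb2
    refine le_trans (Finset.sum_le_sum fun ρ _ => ?_) this
    refine iSup_le fun q => ?_
    have hq : K (exchange ρ q.1) = K p := by
      have h1 := hKex ρ q.1
      rw [h1, q.2, hKex ρ p]
      funext τ
      have : ρ * ρ = 1 := by funext j; simp
      simp only [mul_assoc, this, mul_one]
    have h2 := ghostSup_exchange φ a ρ (exchange ρ q.1)
    rw [exchange_exchange] at h2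
    refine h2.trans (iSup_le fun u => ?_)
    exact le_iSup (fun k : κ' => ENNReal.ofReal (∑ j, ((ρ j : ℤ) : ℝ) *
      (φ j (a k.1 (k.2.1.1 j)) - φ j (a k.1 (k.2.1.2 j))))) (u, ⟨exchange ρ q.1, hq⟩)
  have hcard : Fintype.card (J → ℤˣ) = 2 ^ Fintype.card J := by simp
  have hmul : (2 : ℝ≥0∞) ^ Fintype.card J * ∫⁻ p, Φ (K p) ∂M ≤
      -- Exchanges preserve the product measure, so the integral of the majorant equals its average
      -- over all patterns.
      2 * ENNReal.ofReal L * ∑ ρ : J → ℤˣ, (outerExpectation (Measure.pi fun _ : J => Q)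
        (signedSumSup a ρ) + ENNReal.ofReal δ) := by
    calc (2 : ℝ≥0∞) ^ Fintype.card J * ∫⁻ p, Φ (K p) ∂M
        = ∑ ρ : J → ℤˣ, ∫⁻ p, Φ (K (exchange ρ p)) ∂M := by
          have : ∀ ρ : J → ℤˣ, ∫⁻ p, Φ (K (exchange ρ p)) ∂M = ∫⁻ p, Φ (K p) ∂M := fun ρ =>
            (measurePreserving_exchange Q ρ).lintegral_comp hΦ
          simp only [this, Finset.sum_const, Finset.card_univ, hcard, nsmul_eq_mul]
          push_cast; rfl
      _ = ∫⁻ p, ∑ ρ : J → ℤˣ, Φ (K (exchange ρ p)) ∂M :=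
          (lintegral_finsetSum _ fun ρ _ =>
            hΦ.comp (measurePreserving_exchange Q ρ).measurable).symm
      _ ≤ ∫⁻ p, ENNReal.ofReal L * (∑ ρ, c p.1 ρ + ∑ ρ, c p.2 ρ) ∂M := lintegral_mono hpt
      _ = ENNReal.ofReal L * (∑ ρ, ∫⁻ x, c x ρ ∂(Measure.pi fun _ : J => Q) +
            ∑ ρ, ∫⁻ x, c x ρ ∂(Measure.pi fun _ : J => Q)) := by
          have hs : Measurable fun x => ∑ ρ, c x ρ :=
            Finset.measurable_sum _ fun ρ _ => hcm ρ
          have h1 : Measurable fun p : (J → B) × (J → B) => ∑ ρ, c p.1 ρ := hs.comp measurable_fst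
          have h2 : Measurable fun p : (J → B) × (J → B) => ∑ ρ, c p.2 ρ := hs.comp measurable_snd
          have h3 : ∫⁻ p, ∑ ρ, c p.1 ρ ∂M = ∫⁻ x, ∑ ρ, c x ρ ∂(Measure.pi fun _ : J => Q) :=
            measurePreserving_fst.lintegral_comp hs
          have h4 : ∫⁻ p, ∑ ρ, c p.2 ρ ∂M = ∫⁻ x, ∑ ρ, c x ρ ∂(Measure.pi fun _ : J => Q) :=
            measurePreserving_snd.lintegral_comp hs
          have h5 : Measurable fun p : (J → B) × (J → B) => ∑ ρ, c p.1 ρ + ∑ ρ, c p.2 ρ := h1.add h2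
          rw [lintegral_const_mul _ h5, lintegral_add_left h1, h3, h4,
            lintegral_finsetSum _ fun ρ _ => hcm ρ]
      _ = 2 * ENNReal.ofReal L * ∑ ρ, ∫⁻ x, c x ρ ∂(Measure.pi fun _ : J => Q) := by ring
      _ ≤ _ := by
          gcongr with ρ
          rw [← hint ρ]
          calc ∫⁻ x, c x ρ ∂(Measure.pi fun _ : J => Q)
              ≤ ∫⁻ x, (H ρ x + ENNReal.ofReal δ) ∂(Measure.pi fun _ : J => Q) :=
                lintegral_mono fun x => roundVal_roundCode_le hδ _
            _ = _ := by rw [lintegral_add_left (hH ρ)]; simp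
  have htwo : (2 : ℝ≥0∞) ^ Fintype.card J ≠ 0 := by simp
  have htwo' : (2 : ℝ≥0∞) ^ Fintype.card J ≠ ⊤ := by simp
  refine (outerExpectation_le_lintegral hΦ hge).trans ?_
  rw [mul_comm, ← ENNReal.le_div_iff_mul_le (Or.inl htwo) (Or.inl htwo')] at hmul
  refine hmul.trans (le_of_eq ?_)
  rw [Finset.sum_add_distrib, Finset.sum_const, Finset.card_univ, hcard, nsmul_eq_mul,
    mul_add, ENNReal.add_div, rademacherSup, mul_div_assoc]
  congr 1
  have h2L : 2 * ENNReal.ofReal L * ENNReal.ofReal δ = ε := by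
    rw [show (2 : ℝ≥0∞) = ENNReal.ofReal 2 by simp, ← ENNReal.ofReal_mul (by norm_num),
      ← ENNReal.ofReal_mul (by positivity), hδdef, mul_div_cancel₀ _ (by positivity)]
    simp
  push_cast
  rw [mul_left_comm, h2L, mul_comm, mul_div_assoc, ENNReal.div_self htwo htwo', mul_one]

/-- The expected deviations of a class, for any coordinatewise Lipschitz image of the class. -/
theorem outerExpectation_deviation_le (Q : Measure B) [IsProbabilityMeasure Q] (a : ι → B → ℝ)
    {φ : J → ℝ → ℝ} {L : ℝ} (hL : 0 < L) (hφ : ∀ j s t, |φ j s - φ j t| ≤ L * |s - t|)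
    (hφ0 : ∀ j, φ j 0 = 0) (hint : ∀ u j, Integrable (fun b => φ j (a u b)) Q) :
    outerExpectation (Measure.pi fun _ : J => Q)
      (fun x => ⨆ u, ENNReal.ofReal |∑ j, (φ j (a u (x j)) - ∫ b, φ j (a u b) ∂Q)|) ≤
      4 * ENNReal.ofReal L * rademacherSup Q J a := by
  -- The expectation is written as an integral over an independent ghost sample and taken out of the
  -- absolute value. The two one-sided suprema, for `φ` and `-φ`, dominate that absolute value.
  have key := outerExpectation_le_of_section (P := Measure.pi fun _ : J => Q)
    (P' := Measure.pi fun _ : J => Q) (c := 0)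
    (f := fun x => ⨆ u, ENNReal.ofReal |∑ j, (φ j (a u (x j)) - ∫ b, φ j (a u b) ∂Q)|)
    (g := fun p => ghostSup φ a p + ghostSup (fun j t => -φ j t) a p) ?_
  · rw [zero_add] at key
    refine key.trans ((outerExpectation_add_le _ _).trans ?_)
    have h1 := outerExpectation_ghostSup_le Q a hL hφ hφ0
    have h2 := outerExpectation_ghostSup_le (φ := fun j t => -φ j t) Q a hL
      (fun j s t => by rw [← abs_neg]; convert hφ j s t using 2; ring) (fun j => by simp [hφ0 j])
    refine (add_le_add h1 h2).trans (le_of_eq ?_)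
    rw [← two_mul]; ring
  intro G hG hle x
  rw [zero_add]
  refine iSup_le fun u => ?_
  have hi : Integrable (fun x' : J → B => ∑ j, (φ j (a u (x j)) - φ j (a u (x' j))))
      (Measure.pi fun _ : J => Q) := by
    refine integrable_finsetSum _ fun j _ => (integrable_const _).sub ?_
    exact (measurePreserving_eval (fun _ : J => Q) j).integrable_comp_of_integrable (hint u j)
  have heq : ∑ j, (φ j (a u (x j)) - ∫ b, φ j (a u b) ∂Q) =
      ∫ x', ∑ j, (φ j (a u (x j)) - φ j (a u (x' j))) ∂(Measure.pi fun _ : J => Q) := by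
    rw [integral_finsetSum]
    · refine Finset.sum_congr rfl fun j _ => ?_
      have hij := (measurePreserving_eval (fun _ : J => Q) j).integrable_comp_of_integrable
        (hint u j)
      have h3 : ∫ x' : J → B, φ j (a u (x' j)) ∂(Measure.pi fun _ : J => Q) =
          ∫ b, φ j (a u b) ∂Q := by
        have hmap := (measurePreserving_eval (fun _ : J => Q) j).map_eq
        conv_rhs => rw [← hmap]
        exact (integral_map (measurable_pi_apply j).aemeasurable
          (by rw [hmap]; exact (hint u j).aestronglyMeasurable)).symm
      refine Eq.trans ?_ (integral_sub (integrable_const _) hij).symm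
      simp only [Function.comp_def, Function.eval, h3, integral_const]
      simp
    · intro j _
      exact (integrable_const _).sub
        ((measurePreserving_eval (fun _ : J => Q) j).integrable_comp_of_integrable (hint u j))
  rw [heq]
  calc ENNReal.ofReal |∫ x', ∑ j, (φ j (a u (x j)) - φ j (a u (x' j))) ∂(Measure.pi fun _ => Q)|
      ≤ ∫⁻ x', ENNReal.ofReal |∑ j, (φ j (a u (x j)) - φ j (a u (x' j)))|
          ∂(Measure.pi fun _ => Q) := by
        rw [← ofReal_integral_eq_lintegral_ofReal hi.abs (ae_of_all _ fun _ => abs_nonneg _)]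
        exact ENNReal.ofReal_le_ofReal (abs_integral_le_integral_abs)
    _ ≤ _ := by
        refine lintegral_mono fun x' => le_trans ?_ (hle (x, x'))
        rcases abs_cases (∑ j, (φ j (a u (x j)) - φ j (a u (x' j)))) with ⟨h, _⟩ | ⟨h, _⟩
        · rw [h]
          exact (le_iSup (fun u => ENNReal.ofReal
            (∑ j, (φ j (a u (x j)) - φ j (a u (x' j))))) u).trans le_self_add
        · rw [h, ← Finset.sum_neg_distrib]
          refine le_trans (le_of_eq ?_) ((le_iSup (fun u => ENNReal.ofReal
            (∑ j, (-φ j (a u (x j)) - -φ j (a u (x' j))))) u).trans le_add_self)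
          congr 1
          exact Finset.sum_congr rfl fun j _ => by ring

/-- The expected supremum of the sums of a nonnegative Lipschitz image of the class. -/
theorem outerExpectation_iSup_sum_le (Q : Measure B) [IsProbabilityMeasure Q] (a : ι → B → ℝ)
    {ψ : ℝ → ℝ} {L p : ℝ} (hL : 0 < L) (hψ : ∀ s t, |ψ s - ψ t| ≤ L * |s - t|)
    (hψ0 : ψ 0 = 0) (hint : ∀ u, Integrable (fun b => ψ (a u b)) Q)
    (hp : ∀ u, ∫ b, ψ (a u b) ∂Q ≤ p) :
    outerExpectation (Measure.pi fun _ : J => Q)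
      (fun x => ⨆ u, ENNReal.ofReal (∑ j, ψ (a u (x j)))) ≤
      ENNReal.ofReal (Fintype.card J * p) + 4 * ENNReal.ofReal L * rademacherSup Q J a := by
  have h := outerExpectation_deviation_le (J := J) (φ := fun _ => ψ) Q a hL (fun _ => hψ)
    (fun _ => hψ0) (fun u _ => hint u)
  refine le_trans ?_ (add_le_add le_rfl h)
  have hc : outerExpectation (Measure.pi fun _ : J => Q)
      (fun _ => ENNReal.ofReal (Fintype.card J * p)) ≤ ENNReal.ofReal (Fintype.card J * p) :=
    (outerExpectation_le_lintegral measurable_const le_rfl).trans (by simp)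
  refine le_trans ?_ (add_le_add hc le_rfl)
  refine le_trans (outerExpectation_mono fun x => ?_) (outerExpectation_add_le _ _)
  refine iSup_le fun u => ?_
  have h1 : ∑ j, ψ (a u (x j)) ≤ Fintype.card J * p +
      |∑ j, (ψ (a u (x j)) - ∫ b, ψ (a u b) ∂Q)| := by
    have := le_abs_self (∑ j, (ψ (a u (x j)) - ∫ b, ψ (a u b) ∂Q))
    rw [Finset.sum_sub_distrib, Finset.sum_const, Finset.card_univ, nsmul_eq_mul] at this ⊢
    have h2 : (Fintype.card J : ℝ) * ∫ b, ψ (a u b) ∂Q ≤ Fintype.card J * p :=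
      mul_le_mul_of_nonneg_left (hp u) (by positivity)
    linarith
  refine (ENNReal.ofReal_le_ofReal h1).trans (ENNReal.ofReal_add_le.trans ?_)
  gcongr
  exact le_iSup (fun u => ENNReal.ofReal |∑ j, (ψ (a u (x j)) - ∫ b, ψ (a u b) ∂Q)|) u

end Symmetrization

/-! ### Bounded differences without measurability -/

section BoundedDifferences

variable {B C : Type*} [MeasurableSpace B] [MeasurableSpace C]

theorem ae_ae_of_ae_prod_right {Q : Measure B} {ν : Measure C} [SFinite Q] [SFinite ν]
    {p : B × C → Prop} (hp : ∀ᵐ q ∂Q.prod ν, p q) : ∀ᵐ z ∂ν, ∀ᵐ x ∂Q, p (x, z) :=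
  Measure.ae_ae_of_ae_prod
    ((Measure.measurePreserving_swap (μ := ν) (ν := Q)).quasiMeasurePreserving.ae hp)

/-- Hoeffding's lemma for a random variable that varies by at most one. -/
theorem lintegral_exp_le_of_oscillation (Q : Measure B) [IsProbabilityMeasure Q] {X : B → ℝ}
    (hX : Measurable X) {M : ℝ} (hM : ∀ x, |X x| ≤ M) (hosc : ∀ᵐ x ∂Q, ∀ᵐ w ∂Q, X x ≤ X w + 1)
    (t : ℝ) :
    ∫⁻ x, ENNReal.ofReal (Real.exp (t * X x)) ∂Q ≤
      ENNReal.ofReal (Real.exp (t * ∫ x, X x ∂Q + t ^ 2 / 2)) := by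
  have hint : Integrable X Q := Integrable.of_bound hX.aestronglyMeasurable M (ae_of_all _ hM)
  have hup : ∀ᵐ x ∂Q, X x ≤ ∫ w, X w ∂Q + 1 := by
    filter_upwards [hosc] with x hx
    have := integral_mono_ae (integrable_const (X x)) (hint.add (integrable_const 1)) hx
    simpa [integral_add hint (integrable_const _)] using this
  have hlow : ∀ᵐ w ∂Q, ∫ x, X x ∂Q ≤ X w + 1 := by
    have hms : MeasurableSet {q : B × B | X q.1 ≤ X q.2 + 1} :=
      measurableSet_le (hX.comp measurable_fst) ((hX.comp measurable_snd).add_const 1)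
    have hsw := (Measure.ae_ae_comm hms).1 hosc
    filter_upwards [hsw] with w hw
    have := integral_mono_ae hint (integrable_const (X w + 1)) hw
    simpa using this
  -- The two bounds place `X - E X` in `[-1, 1]`. The resulting variance proxy `1` is not optimal
  -- but sufficient.
  have hsub : HasSubgaussianMGF (fun x => X x - ∫ w, X w ∂Q) ((‖(1 : ℝ) - (-1)‖₊ / 2) ^ 2) Q := by
    refine hasSubgaussianMGF_of_mem_Icc_of_integral_eq_zero (hX.sub_const _).aemeasurable ?_ ?_
    · filter_upwards [hup, hlow] with x h1 h2
      exact ⟨by linarith, by linarith⟩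
    · simp [integral_sub hint (integrable_const _)]
  have hmgf := hsub.mgf_le t
  have hc : (((‖(1 : ℝ) - (-1)‖₊ / 2) ^ 2 : NNReal) : ℝ) = 1 := by
    push_cast; norm_num
  rw [hc, one_mul] at hmgf
  have hie := hsub.integrable_exp_mul t
  have heq : ∀ x, ENNReal.ofReal (Real.exp (t * X x)) =
      ENNReal.ofReal (Real.exp (t * ∫ w, X w ∂Q)) *
        ENNReal.ofReal (Real.exp (t * (X x - ∫ w, X w ∂Q))) := by
    intro x
    rw [← ENNReal.ofReal_mul (Real.exp_pos _).le, ← Real.exp_add]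
    congr 2; ring
  simp only [heq]
  rw [lintegral_const_mul' _ _ ENNReal.ofReal_ne_top, Real.exp_add,
    ENNReal.ofReal_mul (Real.exp_pos _).le]
  gcongr
  rw [← ofReal_integral_eq_lintegral_ofReal hie (ae_of_all _ fun _ => (Real.exp_pos _).le)]
  exact ENNReal.ofReal_le_ofReal hmgf

theorem measurePreserving_cons (Q : Measure B) [IsProbabilityMeasure Q] (n : ℕ) :
    MeasurePreserving (fun p : B × (Fin n → B) => (Fin.cons p.1 p.2 : Fin (n + 1) → B))
      (Q.prod (Measure.pi fun _ : Fin n => Q)) (Measure.pi fun _ : Fin (n + 1) => Q) := by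
  have h := (measurePreserving_piFinSuccAbove (fun _ : Fin (n + 1) => Q) 0).symm
  convert h using 1
  funext p
  simp [MeasurableEquiv.piFinSuccAbove_symm_apply, Fin.consEquiv]

/-- Induction on the number of coordinates: Hoeffding's lemma integrates out the first one, and the
partial mean inherits the bounded differences. The differences are bounded only almost everywhere
because the intended `g` is a measurable majorant, about which nothing more is known. -/
theorem lintegral_exp_le_of_ae_bounded_difference (Q : Measure B) [IsProbabilityMeasure Q] (t : ℝ)
    {n : ℕ} {g : (Fin n → B) → ℝ} (hg : Measurable g) {M : ℝ} (hM : ∀ x, |g x| ≤ M)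
    (hdiff : ∀ i w, ∀ᵐ x ∂(Measure.pi fun _ : Fin n => Q), g x ≤ g (Function.update x i w) + 1) :
    ∫⁻ x, ENNReal.ofReal (Real.exp (t * g x)) ∂(Measure.pi fun _ : Fin n => Q) ≤
      ENNReal.ofReal (Real.exp (t * ∫ x, g x ∂(Measure.pi fun _ : Fin n => Q) +
        n * t ^ 2 / 2)) := by
  induction n with
  | zero =>
    rw [Measure.pi_of_empty]
    have : ∀ x : Fin 0 → B, x = fun a => isEmptyElim a := fun x => Subsingleton.elim _ _
    have hm : Measurable fun x => ENNReal.ofReal (Real.exp (t * g x)) := by fun_prop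
    rw [lintegral_dirac' _ hm, integral_dirac' _ _ hg.stronglyMeasurable]
    simp
  | succ n ih =>
    have hcons := measurePreserving_cons Q n
    set ν := Measure.pi fun _ : Fin n => Q
    set G : B × (Fin n → B) → ℝ := fun p => g (Fin.cons p.1 p.2)
    have hG : Measurable G := hg.comp hcons.measurable
    have hGM : ∀ p, |G p| ≤ M := fun p => hM _
    have hGi : Integrable G (Q.prod ν) :=
      Integrable.of_bound hG.aestronglyMeasurable M (ae_of_all _ hGM)
    have hGz : ∀ z, Measurable fun x => G (x, z) := fun z =>
      hG.comp (measurable_id.prodMk measurable_const)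
    have hGzi : ∀ z, Integrable (fun x => G (x, z)) Q := fun z =>
      Integrable.of_bound (hGz z).aestronglyMeasurable M (ae_of_all _ fun x => hGM _)
    set g' : (Fin n → B) → ℝ := fun z => ∫ x, G (x, z) ∂Q
    have hg' : Measurable g' := (hG.stronglyMeasurable.integral_prod_left').measurable
    have hg'M : ∀ z, |g' z| ≤ M := by
      intro z
      have := norm_integral_le_of_norm_le_const (μ := Q) (f := fun x => G (x, z)) (C := M)
        (ae_of_all _ fun x => hGM _)
      simpa using this
    have hdiff' : ∀ i w, ∀ᵐ z ∂ν, g' z ≤ g' (Function.update z i w) + 1 := by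
      intro i w
      have h1 := hcons.quasiMeasurePreserving.ae (hdiff i.succ w)
      filter_upwards [ae_ae_of_ae_prod_right h1] with z hz
      have h2 : ∀ᵐ x ∂Q, G (x, z) ≤ G (x, Function.update z i w) + 1 := by
        filter_upwards [hz] with x hx
        simpa only [G, Fin.cons_update] using hx
      have := integral_mono_ae (hGzi z) ((hGzi _).add (integrable_const 1)) h2
      simpa [integral_add (hGzi _) (integrable_const _), g'] using this
    have hosc : ∀ᵐ z ∂ν, ∀ᵐ x ∂Q, ∀ᵐ w ∂Q, G (x, z) ≤ G (w, z) + 1 := by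
      have hms : MeasurableSet {q : B × (B × (Fin n → B)) | G q.2 ≤ G (q.1, q.2.2) + 1} := by
        refine measurableSet_le (hG.comp measurable_snd) ((hG.comp ?_).add_const 1)
        exact measurable_fst.prodMk (measurable_snd.comp measurable_snd)
      have h0 : ∀ᵐ w ∂Q, ∀ᵐ p ∂Q.prod ν, G p ≤ G (w, p.2) + 1 := ae_of_all _ fun w => by
        have h1 := hcons.quasiMeasurePreserving.ae (hdiff 0 w)
        filter_upwards [h1] with p hp
        simpa only [G, Fin.update_cons_zero] using hp
      exact ae_ae_of_ae_prod_right (p := fun p => ∀ᵐ w ∂Q, G p ≤ G (w, p.2) + 1)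
        ((Measure.ae_ae_comm (p := fun w p => G p ≤ G (w, p.2) + 1) hms).1 h0)
    have hint : ∫ x, g x ∂(Measure.pi fun _ : Fin (n + 1) => Q) = ∫ z, g' z ∂ν := by
      rw [← hcons.map_eq, integral_map hcons.measurable.aemeasurable
        hg.aestronglyMeasurable, integral_prod_symm _ hGi]
    have hexp : Measurable fun x => ENNReal.ofReal (Real.exp (t * g x)) := by fun_prop
    have hexpG : Measurable fun p => ENNReal.ofReal (Real.exp (t * G p)) := by fun_prop
    calc ∫⁻ x, ENNReal.ofReal (Real.exp (t * g x)) ∂(Measure.pi fun _ : Fin (n + 1) => Q)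
        = ∫⁻ p, ENNReal.ofReal (Real.exp (t * G p)) ∂Q.prod ν := (hcons.lintegral_comp hexp).symm
      _ = ∫⁻ z, ∫⁻ x, ENNReal.ofReal (Real.exp (t * G (x, z))) ∂Q ∂ν :=
          lintegral_prod_symm' _ hexpG
      _ ≤ ∫⁻ z, ENNReal.ofReal (Real.exp (t * g' z)) *
            ENNReal.ofReal (Real.exp (t ^ 2 / 2)) ∂ν := by
          refine lintegral_mono_ae ?_
          filter_upwards [hosc] with z hz
          rw [← ENNReal.ofReal_mul (Real.exp_pos _).le, ← Real.exp_add]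
          exact lintegral_exp_le_of_oscillation Q (hGz z) (fun x => hGM _) hz t
      _ ≤ ENNReal.ofReal (Real.exp (t * ∫ z, g' z ∂ν + n * t ^ 2 / 2)) *
            ENNReal.ofReal (Real.exp (t ^ 2 / 2)) := by
          rw [lintegral_mul_const' _ _ ENNReal.ofReal_ne_top]
          gcongr
          exact ih hg' hg'M hdiff'
      _ = _ := by
          rw [← ENNReal.ofReal_mul (Real.exp_pos _).le, ← Real.exp_add, hint]
          congr 2; push_cast; ring

/-- McDiarmid's inequality for a function that need not be measurable. -/
theorem measure_ge_le_of_bounded_difference (Q : Measure B) [IsProbabilityMeasure Q] {n : ℕ}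
    (hn : 0 < n) {G : (Fin n → B) → ℝ} {M : ℝ} (hM : ∀ x, G x ≤ M)
    (hdiff : ∀ i w x, G x ≤ G (Function.update x i w) + 1) {m t : ℝ} (hm : 0 ≤ m) (ht : 0 ≤ t)
    (hE : outerExpectation (Measure.pi fun _ : Fin n => Q) (fun x => ENNReal.ofReal (G x)) ≤
      ENNReal.ofReal m) :
    (Measure.pi fun _ : Fin n => Q) {x | m + t ≤ G x} ≤
      ENNReal.ofReal (Real.exp (-(t ^ 2 / (2 * n)))) := by
  set ν := Measure.pi fun _ : Fin n => Q
  obtain ⟨F₀, hF₀, hle₀, hint₀⟩ := exists_measurable_majorant ν fun x => ENNReal.ofReal (G x)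
  -- Truncation at the bound `M` keeps the majorant optimal and makes it finite.
  set F : (Fin n → B) → ℝ≥0∞ := fun x => min (F₀ x) (ENNReal.ofReal M)
  have hF : Measurable F := hF₀.min measurable_const
  have hle : ∀ x, ENNReal.ofReal (G x) ≤ F x := fun x =>
    le_min (hle₀ x) (ENNReal.ofReal_le_ofReal (hM x))
  have hFtop : ∀ x, F x ≠ ⊤ := fun x =>
    ne_top_of_le_ne_top ENNReal.ofReal_ne_top (min_le_right _ _)
  have hFint : ∫⁻ x, F x ∂ν = outerExpectation ν fun x => ENNReal.ofReal (G x) :=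
    le_antisymm (hint₀ ▸ lintegral_mono fun x => min_le_left _ _)
      (outerExpectation_le_lintegral hF hle)
  have hFfin : ∫⁻ x, F x ∂ν ≠ ⊤ := by
    rw [hFint]; exact ne_top_of_le_ne_top ENNReal.ofReal_ne_top hE
  -- The minimum of `F` and `F ∘ update + 1` is again a measurable majorant of the positive part of
  -- `G`. As the integral of `F` is minimal, the minimum equals `F` almost everywhere.
  have hFdiff : ∀ i w, ∀ᵐ x ∂ν, F x ≤ F (Function.update x i w) + 1 := by
    intro i w
    have hu : Measurable fun x : Fin n → B => Function.update x i w :=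
      measurable_pi_lambda _ fun k => by
        by_cases hk : k = i
        · subst hk; simp
        · simpa [Function.update_of_ne hk] using measurable_pi_apply k
    have hFu : Measurable fun x => F (Function.update x i w) + 1 := (hF.comp hu).add_const 1
    have hmaj : ∀ x, ENNReal.ofReal (G x) ≤ min (F x) (F (Function.update x i w) + 1) := by
      refine fun x => le_min (hle x) ?_
      refine (ENNReal.ofReal_le_ofReal (hdiff i w x)).trans (ENNReal.ofReal_add_le.trans ?_)
      simpa using hle _
    have hae := ae_eq_of_ae_le_of_lintegral_le (μ := ν)
      (f := fun x => min (F x) (F (Function.update x i w) + 1)) (g := F)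
      (ae_of_all _ fun x => min_le_left _ _)
      (ne_top_of_le_ne_top hFfin (lintegral_mono fun x => min_le_left _ _)) hF.aemeasurable
      (hFint ▸ outerExpectation_le_lintegral (hF.min hFu) hmaj)
    filter_upwards [hae] with x hx
    exact hx ▸ min_le_right _ _
  set g : (Fin n → B) → ℝ := fun x => (F x).toReal
  have hg : Measurable g := hF.ennreal_toReal
  have hgM : ∀ x, |g x| ≤ (ENNReal.ofReal M).toReal := fun x => by
    rw [abs_of_nonneg ENNReal.toReal_nonneg]
    exact ENNReal.toReal_mono ENNReal.ofReal_ne_top (min_le_right _ _)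
  have hGg : ∀ x, G x ≤ g x := fun x => (ENNReal.ofReal_le_iff_le_toReal (hFtop x)).1 (hle x)
  have hgdiff : ∀ i w, ∀ᵐ x ∂ν, g x ≤ g (Function.update x i w) + 1 := by
    intro i w
    filter_upwards [hFdiff i w] with x hx
    have := ENNReal.toReal_mono (ENNReal.add_ne_top.2 ⟨hFtop _, ENNReal.one_ne_top⟩) hx
    rwa [ENNReal.toReal_add (hFtop _) ENNReal.one_ne_top, ENNReal.toReal_one] at this
  have hgint : ∫ x, g x ∂ν ≤ m := by
    rw [integral_toReal hF.aemeasurable (ae_of_all _ fun x => (hFtop x).lt_top), hFint]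
    exact ENNReal.toReal_le_of_le_ofReal hm hE
  -- This minimizes the exponent `n * s ^ 2 / 2 - s * t` of the Chernoff bound.
  set s : ℝ := t / n
  have hs : 0 ≤ s := by positivity
  have hmgf := lintegral_exp_le_of_ae_bounded_difference Q s hg hgM hgdiff
  have hsub : {x | m + t ≤ G x} ⊆ {x | ENNReal.ofReal (Real.exp (s * (m + t))) ≤
      ENNReal.ofReal (Real.exp (s * g x))} := by
    intro x hx
    refine ENNReal.ofReal_le_ofReal (Real.exp_le_exp.2 ?_)
    exact mul_le_mul_of_nonneg_left (le_trans hx (hGg x)) hs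
  refine (measure_mono hsub).trans ?_
  have hmeas : Measurable fun x => ENNReal.ofReal (Real.exp (s * g x)) := by fun_prop
  refine (meas_ge_le_lintegral_div hmeas.aemeasurable
    (by simpa using Real.exp_pos _) ENNReal.ofReal_ne_top).trans ?_
  refine (ENNReal.div_le_div_right hmgf _).trans ?_
  rw [← ENNReal.ofReal_div_of_pos (Real.exp_pos _), ← Real.exp_sub]
  refine ENNReal.ofReal_le_ofReal (Real.exp_le_exp.2 ?_)
  have h1 : s * ∫ x, g x ∂ν ≤ s * m := mul_le_mul_of_nonneg_left hgint hs
  have hn' : (n : ℝ) ≠ 0 := by positivity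
  have h2 : (n : ℝ) * s ^ 2 / 2 - s * t = -(t ^ 2 / (2 * n)) := by
    simp only [s]; field_simp; ring
  linarith

end BoundedDifferences

/-! ### Splitting the sample into blocks -/

section Blocks

variable {Z : Type*} {N n m : ℕ}

/-- The sample, arranged into `n` blocks of length `m` at the positions `e`. -/
def blocks (e : Fin n × Fin m → Fin N) (D : Fin N → Z) : Fin n → Fin m → Z :=
  fun j k => D (e (j, k))

/-- Overwrite the positions `e` of a sample by the given blocks. -/
noncomputable def splice (e : Fin n × Fin m → Fin N) (p : (Fin n → Fin m → Z) × (Fin N → Z)) :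
    Fin N → Z :=
  Function.extend e (fun q => p.1 q.1 q.2) p.2

theorem blocks_splice {e : Fin n × Fin m → Fin N} (he : Function.Injective e)
    (p : (Fin n → Fin m → Z) × (Fin N → Z)) : blocks e (splice e p) = p.1 := by
  funext j k
  simp only [blocks, splice, he.extend_apply]

variable [MeasurableSpace Z]

/-- Independent blocks, completed by the unused coordinates of an independent sample, form a sample.
This gives a measure-preserving right inverse of `blocks`, up to auxiliary randomness. -/
theorem measurePreserving_splice (Q : Measure Z) [IsProbabilityMeasure Q]
    {e : Fin n × Fin m → Fin N} (he : Function.Injective e) :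
    MeasurePreserving (splice (Z := Z) e)
      ((Measure.pi fun _ : Fin n => Measure.pi fun _ : Fin m => Q).prod
        (Measure.pi fun _ : Fin N => Q)) (Measure.pi fun _ : Fin N => Q) := by
  classical
  have hmeas : Measurable (splice (Z := Z) e) := by
    refine measurable_pi_lambda _ fun i => ?_
    by_cases hi : ∃ q, e q = i
    · obtain ⟨q, rfl⟩ := hi
      simp only [splice, he.extend_apply]
      exact (measurable_pi_apply q.2).comp ((measurable_pi_apply q.1).comp measurable_fst)
    · simp only [splice, Function.extend_apply' _ _ _ hi]
      exact (measurable_pi_apply i).comp measurable_snd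
  refine ⟨hmeas, (Measure.pi_eq fun s hs => ?_).symm⟩
  rw [Measure.map_apply hmeas (MeasurableSet.univ_pi hs)]
  have hpre : splice e ⁻¹' Set.univ.pi s =
      (Set.univ.pi fun j => Set.univ.pi fun k => s (e (j, k))) ×ˢ
        Set.univ.pi fun i => if i ∈ Set.range e then Set.univ else s i := by
    ext p
    simp only [Set.mem_preimage, Set.mem_prod, Set.mem_univ_pi]
    constructor
    · intro h
      refine ⟨fun j k => ?_, fun i => ?_⟩
      · simpa only [splice, he.extend_apply] using h (e (j, k))
      · split_ifs with hi
        · trivial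
        · simpa only [splice, Function.extend_apply' _ _ _ hi] using h i
    · rintro ⟨h1, h2⟩ i
      by_cases hi : ∃ q, e q = i
      · obtain ⟨q, rfl⟩ := hi
        simp only [splice, he.extend_apply]
        exact h1 q.1 q.2
      · have := h2 i
        rw [if_neg (show i ∉ Set.range e from hi)] at this
        simpa only [splice, Function.extend_apply' _ _ _ hi] using this
  rw [hpre, Measure.prod_prod, Measure.pi_pi]
  simp only [Measure.pi_pi]
  have h1 : ∏ j, ∏ k, Q (s (e (j, k))) = ∏ i, if i ∈ Set.range e then Q (s i) else 1 := by
    rw [← Fintype.prod_prod_type' (f := fun j k => Q (s (e (j, k))))]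
    refine Fintype.prod_of_injective e he _ _ (fun i hi => if_neg hi) fun q => ?_
    rw [if_pos ⟨q, rfl⟩]
  rw [h1, ← Finset.prod_mul_distrib]
  refine Finset.prod_congr rfl fun i _ => ?_
  split_ifs <;> simp

theorem measurePreserving_blocks (Q : Measure Z) [IsProbabilityMeasure Q]
    {e : Fin n × Fin m → Fin N} (he : Function.Injective e) :
    MeasurePreserving (blocks (Z := Z) e) (Measure.pi fun _ : Fin N => Q)
      (Measure.pi fun _ : Fin n => Measure.pi fun _ : Fin m => Q) := by
  have hmeas : Measurable (blocks (Z := Z) e) :=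
    measurable_pi_lambda _ fun j => measurable_pi_lambda _ fun k => measurable_pi_apply _
  refine ⟨hmeas, ?_⟩
  have hs := measurePreserving_splice Q he
  rw [← hs.map_eq, Measure.map_map hmeas hs.measurable]
  have : blocks e ∘ splice (Z := Z) e = Prod.fst := funext fun p => blocks_splice he p
  rw [this, measurePreserving_fst.map_eq]

/-- This is the direction opposite to `outerExpectation_comp_le`. A majorant over full samples is
pulled back along `splice`, and averaging over the auxiliary sample leaves a majorant of `g`. -/
theorem outerExpectation_le_comp_blocks (Q : Measure Z) [IsProbabilityMeasure Q]
    {e : Fin n × Fin m → Fin N} (he : Function.Injective e) (g : (Fin n → Fin m → Z) → ℝ≥0∞) :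
    outerExpectation (Measure.pi fun _ : Fin n => Measure.pi fun _ : Fin m => Q) g ≤
      outerExpectation (Measure.pi fun _ : Fin N => Q) fun D => g (blocks e D) := by
  have h := outerExpectation_le_of_section
    (P := Measure.pi fun _ : Fin n => Measure.pi fun _ : Fin m => Q)
    (P' := Measure.pi fun _ : Fin N => Q) (f := g) (g := fun p => g (blocks e (splice e p))) 0 ?_
  · rw [zero_add] at h
    exact h.trans (outerExpectation_comp_le (measurePreserving_splice Q he)
      fun D => g (blocks e D))
  · intro G _ hle z
    rw [zero_add]
    calc g z = ∫⁻ _, g z ∂(Measure.pi fun _ : Fin N => Q) := by simp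
      _ ≤ _ := lintegral_mono fun w => by
        have := hle (z, w)
        simpa only [blocks_splice he] using this

end Blocks

/-! ### A Lipschitz substitute for the indicator of a large deviation -/

section Clip

/-- A Lipschitz function that dominates the indicator of `|t| > τ` and is at most `(t / τ)²`. -/
noncomputable def clipSq (τ t : ℝ) : ℝ := min (|t| / τ) 1 ^ 2

variable {τ : ℝ}

theorem clipSq_zero : clipSq τ 0 = 0 := by simp [clipSq]

theorem clipSq_nonneg (t : ℝ) : 0 ≤ clipSq τ t := sq_nonneg _

theorem clipSq_le_one (hτ : 0 < τ) (t : ℝ) : clipSq τ t ≤ 1 :=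
  pow_le_one₀ (le_min (by positivity) zero_le_one) (min_le_right _ _)

theorem clipSq_le_sq (hτ : 0 < τ) (t : ℝ) : clipSq τ t ≤ t ^ 2 / τ ^ 2 := by
  have h : 0 ≤ |t| / τ := by positivity
  calc clipSq τ t ≤ (|t| / τ) ^ 2 :=
        pow_le_pow_left₀ (le_min h zero_le_one) (min_le_left _ _) 2
    _ = t ^ 2 / τ ^ 2 := by rw [div_pow, sq_abs]

theorem clipSq_eq_one (hτ : 0 < τ) {t : ℝ} (ht : τ < |t|) : clipSq τ t = 1 := by
  have : 1 ≤ |t| / τ := (one_le_div hτ).2 ht.le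
  simp [clipSq, min_eq_right this]

theorem abs_clipSq_sub_le (hτ : 0 < τ) (s t : ℝ) :
    |clipSq τ s - clipSq τ t| ≤ 2 / τ * |s - t| := by
  have hb : ∀ x : ℝ, 0 ≤ min (|x| / τ) 1 ∧ min (|x| / τ) 1 ≤ 1 := fun x =>
    ⟨le_min (by positivity) zero_le_one, min_le_right _ _⟩
  have h1 : |min (|s| / τ) 1 - min (|t| / τ) 1| ≤ |s - t| / τ := by
    refine (abs_min_sub_min_le_max _ _ _ _).trans (max_le ?_ (by simp; positivity))
    rw [← sub_div, abs_div, abs_of_pos hτ]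
    exact div_le_div_of_nonneg_right (abs_abs_sub_abs_le_abs_sub s t) hτ.le
  have h2 : |min (|s| / τ) 1 + min (|t| / τ) 1| ≤ 2 := by
    rw [abs_of_nonneg (add_nonneg (hb s).1 (hb t).1)]
    linarith [(hb s).2, (hb t).2]
  calc |clipSq τ s - clipSq τ t|
      = |min (|s| / τ) 1 + min (|t| / τ) 1| * |min (|s| / τ) 1 - min (|t| / τ) 1| := by
        rw [← abs_mul]; congr 1; unfold clipSq; ring
    _ ≤ 2 * (|s - t| / τ) := mul_le_mul h2 h1 (abs_nonneg _) zero_le_two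
    _ = 2 / τ * |s - t| := by ring

theorem measurable_clipSq : Measurable (clipSq τ) := by unfold clipSq; fun_prop

end Clip

/-! ### The uniform median-of-means estimate -/

section MedianOfMeans

variable {Z ι : Type*} [MeasurableSpace Z] {N n m : ℕ}

/-- The deviation of a block mean of `v` from the expectation of `v`. -/
noncomputable def blockDeviation (Q : Measure Z) (v : Z → ℝ) (y : Fin m → Z) : ℝ :=
  (∑ k, v (y k)) / m - ∫ z, v z ∂Q

theorem memLp_blockDeviation (Q : Measure Z) [IsProbabilityMeasure Q] {v : Z → ℝ}
    (hv : MemLp v 2 Q) :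
    MemLp (blockDeviation (m := m) Q v) 2 (Measure.pi fun _ : Fin m => Q) := by
  have h : MemLp (fun y : Fin m → Z => ∑ k, v (y k)) 2 (Measure.pi fun _ : Fin m => Q) :=
    memLp_finsetSum _ fun k _ => hv.comp_measurePreserving (measurePreserving_eval (fun _ => Q) k)
  exact (h.mul_const (m : ℝ)⁻¹).sub (memLp_const _)

theorem integral_blockDeviation_sq_le (Q : Measure Z) [IsProbabilityMeasure Q] {v : Z → ℝ}
    (hv : MemLp v 2 Q) (hm : 0 < m) :
    ∫ y : Fin m → Z, blockDeviation Q v y ^ 2 ∂(Measure.pi fun _ : Fin m => Q) ≤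
      (∫ z, v z ^ 2 ∂Q) / m := by
  set P := Measure.pi fun _ : Fin m => Q
  have hm' : (m : ℝ) ≠ 0 := by positivity
  have hev : ∀ k, MemLp (fun y : Fin m → Z => v (y k)) 2 P := fun k =>
    hv.comp_measurePreserving (measurePreserving_eval (fun _ => Q) k)
  have hmean : ∀ k, ∫ y : Fin m → Z, v (y k) ∂P = ∫ z, v z ∂Q := fun k => by
    have hmap := (measurePreserving_eval (fun _ : Fin m => Q) k).map_eq
    conv_rhs => rw [← hmap]
    exact (integral_map (measurable_pi_apply k).aemeasurable
      (by rw [hmap]; exact hv.aestronglyMeasurable)).symm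
  have hS : ∫ y : Fin m → Z, ∑ k, v (y k) ∂P = m * ∫ z, v z ∂Q := by
    rw [integral_finsetSum _ fun k _ => (hev k).integrable (by norm_num)]
    simp [hmean]
  have hSm : MemLp (fun y : Fin m → Z => ∑ k, v (y k)) 2 P := memLp_finsetSum _ fun k _ => hev k
  have hvar : Var[fun y : Fin m → Z => ∑ k, v (y k); P] = m * Var[v; Q] := by
    have := variance_sum_pi (μ := fun _ : Fin m => Q) (X := fun _ => v) fun _ => hv
    rw [show (∑ k : Fin m, fun ω : Fin m → Z => v (ω k)) = fun y => ∑ k, v (y k) by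
      funext y; simp] at this
    simpa using this
  rw [variance_eq_integral hSm.aestronglyMeasurable.aemeasurable, hS] at hvar
  have hle : Var[v; Q] ≤ ∫ z, v z ^ 2 ∂Q := by
    have := variance_le_expectation_sq (X := v) (μ := Q) hv.aestronglyMeasurable
    simpa using this
  have heq : ∀ y : Fin m → Z, blockDeviation Q v y ^ 2 =
      (m : ℝ)⁻¹ ^ 2 * (∑ k, v (y k) - m * ∫ z, v z ∂Q) ^ 2 := by
    intro y
    rw [← mul_pow, blockDeviation]
    congr 1
    field_simp
  simp only [heq]
  rw [integral_const_mul, hvar]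
  calc (m : ℝ)⁻¹ ^ 2 * (m * Var[v; Q]) = Var[v; Q] / m := by field_simp
    _ ≤ _ := by gcongr

/-- Signed sums of block deviations reduce to Rademacher sums over the sample. -/
theorem rademacherSup_blockDeviation_le (Q : Measure Z) [IsProbabilityMeasure Q] (a : ι → Z → ℝ)
    {φ : ℝ → ℝ} (hφ : ∀ s t, |φ s - φ t| ≤ |s - t|) (hφ0 : φ 0 = 0)
    (hint : ∀ u, Integrable (fun z => φ (a u z)) Q) (hm : 0 < m) {e : Fin n × Fin m → Fin N}
    (he : Function.Injective e) :
    rademacherSup (Measure.pi fun _ : Fin m => Q) (Fin n)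
        (fun u => blockDeviation Q fun z => φ (a u z)) ≤
      4 * ENNReal.ofReal (1 / m) * rademacherSup Q (Fin N) a := by
  classical
  have hm' : (0 : ℝ) < m := by positivity
  have hσ : ∀ σ : Fin n → ℤˣ, outerExpectation
      (Measure.pi fun _ : Fin n => Measure.pi fun _ : Fin m => Q)
      (signedSumSup (fun u => blockDeviation Q fun z => φ (a u z)) σ) ≤
      4 * ENNReal.ofReal (1 / m) * rademacherSup Q (Fin N) a := by
    intro σ
    refine (outerExpectation_le_comp_blocks Q he _).trans ?_
    -- For fixed block signs, the signed sum of block deviations is a weighted sum of centred terms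
    -- over the whole sample, with weight `±1/m` on the blocks and zero elsewhere. The deviation
    -- estimate applies to the coordinatewise maps `c i * φ`, which are `1/m`-Lipschitz.
    set c : Fin N → ℝ := Function.extend e (fun q => ((σ q.1 : ℤ) : ℝ) / m) 0
    have hc : ∀ i, |c i| ≤ 1 / m := by
      intro i
      by_cases hi : ∃ q, e q = i
      · obtain ⟨q, rfl⟩ := hi
        simp only [c, he.extend_apply]
        rcases Int.units_eq_one_or (σ q.1) with h | h <;> simp [h, abs_div]
      · simp only [c, Function.extend_apply' _ _ _ hi]
        simp
    have hdev := outerExpectation_deviation_le (J := Fin N) Q a (φ := fun i t => c i * φ t)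
      (L := 1 / m) (by positivity)
      (fun i s t => by
        rw [← mul_sub, abs_mul]
        exact mul_le_mul (hc i) (hφ s t) (abs_nonneg _) (by positivity))
      (fun i => by simp [hφ0]) (fun u i => (hint u).const_mul _)
    refine (outerExpectation_mono fun D => iSup_mono fun u => ?_).trans hdev
    refine ENNReal.ofReal_le_ofReal (le_of_eq (congrArg _ ?_))
    have hsum : ∑ i, (c i * φ (a u (D i)) - ∫ b, c i * φ (a u b) ∂Q) =
        ∑ q : Fin n × Fin m, ((σ q.1 : ℤ) : ℝ) / m *
          (φ (a u (D (e q))) - ∫ z, φ (a u z) ∂Q) := by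
      refine (Fintype.sum_of_injective e he _ _ (fun i hi => ?_) fun q => ?_).symm
      · have : c i = 0 := Function.extend_apply' _ _ _ hi
        simp [this]
      · have : c (e q) = ((σ q.1 : ℤ) : ℝ) / m := he.extend_apply _ _ _
        rw [this, integral_const_mul]; ring
    rw [hsum, Fintype.sum_prod_type]
    refine Finset.sum_congr rfl fun j _ => ?_
    dsimp only
    rw [← Finset.mul_sum, Finset.sum_sub_distrib, blockDeviation]
    simp only [blocks, Finset.sum_const, Finset.card_univ, Fintype.card_fin, nsmul_eq_mul]
    field_simp
  rw [rademacherSup]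
  refine ENNReal.div_le_of_le_mul ?_
  refine (Finset.sum_le_sum fun σ _ => hσ σ).trans (le_of_eq ?_)
  rw [Finset.sum_const, Finset.card_univ, nsmul_eq_mul, mul_comm]
  congr 1
  simp

/-- The uniform median-of-means estimate: with overwhelming probability, for all the functions of
the class simultaneously, most block means are close to the expectation. -/
theorem measure_blockDeviation_le (Q : Measure Z) [IsProbabilityMeasure Q] (a : ι → Z → ℝ)
    {φ : ℝ → ℝ} (hφ : ∀ s t, |φ s - φ t| ≤ |s - t|) (hφ0 : φ 0 = 0)
    (hL2 : ∀ u, MemLp (fun z => φ (a u z)) 2 Q) {s : ℝ}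
    (hs : ∀ u, ∫ z, φ (a u z) ^ 2 ∂Q ≤ s) (hn : 0 < n) (hm : 0 < m) {e : Fin n × Fin m → Fin N}
    (he : Function.Injective e) {τ : ℝ} (hτ : 0 < τ) (hvar : 16 * s ≤ m * τ ^ 2)
    (hrad : rademacherSup Q (Fin N) a ≤ ENNReal.ofReal (n * m * τ / 512)) :
    (Measure.pi fun _ : Fin N => Q)
        {D | ∃ u, n ≤ 4 * (Finset.univ.filter fun j =>
          τ < |blockDeviation Q (fun z => φ (a u z)) (blocks e D j)|).card} ≤
      ENNReal.ofReal (Real.exp (-(n / 128))) := by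
  have hm' : (0 : ℝ) < m := by positivity
  have hn' : (0 : ℝ) < n := by positivity
  set b : ι → (Fin m → Z) → ℝ := fun u => blockDeviation Q fun z => φ (a u z)
  set P := Measure.pi fun _ : Fin m => Q
  have hb : ∀ u, MemLp (b u) 2 P := fun u => memLp_blockDeviation Q (hL2 u)
  have hbi : ∀ u, Integrable (fun y => clipSq τ (b u y)) P := fun u => by
    refine Integrable.of_bound (C := 1) ?_ (ae_of_all _ fun y => ?_)
    · exact (measurable_clipSq.comp_aemeasurable
        (hb u).aestronglyMeasurable.aemeasurable).aestronglyMeasurable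
    · rw [Real.norm_eq_abs, abs_of_nonneg (clipSq_nonneg _)]
      exact clipSq_le_one hτ _
  -- Chebyshev: the second moment of a block deviation is at most `s / m`, which is at most `τ ^ 2 /
  -- 16`.
  have hp : ∀ u, ∫ y, clipSq τ (b u y) ∂P ≤ 1 / 16 := fun u => by
    have hsq : Integrable (fun y => b u y ^ 2) P := (hb u).integrable_sq
    calc ∫ y, clipSq τ (b u y) ∂P ≤ ∫ y, b u y ^ 2 / τ ^ 2 ∂P :=
          integral_mono (hbi u) (hsq.div_const _) fun y => clipSq_le_sq hτ _
      _ = (∫ y, b u y ^ 2 ∂P) / τ ^ 2 := integral_div _ _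
      _ ≤ (s / m) / τ ^ 2 := by
          gcongr
          exact (integral_blockDeviation_sq_le Q (hL2 u) hm).trans (by gcongr; exact hs u)
      _ ≤ 1 / 16 := by
          rw [div_div, div_le_div_iff₀ (by positivity) (by norm_num)]; linarith
  set S : (Fin n → Fin m → Z) → ℝ≥0∞ := fun x => ⨆ u, ENNReal.ofReal (∑ j, clipSq τ (b u (x j)))
  -- The mean contributes `n / 16`. The Rademacher part contributes `4 * (2 / τ) * (4 / m) * (n * m
  -- * τ / 512) = n / 16`, where `2 / τ` is the Lipschitz constant of `clipSq`.
  have hSE : outerExpectation (Measure.pi fun _ : Fin n => P) S ≤ ENNReal.ofReal (n / 8) := by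
    refine (outerExpectation_iSup_sum_le P b (by positivity) (abs_clipSq_sub_le hτ) clipSq_zero
      hbi hp).trans ?_
    have h1 := rademacherSup_blockDeviation_le Q a hφ hφ0
      (fun u => (hL2 u).integrable (by norm_num)) hm he
    calc ENNReal.ofReal (Fintype.card (Fin n) * (1 / 16)) +
          4 * ENNReal.ofReal (2 / τ) * rademacherSup P (Fin n) b
        ≤ ENNReal.ofReal (n / 16) + 4 * ENNReal.ofReal (2 / τ) *
            (4 * ENNReal.ofReal (1 / m) * ENNReal.ofReal (n * m * τ / 512)) := by
          refine add_le_add (le_of_eq ?_) ?_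
          · rw [Fintype.card_fin]; congr 1; ring
          · gcongr
            exact h1.trans (by gcongr)
      _ = ENNReal.ofReal (n / 16) + ENNReal.ofReal (n / 16) := by
          congr 1
          rw [show (4 : ℝ≥0∞) = ENNReal.ofReal 4 by simp, ← ENNReal.ofReal_mul (by norm_num),
            ← ENNReal.ofReal_mul (by norm_num), ← ENNReal.ofReal_mul (by positivity),
            ← ENNReal.ofReal_mul (by positivity)]
          congr 1
          field_simp
          norm_num
      _ = ENNReal.ofReal (n / 8) := by
          rw [← ENNReal.ofReal_add (by positivity) (by positivity)]; congr 1; ring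
  have hSle : ∀ x, S x ≤ ENNReal.ofReal n := fun x => iSup_le fun u => by
    refine ENNReal.ofReal_le_ofReal ?_
    calc ∑ j, clipSq τ (b u (x j)) ≤ ∑ _j : Fin n, (1 : ℝ) :=
          Finset.sum_le_sum fun j _ => clipSq_le_one hτ _
      _ = n := by simp
  have hStop : ∀ x, S x ≠ ⊤ := fun x => ne_top_of_le_ne_top ENNReal.ofReal_ne_top (hSle x)
  have hSdiff : ∀ i w x, S x ≤ S (Function.update x i w) + 1 := by
    intro i w x
    refine iSup_le fun u => ?_
    have h1 : ∑ j, clipSq τ (b u (x j)) ≤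
        ∑ j, clipSq τ (b u (Function.update x i w j)) + 1 := by
      rw [← Finset.sum_erase_add _ _ (Finset.mem_univ i),
        ← Finset.sum_erase_add _ (fun j => clipSq τ (b u (Function.update x i w j)))
          (Finset.mem_univ i)]
      have h2 : ∑ j ∈ Finset.univ.erase i, clipSq τ (b u (Function.update x i w j)) =
          ∑ j ∈ Finset.univ.erase i, clipSq τ (b u (x j)) :=
        Finset.sum_congr rfl fun j hj => by rw [Function.update_of_ne (Finset.ne_of_mem_erase hj)]
      rw [h2]
      have h3 := clipSq_le_one hτ (b u (x i))
      have h4 := clipSq_nonneg (τ := τ) (b u (Function.update x i w i))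
      linarith
    refine (ENNReal.ofReal_le_ofReal h1).trans (ENNReal.ofReal_add_le.trans ?_)
    rw [ENNReal.ofReal_one]
    gcongr
    exact le_iSup (fun u => ENNReal.ofReal
      (∑ j, clipSq τ (b u (Function.update x i w j)))) u
  -- Mean `n / 8` plus deviation `n / 8` reaches the quarter of the blocks that is to be excluded.
  have hmain := measure_ge_le_of_bounded_difference P hn (G := fun x => (S x).toReal) (M := n)
    (m := n / 8) (t := n / 8)
    (fun x => ENNReal.toReal_le_of_le_ofReal hn'.le (hSle x))
    (fun i w x => by
      have := ENNReal.toReal_mono (ENNReal.add_ne_top.2 ⟨hStop _, ENNReal.one_ne_top⟩)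
        (hSdiff i w x)
      rwa [ENNReal.toReal_add (hStop _) ENNReal.one_ne_top, ENNReal.toReal_one] at this)
    (by positivity) (by positivity)
    (by simpa only [ENNReal.ofReal_toReal (hStop _)] using hSE)
  have hexp : ((n : ℝ) / 8) ^ 2 / (2 * n) = n / 128 := by field_simp; norm_num
  rw [hexp] at hmain
  refine le_trans ?_ hmain
  have hT := measurePreserving_blocks Q he
  rw [← hT.map_eq]
  refine le_trans (measure_mono ?_) (Measure.le_map_apply hT.aemeasurable _)
  rintro D ⟨u, hu⟩
  change (n : ℝ) / 8 + n / 8 ≤ (S (blocks e D)).toReal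
  rw [← ENNReal.ofReal_le_iff_le_toReal (hStop _)]
  refine le_trans (ENNReal.ofReal_le_ofReal ?_)
    (le_iSup (fun u => ENNReal.ofReal (∑ j, clipSq τ (b u (blocks e D j)))) u)
  set A := Finset.univ.filter fun j => τ < |b u (blocks e D j)|
  have hcard : (A.card : ℝ) ≤ ∑ j, clipSq τ (b u (blocks e D j)) := by
    calc (A.card : ℝ) = ∑ j ∈ A, clipSq τ (b u (blocks e D j)) := by
          rw [Finset.card_eq_sum_ones, Nat.cast_sum]
          refine Finset.sum_congr rfl fun j hj => ?_
          rw [clipSq_eq_one hτ (Finset.mem_filter.1 hj).2, Nat.cast_one]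
      _ ≤ _ := Finset.sum_le_univ_sum_of_nonneg fun j => clipSq_nonneg _
  have hu' : (n : ℝ) ≤ 4 * A.card := by exact_mod_cast hu
  linarith

/-- The quantity `signedSup` of the complexity parameters controls Rademacher sums. -/
theorem rademacherSup_le_signedSup (Q : Measure Z) (hN : 0 < N) (V : Set (Z → ℝ)) :
    rademacherSup Q (Fin N) (fun v : V => v.1) ≤
      ENNReal.ofReal (√(N : ℝ)) * signedSup Q N V := by
  have hN' : 0 < √(N : ℝ) := Real.sqrt_pos.2 (by positivity)
  rw [rademacherSup, signedSup, ← mul_div_assoc, Fintype.card_fin]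
  refine ENNReal.div_le_div_right ?_ _
  rw [Finset.mul_sum]
  refine Finset.sum_le_sum fun σ _ => ?_
  refine le_trans (outerExpectation_mono fun z => ?_) (outerExpectation_const_mul_le _ _)
  refine iSup_le fun v => ?_
  have h1 : |∑ i, ((σ i : ℤ) : ℝ) * v.1 (z i)| =
      √(N : ℝ) * |1 / √(N : ℝ) * ∑ i, ((σ i : ℤ) : ℝ) * v.1 (z i)| := by
    rw [abs_mul, abs_of_pos (by positivity : (0 : ℝ) < 1 / √(N : ℝ))]
    field_simp
  rw [h1, ENNReal.ofReal_mul hN'.le]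
  gcongr
  exact le_iSup₂ (f := fun (v : Z → ℝ) (_ : v ∈ V) =>
    ENNReal.ofReal |1 / √(N : ℝ) * ∑ i, ((σ i : ℤ) : ℝ) * v (z i)|) v.1 v.2

end MedianOfMeans

/-! ### Medians -/

section Median

variable {k : ℕ} {a : Fin k → ℝ}

/-- Take the least value `a i` with at least half of the values below or equal to it. If fewer than
half were at least `a i`, the largest value below `a i` would already have qualified. -/
theorem exists_mem_medianSet (hk : 0 < k) :
    ∃ x, x ∈ {x | k ≤ 2 * (Finset.univ.filter fun j => a j ≤ x).card ∧
    k ≤ 2 * (Finset.univ.filter fun j => x ≤ a j).card} := by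
  classical
  have : Nonempty (Fin k) := ⟨⟨0, hk⟩⟩
  set I := Finset.univ.filter fun i => k ≤ 2 * (Finset.univ.filter fun j => a j ≤ a i).card
  have hI : I.Nonempty := by
    obtain ⟨i, hi⟩ := Finite.exists_max a
    refine ⟨i, Finset.mem_filter.2 ⟨Finset.mem_univ _, ?_⟩⟩
    rw [Finset.filter_true_of_mem fun j _ => hi j, Finset.card_univ, Fintype.card_fin]
    omega
  obtain ⟨i, hi, hmin⟩ := I.exists_min_image a hI
  refine ⟨a i, (Finset.mem_filter.1 hi).2, ?_⟩
  by_contra hlt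
  have hsum := Finset.card_filter_add_card_filter_not (s := (Finset.univ : Finset (Fin k)))
    (fun j => a i ≤ a j)
  rw [Finset.card_univ, Fintype.card_fin] at hsum
  have hB : (Finset.univ.filter fun j => ¬ a i ≤ a j).Nonempty := by
    rw [← Finset.card_pos]; omega
  obtain ⟨i', hi', hmax⟩ := (Finset.univ.filter fun j => ¬ a i ≤ a j).exists_max_image a hB
  have hlt' : a i' < a i := not_le.1 (Finset.mem_filter.1 hi').2
  have hsub : (Finset.univ.filter fun j => ¬ a i ≤ a j) ⊆
      Finset.univ.filter fun j => a j ≤ a i' := fun j hj =>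
    Finset.mem_filter.2 ⟨Finset.mem_univ _, hmax j hj⟩
  have hle := Finset.card_le_card hsub
  have : i' ∈ I := Finset.mem_filter.2 ⟨Finset.mem_univ _, by omega⟩
  exact absurd (hmin i' this) (not_le.2 hlt')

/-- A strict majority meets each of the two halves that define a median. For `k = 0` every real
number is a median and `sInf` takes its default value `0`, hence `hk`. -/
theorem le_median {y : ℝ} (hk : 0 < k)
    (h : k < 2 * (Finset.univ.filter fun j => y ≤ a j).card) : y ≤ median a := by
  refine le_csInf (exists_mem_medianSet hk) fun x hx => ?_
  by_contra hlt
  have hsub : (Finset.univ.filter fun j => a j ≤ x) ⊆ Finset.univ.filter fun j => ¬ y ≤ a j :=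
    fun j hj => Finset.mem_filter.2 ⟨Finset.mem_univ _, not_le.2
      ((Finset.mem_filter.1 hj).2.trans_lt (not_le.1 hlt))⟩
  have hle := Finset.card_le_card hsub
  have hsum := Finset.card_filter_add_card_filter_not (s := (Finset.univ : Finset (Fin k)))
    (fun j => y ≤ a j)
  rw [Finset.card_univ, Fintype.card_fin] at hsum
  have := hx.1
  omega

theorem median_lt {y : ℝ} (hk : 0 < k)
    (h : k < 2 * (Finset.univ.filter fun j => a j < y).card) : median a < y := by
  obtain ⟨x, hx⟩ := exists_mem_medianSet (a := a) hk
  have : Nonempty (Fin k) := ⟨⟨0, hk⟩⟩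
  have hbdd : BddBelow {x | k ≤ 2 * (Finset.univ.filter fun j => a j ≤ x).card ∧
      k ≤ 2 * (Finset.univ.filter fun j => x ≤ a j).card} := by
    obtain ⟨i, hi⟩ := Finite.exists_min a
    refine ⟨a i, fun z hz => ?_⟩
    by_contra hlt
    have : (Finset.univ.filter fun j => a j ≤ z) = ∅ :=
      Finset.filter_eq_empty_iff.2 fun j _ => not_le.2 ((not_le.1 hlt).trans_le (hi j))
    have h1 := hz.1
    rw [this] at h1
    simp at h1
    omega
  refine (csInf_le hbdd hx).trans_lt ?_
  by_contra hge
  have hsub : (Finset.univ.filter fun j => x ≤ a j) ⊆ Finset.univ.filter fun j => ¬ a j < y :=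
    fun j hj => Finset.mem_filter.2 ⟨Finset.mem_univ _, not_lt.2
      ((not_lt.1 hge).trans (Finset.mem_filter.1 hj).2)⟩
  have hle := Finset.card_le_card hsub
  have hsum := Finset.card_filter_add_card_filter_not (s := (Finset.univ : Finset (Fin k)))
    (fun j => a j < y)
  rw [Finset.card_univ, Fintype.card_fin] at hsum
  have := hx.2
  omega

end Median

/-! ### Positions of the blocks -/

section BlockMean

variable {𝒳 : Type*} {N n m s : ℕ}

/-- The position of the `k`-th point of the `j`-th block of length `m`, from position `s` on. -/
def blockPos (h : s + n * m ≤ N) (q : Fin n × Fin m) : Fin N :=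
  ⟨s + q.1 * m + q.2, by
    have h1 : (q.1 + 1) * m ≤ n * m := Nat.mul_le_mul_right m q.1.2
    have h2 := q.2.2
    rw [Nat.add_mul] at h1
    omega⟩

theorem blockPos_injective (h : s + n * m ≤ N) : Function.Injective (blockPos h) := by
  rintro ⟨j, k⟩ ⟨j', k'⟩ hq
  have h1 : s + j * m + k = s + j' * m + k' := congrArg Fin.val hq
  have h2 : (k : ℕ) + m * j = k' + m * j' := by rw [mul_comm m, mul_comm m]; omega
  have hm : 0 < m := lt_of_le_of_lt (Nat.zero_le _) k.2
  have h3 := congrArg (· / m) h2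
  simp only [Nat.add_mul_div_left _ _ hm, Nat.div_eq_of_lt k.2, Nat.div_eq_of_lt k'.2,
    zero_add] at h3
  have h4 : j = j' := Fin.ext h3
  subst h4
  have h5 : k = k' := Fin.ext (by omega)
  rw [h5]

theorem blockMean_eq (h : s + n * m ≤ N) (D : Fin N → 𝒳 × ℝ) (j : Fin n) (g : 𝒳 × ℝ → ℝ) :
    blockMean D s m j g = (∑ k, g (D (blockPos h (j, k)))) / m := by
  unfold blockMean
  congr 1
  have hinj : Function.Injective fun k => blockPos h (j, k) := fun k k' hk =>
    (Prod.ext_iff.1 (blockPos_injective h hk)).2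
  have himg : (Finset.univ : Finset (Fin N)).filter
      (fun i => s + j * m ≤ i.val ∧ i.val < s + (j + 1) * m) =
      Finset.univ.map ⟨fun k => blockPos h (j, k), hinj⟩ := by
    ext i
    simp only [Finset.mem_filter, Finset.mem_univ, true_and, Finset.mem_map,
      Function.Embedding.coeFn_mk]
    constructor
    · rintro ⟨h1, h2⟩
      rw [Nat.add_mul] at h2
      exact ⟨⟨i - (s + j * m), by omega⟩, Fin.ext (by simp only [blockPos]; omega)⟩
    · rintro ⟨k, rfl⟩
      have := k.2
      simp only [blockPos]
      rw [Nat.add_mul]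
      omega
  rw [himg, Finset.sum_map]
  rfl

end BlockMean

/-! ### Comparison of the L₁ and L₂ norms -/

section LpNorms

variable {𝒳 : Type*} [MeasurableSpace 𝒳] {μ : Measure 𝒳}

theorem integral_sq_eq_eLpNorm_sq {u : 𝒳 → ℝ} (hu : MemLp u 2 μ) :
    ∫ x, u x ^ 2 ∂μ = (eLpNorm u 2 μ).toReal ^ 2 := by
  rw [hu.eLpNorm_eq_integral_rpow_norm (by norm_num) (by norm_num)]
  have h0 : 0 ≤ ∫ x, ‖u x‖ ^ (2 : ℝ≥0∞).toReal ∂μ := integral_nonneg fun x => by positivity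
  rw [ENNReal.toReal_ofReal (by positivity), ENNReal.toReal_ofNat, ← Real.rpow_natCast,
    ← Real.rpow_mul (by simpa using h0)]
  simp

theorem integral_abs_le_eLpNorm [IsProbabilityMeasure μ] {u : 𝒳 → ℝ} (hu : MemLp u 2 μ) :
    ∫ x, |u x| ∂μ ≤ (eLpNorm u 2 μ).toReal := by
  have h1 : MemLp u 1 μ := hu.mono_exponent (by norm_num)
  have h2 : eLpNorm u 1 μ ≤ eLpNorm u 2 μ :=
    eLpNorm_le_eLpNorm_of_exponent_le (by norm_num) hu.aestronglyMeasurable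
  have h3 : ∫ x, |u x| ∂μ = (eLpNorm u 1 μ).toReal := by
    rw [eLpNorm_one_eq_lintegral_enorm]
    exact integral_norm_eq_lintegral_enorm hu.aestronglyMeasurable
  rw [h3]
  exact ENNReal.toReal_mono hu.eLpNorm_ne_top h2

/-- The ratio of the `L₁` and `L₂` norms that follows from the equivalence of the `L_q` and the
`L₂` norms. -/
noncomputable def l1Ratio (q L : ℝ) : ℝ := 1 / (2 * (2 * L ^ q) ^ (1 / (q - 2)))

theorem l1Ratio_pos {q L : ℝ} (hL : 0 < L) : 0 < l1Ratio q L := by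
  unfold l1Ratio; positivity

theorem l1Ratio_le_one {q L : ℝ} (hq : 2 < q) (hL : 1 < L) : l1Ratio q L ≤ 1 := by
  unfold l1Ratio
  have h1 : 1 ≤ L ^ q := Real.one_le_rpow hL.le (by linarith)
  have h2 : (1 : ℝ) ≤ (2 * L ^ q) ^ (1 / (q - 2)) :=
    Real.one_le_rpow (by linarith) (by have : 0 < q - 2 := by linarith
                                       positivity)
  rw [div_le_one (by positivity)]
  linarith

/-- Split at the level `M * s` with `s` the L₂ norm: below it `u² ≤ M s |u|`, above it `u² ≤ (M
s)^(2 - q) |u|^q`. The choice of `M` makes the integral of the second bound at most `s² / 2`, so the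
first carries the other half of `s²`. -/
theorem l1Ratio_mul_le_integral_abs {q L : ℝ} (hq : 2 < q) (hL : 1 < L) [IsProbabilityMeasure μ]
    {u : 𝒳 → ℝ} (hu : MemLp u 2 μ)
    (huq : eLpNorm u (ENNReal.ofReal q) μ ≤ ENNReal.ofReal L * eLpNorm u 2 μ) :
    l1Ratio q L * (eLpNorm u 2 μ).toReal ≤ ∫ x, |u x| ∂μ := by
  set s := (eLpNorm u 2 μ).toReal
  have hs0 : 0 ≤ s := ENNReal.toReal_nonneg
  rcases hs0.eq_or_lt with hs | hs
  · rw [← hs, mul_zero]; exact integral_nonneg fun x => abs_nonneg _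
  have hL0 : 0 < L := by linarith
  set M : ℝ := (2 * L ^ q) ^ (1 / (q - 2)) with hMdef
  have hM : 0 < M := by positivity
  have hq2 : 0 < q - 2 := by linarith
  have hMq : M ^ (2 - q) * L ^ q = 1 / 2 := by
    have h1 : M ^ (q - 2) = 2 * L ^ q := by
      rw [hMdef, ← Real.rpow_mul (by positivity)]
      rw [one_div_mul_cancel hq2.ne', Real.rpow_one]
    rw [show (2 - q) = -(q - 2) by ring, Real.rpow_neg hM.le, h1]
    field_simp
  have hqtop : eLpNorm u (ENNReal.ofReal q) μ < ⊤ :=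
    huq.trans_lt (ENNReal.mul_lt_top ENNReal.ofReal_lt_top hu.eLpNorm_lt_top)
  have huLq : MemLp u (ENNReal.ofReal q) μ := ⟨hu.aestronglyMeasurable, hqtop⟩
  have hq0 : ENNReal.ofReal q ≠ 0 := by simp; linarith
  have hqr : (ENNReal.ofReal q).toReal = q := ENNReal.toReal_ofReal (by linarith)
  have hIq : Integrable (fun x => |u x| ^ q) μ := by
    have := huLq.integrable_norm_rpow hq0 ENNReal.ofReal_ne_top
    simpa [hqr] using this
  have hI0 : 0 ≤ ∫ x, |u x| ^ q ∂μ := integral_nonneg fun x => by positivity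
  have hbound : ∫ x, |u x| ^ q ∂μ ≤ (L * s) ^ q := by
    have h1 := huq
    rw [huLq.eLpNorm_eq_integral_rpow_norm hq0 ENNReal.ofReal_ne_top, hqr,
      ← ENNReal.ofReal_toReal hu.eLpNorm_ne_top, ← ENNReal.ofReal_mul hL0.le,
      ENNReal.ofReal_le_ofReal_iff (by positivity)] at h1
    simp only [Real.norm_eq_abs] at h1
    have h2 := Real.rpow_le_rpow (by positivity) h1 (by linarith : 0 ≤ q)
    rwa [← Real.rpow_mul hI0, inv_mul_cancel₀ (by linarith), Real.rpow_one] at h2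
  have hI1 : Integrable (fun x => |u x|) μ := (hu.integrable (by norm_num)).abs
  have hpt : ∀ x, u x ^ 2 ≤ M * s * |u x| + (M * s) ^ (2 - q) * |u x| ^ q := by
    intro x
    have hMs : 0 < M * s := by positivity
    rcases le_total (|u x|) (M * s) with h | h
    · have : u x ^ 2 ≤ M * s * |u x| := by
        rw [← sq_abs, sq]; exact mul_le_mul_of_nonneg_right h (abs_nonneg _)
      have h2 : 0 ≤ (M * s) ^ (2 - q) * |u x| ^ q := by positivity
      linarith
    · have hux : 0 < |u x| := hMs.trans_le h
      have h1 : u x ^ 2 = |u x| ^ (2 - q) * |u x| ^ q := by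
        rw [← Real.rpow_add hux, sub_add_cancel, ← sq_abs]
        norm_cast
      have h2 : |u x| ^ (2 - q) ≤ (M * s) ^ (2 - q) :=
        Real.rpow_le_rpow_of_nonpos hMs h (by linarith)
      have h3 : |u x| ^ (2 - q) * |u x| ^ q ≤ (M * s) ^ (2 - q) * |u x| ^ q := by gcongr
      have h4 : 0 ≤ M * s * |u x| := by positivity
      linarith
  have hint := integral_mono hu.integrable_sq ((hI1.const_mul (M * s)).add (hIq.const_mul _)) hpt
  simp only [Pi.add_apply] at hint
  rw [integral_add (hI1.const_mul _) (hIq.const_mul _), integral_const_mul, integral_const_mul,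
    integral_sq_eq_eLpNorm_sq hu] at hint
  have h5 : (M * s) ^ (2 - q) * ∫ x, |u x| ^ q ∂μ ≤ s ^ 2 / 2 := by
    calc (M * s) ^ (2 - q) * ∫ x, |u x| ^ q ∂μ ≤ (M * s) ^ (2 - q) * (L * s) ^ q := by gcongr
      _ = (M ^ (2 - q) * L ^ q) * (s ^ (2 - q) * s ^ q) := by
          rw [Real.mul_rpow hM.le hs.le, Real.mul_rpow hL0.le hs.le]; ring
      _ = s ^ 2 / 2 := by
          rw [hMq, ← Real.rpow_add hs, sub_add_cancel]; norm_num; ring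
  have h6 : s ^ 2 / 2 ≤ M * s * ∫ x, |u x| ∂μ := by
    change s ^ 2 ≤ _ at hint
    linarith
  have h7 : s / 2 ≤ M * ∫ x, |u x| ∂μ := by
    refine le_of_mul_le_mul_left ?_ hs
    linarith
  have : l1Ratio q L = 1 / (2 * M) := rfl
  rw [this, div_mul_eq_mul_div, one_mul, div_le_iff₀ (by positivity)]
  linarith

end LpNorms

/-! ### Scaling of the localized classes and their packing numbers -/

section Localization

variable {𝒳 : Type*} [MeasurableSpace 𝒳] {μ : Measure 𝒳} {F : Set (𝒳 → ℝ)} {h w : 𝒳 → ℝ} {r r' : ℝ}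

theorem mem_localization_iff : w ∈ localization μ F h r ↔
    ∃ f ∈ F, ∃ t ∈ Set.Icc (0 : ℝ) 1, w = t • (f - h) ∧ eLpNorm w 2 μ ≤ ENNReal.ofReal r := by
  constructor
  · rintro ⟨⟨_, ⟨f, hf, rfl⟩, t, ht, rfl⟩, hw⟩
    exact ⟨f, hf, t, ht, by simp, hw⟩
  · rintro ⟨f, hf, t, ht, rfl, hw⟩
    exact ⟨⟨_, ⟨f, hf, rfl⟩, t, ht, by simp⟩, hw⟩

/-- The localization is star-shaped about `0`, so shrinking by `r' / r` stays inside. This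
transports the complexity bounds from a level `r'` below `r` up to `r`. -/
theorem exists_localization_scaled (hr' : 0 < r') (hle : r' ≤ r)
    (hw : w ∈ localization μ F h r) : ∃ w' ∈ localization μ F h r', w = (r / r') • w' := by
  obtain ⟨f, hf, t, ht, rfl, hw⟩ := mem_localization_iff.1 hw
  have hr : 0 < r := hr'.trans_le hle
  refine ⟨(r' / r * t) • (f - h), mem_localization_iff.2 ⟨f, hf, r' / r * t, ⟨?_, ?_⟩, rfl, ?_⟩, ?_⟩
  · exact mul_nonneg (by positivity) ht.1
  · exact mul_le_one₀ ((div_le_one hr).2 hle) ht.1 ht.2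
  · rw [mul_smul, eLpNorm_const_smul, Real.enorm_eq_ofReal (by positivity)]
    calc ENNReal.ofReal (r' / r) * eLpNorm (t • (f - h)) 2 μ
        ≤ ENNReal.ofReal (r' / r) * ENNReal.ofReal r := by gcongr
      _ = ENNReal.ofReal r' := by
        rw [← ENNReal.ofReal_mul (by positivity), div_mul_cancel₀ _ hr.ne']
  · rw [smul_smul]
    congr 1
    field_simp

theorem signedSup_le_of_scaled {Z : Type*} [MeasurableSpace Z] {Q : Measure Z} {N : ℕ}
    {V V' : Set (Z → ℝ)} {c : ℝ} (hc : 0 ≤ c) (hV : ∀ v ∈ V, ∃ v' ∈ V', v = c • v') :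
    signedSup Q N V ≤ ENNReal.ofReal c * signedSup Q N V' := by
  rw [signedSup, signedSup, ← mul_div_assoc, Finset.mul_sum]
  refine ENNReal.div_le_div_right (Finset.sum_le_sum fun σ _ => ?_) _
  refine le_trans (outerExpectation_mono fun z => ?_) (outerExpectation_const_mul_le _ _)
  refine iSup₂_le fun v hv => ?_
  obtain ⟨v', hv', rfl⟩ := hV v hv
  have h1 : |1 / √(N : ℝ) * ∑ i, ((σ i : ℤ) : ℝ) * (c • v') (z i)| =
      c * |1 / √(N : ℝ) * ∑ i, ((σ i : ℤ) : ℝ) * v' (z i)| := by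
    have h0 : ∑ i, ((σ i : ℤ) : ℝ) * (c • v') (z i) = c * ∑ i, ((σ i : ℤ) : ℝ) * v' (z i) := by
      rw [Finset.mul_sum]
      exact Finset.sum_congr rfl fun i _ => by simp only [Pi.smul_apply, smul_eq_mul]; ring
    rw [h0, mul_left_comm, abs_mul c, abs_of_nonneg hc]
  rw [h1, ENNReal.ofReal_mul hc]
  gcongr
  exact le_iSup₂ (f := fun (v : Z → ℝ) (_ : v ∈ V') =>
    ENNReal.ofReal |1 / √(N : ℝ) * ∑ i, ((σ i : ℤ) : ℝ) * v (z i)|) v' hv'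

theorem exists_of_critLevel_lt {p : ℝ → Prop} (hr : critLevel p < ENNReal.ofReal r) :
    ∃ r', 0 < r' ∧ r' < r ∧ p r' := by
  obtain ⟨r', h1⟩ := iInf_lt_iff.1 hr
  obtain ⟨⟨h2, h3⟩, h4⟩ := iInf_lt_iff.1 h1
  exact ⟨r', h2, (ENNReal.ofReal_lt_ofReal_iff_of_nonneg h2.le).1 h4, h3⟩

/-- A small packing number at some level below `r` confines the whole class to a ball. -/
theorem eLpNorm_sub_le_of_logPacking_lt {η : ℝ} (hη1 : η ≤ 1) (hh : h ∈ F)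
    (hF : ∀ f ∈ F, MemLp f 2 μ) (hr' : 0 < r') (hle : r' ≤ r)
    (hlog : logPacking μ (localization μ F h r') (η * r') < ENNReal.log 2) :
    ∀ f ∈ F, eLpNorm (f - h) 2 μ ≤ ENNReal.ofReal r := by
  intro f hf
  by_contra hlt
  rw [not_le] at hlt
  have hmem : MemLp (f - h) 2 μ := (hF f hf).sub (hF h hh)
  set s := (eLpNorm (f - h) 2 μ).toReal
  have hs : eLpNorm (f - h) 2 μ = ENNReal.ofReal s :=
    (ENNReal.ofReal_toReal hmem.eLpNorm_ne_top).symm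
  have hr : 0 < r := hr'.trans_le hle
  have hrs : r < s := by
    rw [hs] at hlt; exact (ENNReal.ofReal_lt_ofReal_iff_of_nonneg hr.le).1 hlt
  have hs0 : 0 < s := hr.trans hrs
  set u := (r' / s) • (f - h)
  have hu : eLpNorm u 2 μ = ENNReal.ofReal r' := by
    rw [eLpNorm_const_smul, Real.enorm_eq_ofReal (by positivity), hs,
      ← ENNReal.ofReal_mul (by positivity), div_mul_cancel₀ _ hs0.ne']
  have hne : (0 : 𝒳 → ℝ) ≠ u := by
    intro h0
    rw [← h0, eLpNorm_zero] at hu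
    exact absurd hu.symm (by simpa using hr')
  have hsep : ENNReal.ofReal (η * r') ≤ eLpNorm u 2 μ := by
    rw [hu]; exact ENNReal.ofReal_le_ofReal (by nlinarith)
  -- A function outside the ball, scaled down to norm `r'`, forms with `0` a pair at distance `r' ≥
  -- η * r'`.
  have h2 : (2 : ℕ∞) ≤ packingNumber μ (localization μ F h r') (η * r') := by
    refine le_trans (le_of_eq (Set.encard_pair hne).symm) (le_iSup₂_of_le {0, u} ⟨?_, ?_⟩ le_rfl)
    · rintro v (rfl | rfl)
      · exact mem_localization_iff.2 ⟨h, hh, 0, ⟨le_rfl, zero_le_one⟩, by simp, by simp⟩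
      · exact mem_localization_iff.2 ⟨f, hf, r' / s, ⟨by positivity,
          (div_le_one hs0).2 (hle.trans hrs.le)⟩, rfl, hu.le⟩
    · refine Set.pairwise_pair.2 fun _ => ⟨?_, ?_⟩
      · rwa [zero_sub, eLpNorm_neg]
      · rwa [sub_zero]
  refine absurd hlog (not_lt.2 ?_)
  refine ENNReal.log_le_log ?_
  exact_mod_cast h2

end Localization

/-! ### Majorities of blocks -/

section Verdicts

variable {𝒳 : Type*} {h : 𝒳 → ℝ} {N n ℓ : ℕ}

/-- Two exceptional sets of less than a quarter each cannot cover half of the blocks; this dictates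
the proportion in the uniform estimates. -/
theorem lt_two_mul_card_of_bad {p₁ p₂ good : Fin n → Prop} [DecidablePred p₁] [DecidablePred p₂]
    [DecidablePred good] (h₁ : 4 * (Finset.univ.filter p₁).card < n)
    (h₂ : 4 * (Finset.univ.filter p₂).card < n) (hg : ∀ j, ¬ p₁ j → ¬ p₂ j → good j) :
    n < 2 * (Finset.univ.filter good).card := by
  classical
  have hsub : (Finset.univ : Finset (Fin n)) ⊆
      (Finset.univ.filter p₁ ∪ Finset.univ.filter p₂) ∪ Finset.univ.filter good := by
    intro j _
    by_cases h1 : p₁ j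
    · simp [h1]
    by_cases h2 : p₂ j
    · simp [h2]
    · simp [hg j h1 h2]
  have h3 := (Finset.card_le_card hsub).trans (Finset.card_union_le _ _)
  have h4 := Finset.card_union_le (Finset.univ.filter p₁) (Finset.univ.filter p₂)
  rw [Finset.card_univ, Fintype.card_fin] at h3
  omega

/-- Two strict majorities share a block, on which the same block mean would be both positive and
negative. A win of `h` thus protects it from losing that match. -/
theorem Beats.not_symm {D : Fin N → 𝒳 × ℝ} {f : 𝒳 → ℝ} (hb : Beats n D h f) : ¬ Beats n D f h := by
  intro hb'
  unfold Beats at hb hb'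
  have hneg : ∀ j : ℕ, blockMean D (N / 3) (N / 3 / n) j
        (fun z => (h z.1 - z.2) ^ 2 - (f z.1 - z.2) ^ 2) =
      -blockMean D (N / 3) (N / 3 / n) j fun z => (f z.1 - z.2) ^ 2 - (h z.1 - z.2) ^ 2 := by
    intro j
    unfold blockMean
    rw [← neg_div, ← Finset.sum_neg_distrib]
    simp only [neg_sub]
  simp only [hneg] at hb'
  have hdisj : Disjoint
      (Finset.univ.filter fun j : Fin n => 0 < blockMean D (N / 3) (N / 3 / n) j
        fun z => (f z.1 - z.2) ^ 2 - (h z.1 - z.2) ^ 2)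
      (Finset.univ.filter fun j : Fin n => 0 < -blockMean D (N / 3) (N / 3 / n) j
        fun z => (f z.1 - z.2) ^ 2 - (h z.1 - z.2) ^ 2) :=
    Finset.disjoint_filter.2 fun j _ h1 h2 => by linarith
  have h1 := Finset.card_le_univ (Finset.disjUnion _ _ hdisj)
  rw [Finset.card_disjUnion, Fintype.card_fin] at h1
  omega

theorem medDist_comm {D : Fin N → 𝒳 × ℝ} (f g : 𝒳 → ℝ) : medDist ℓ D f g = medDist ℓ D g f := by
  simp only [medDist, abs_sub_comm]

end Verdicts

/-! ### Deterministic outcome of the matches -/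

section Matches

variable {𝒳 : Type*} [MeasurableSpace 𝒳] {μ : Measure 𝒳} {F : Set (𝒳 → ℝ)} {h : 𝒳 → ℝ}
  {r γ : ℝ} {N n m ℓ k : ℕ}

/-- The normalized difference `(r / ‖f - h‖) (f - h)`. -/
theorem exists_normalized (hF : ∀ f ∈ F, MemLp f 2 μ) (hh : h ∈ F) (hr : 0 < r) {f : 𝒳 → ℝ}
    (hf : f ∈ F) (hrf : r ≤ (eLpNorm (f - h) 2 μ).toReal) :
    ∃ u ∈ localization μ F h r, (eLpNorm u 2 μ).toReal = r ∧
      f - h = ((eLpNorm (f - h) 2 μ).toReal / r) • u := by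
  have hmem : MemLp (f - h) 2 μ := (hF f hf).sub (hF h hh)
  set s := (eLpNorm (f - h) 2 μ).toReal
  have hs : 0 < s := hr.trans_le hrf
  have hnorm : eLpNorm ((r / s) • (f - h)) 2 μ = ENNReal.ofReal r := by
    rw [eLpNorm_const_smul, Real.enorm_eq_ofReal (by positivity),
      ← ENNReal.ofReal_toReal hmem.eLpNorm_ne_top, ← ENNReal.ofReal_mul (by positivity)]
    exact congrArg _ (div_mul_cancel₀ _ hs.ne')
  refine ⟨(r / s) • (f - h), mem_localization_iff.2 ⟨f, hf, r / s, ⟨by positivity,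
    (div_le_one hs).2 hrf⟩, rfl, hnorm.le⟩, by rw [hnorm, ENNReal.toReal_ofReal hr.le], ?_⟩
  rw [smul_smul, div_mul_div_comm, mul_comm r s, div_self (by positivity), one_smul]

/-- On the event of the uniform estimates, `h` beats every function at a distance. -/
theorem beats_of_uniform {P : Measure (𝒳 × ℝ)} (hF : ∀ f ∈ F, MemLp f 2 μ) (hh : h ∈ F)
    (hr : 0 < r) (hγ : 0 < γ)
    (hsmall : ∀ u ∈ localization μ F h r, γ * (eLpNorm u 2 μ).toReal ≤ ∫ x, |u x| ∂μ)
    (hmean : ∀ u ∈ localization μ F h r, ∫ z, u z.1 * (h z.1 - z.2) ∂P = 0) (hm : 0 < m)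
    (hN : N / 3 + n * m ≤ N) (hmn : N / 3 / n = m) {D : Fin N → 𝒳 × ℝ}
    (h₁ : ∀ u ∈ localization μ F h r, 4 * (Finset.univ.filter fun j => γ * r / 2 <
      |blockDeviation μ (fun x => |u x|) (blocks (blockPos hN) (fun i => (D i).1) j)|).card < n)
    (h₂ : ∀ u ∈ localization μ F h r, 4 * (Finset.univ.filter fun j => γ ^ 2 * r ^ 2 / 16 <
      |blockDeviation P (fun z => u z.1 * (h z.1 - z.2)) (blocks (blockPos hN) D j)|).card < n)
    {f : 𝒳 → ℝ} (hf : f ∈ F) (hrf : r ≤ (eLpNorm (f - h) 2 μ).toReal) : Beats n D h f := by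
  obtain ⟨u, hu, hur, hfu⟩ := exists_normalized hF hh hr hf hrf
  set c := (eLpNorm (f - h) 2 μ).toReal / r
  have hc : 1 ≤ c := (one_le_div hr).2 hrf
  have hm' : (0 : ℝ) < m := by positivity
  refine lt_two_mul_card_of_bad (h₁ u hu) (h₂ u hu) fun j hj₁ hj₂ => ?_
  rw [not_lt] at hj₁ hj₂
  rw [hmn, blockMean_eq hN]
  simp only [blockDeviation, blocks, hmean u hu, sub_zero] at hj₁ hj₂
  set p : Fin m → 𝒳 × ℝ := fun k => D (blockPos hN (j, k))
  -- Cauchy-Schwarz turns the lower bound on the block mean of `|u|` into one on the block mean of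
  -- `u²`.
  have hsq : (∑ k, |u (p k).1|) ^ 2 ≤ m * ∑ k, u (p k).1 ^ 2 := by
    have := sq_sum_le_card_mul_sum_sq (s := (Finset.univ : Finset (Fin m)))
      (f := fun k => |u (p k).1|)
    simpa [sq_abs] using this
  have hA : γ * r / 2 ≤ (∑ k, |u (p k).1|) / m := by
    have h3 := (abs_le.1 hj₁).1
    have h4 := hsmall u hu
    rw [hur] at h4
    change -(γ * r / 2) ≤ (∑ k, |u (p k).1|) / m - _ at h3
    linarith
  have hA2 : (γ * r / 2) ^ 2 ≤ (∑ k, u (p k).1 ^ 2) / m := by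
    calc (γ * r / 2) ^ 2 ≤ ((∑ k, |u (p k).1|) / m) ^ 2 :=
          pow_le_pow_left₀ (by positivity) hA 2
      _ = (∑ k, |u (p k).1|) ^ 2 / m / m := by rw [div_pow, sq (m : ℝ), div_div]
      _ ≤ (m * ∑ k, u (p k).1 ^ 2) / m / m := by gcongr
      _ = (∑ k, u (p k).1 ^ 2) / m := by rw [mul_div_cancel_left₀ _ hm'.ne']
  have hB := (abs_le.1 hj₂).1
  change -(γ ^ 2 * r ^ 2 / 16) ≤ (∑ k, u (p k).1 * (h (p k).1 - (p k).2)) / m at hB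
  have hexp : (∑ k, ((f (p k).1 - (p k).2) ^ 2 - (h (p k).1 - (p k).2) ^ 2)) / m =
      c ^ 2 * ((∑ k, u (p k).1 ^ 2) / m) +
        2 * c * ((∑ k, u (p k).1 * (h (p k).1 - (p k).2)) / m) := by
    rw [← mul_div_assoc, ← mul_div_assoc, ← add_div, Finset.mul_sum, Finset.mul_sum,
      ← Finset.sum_add_distrib]
    congr 1
    refine Finset.sum_congr rfl fun k _ => ?_
    have h5 : f (p k).1 = h (p k).1 + c * u (p k).1 := by
      have := congrFun hfu (p k).1
      simp only [Pi.sub_apply, Pi.smul_apply, smul_eq_mul] at this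
      linarith
    rw [h5]; ring
  change 0 < (∑ k, ((f (p k).1 - (p k).2) ^ 2 - (h (p k).1 - (p k).2) ^ 2)) / m
  rw [hexp]
  set S := (∑ k, u (p k).1 ^ 2) / m
  set T := (∑ k, u (p k).1 * (h (p k).1 - (p k).2)) / m
  have hx : 0 < γ ^ 2 * r ^ 2 := by positivity
  -- Since `1 ≤ c`, scaling up only helps the quadratic term: `c * S` is at least `γ² r² / 4`, while
  -- `2 * T` is at least `-γ² r² / 8`.
  have hS : γ ^ 2 * r ^ 2 / 4 ≤ c * S := by
    have : γ ^ 2 * r ^ 2 / 4 ≤ S := by linarith [hA2, (by ring : (γ * r / 2) ^ 2 = γ ^ 2 * r ^ 2 / 4)]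
    nlinarith
  have : 0 < c * (c * S + 2 * T) := mul_pos (by linarith) (by linarith)
  linarith [this, (by ring : c * (c * S + 2 * T) = c ^ 2 * S + 2 * c * T)]

/-- On the event of the uniform estimate, the distance oracle separates far functions from close
ones. -/
theorem medDist_of_uniform [IsProbabilityMeasure μ] (hF : ∀ f ∈ F, MemLp f 2 μ) (hh : h ∈ F)
    (hr : 0 < r) (hγ : 0 < γ) (hγ1 : γ ≤ 1)
    (hsmall : ∀ u ∈ localization μ F h r, γ * (eLpNorm u 2 μ).toReal ≤ ∫ x, |u x| ∂μ)
    (hℓ : 0 < ℓ) (hk : 0 < N / 3 / ℓ) (hN : 0 + N / 3 / ℓ * ℓ ≤ N) {D : Fin N → 𝒳 × ℝ}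
    (h₃ : ∀ u ∈ localization μ F h r, 4 * (Finset.univ.filter fun j => γ * r / 2 <
      |blockDeviation μ (fun x => |u x|) (blocks (blockPos hN) (fun i => (D i).1) j)|).card <
        N / 3 / ℓ)
    {f : 𝒳 → ℝ} (hf : f ∈ F) :
    (4 / γ * r ≤ (eLpNorm (f - h) 2 μ).toReal → 2 * r ≤ medDist ℓ D f h) ∧
      (2 * r ≤ medDist ℓ D f h → r ≤ (eLpNorm (f - h) 2 μ).toReal) := by
  have hℓ' : (0 : ℝ) < ℓ := by positivity
  constructor
  · intro hfar
    have h4 : r ≤ 4 / γ * r := by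
      have : 1 ≤ 4 / γ := by rw [one_le_div hγ]; linarith
      nlinarith
    obtain ⟨u, hu, hur, hfu⟩ := exists_normalized hF hh hr hf (h4.trans hfar)
    set s := (eLpNorm (f - h) 2 μ).toReal
    -- There is only one exceptional set here; it is supplied twice.
    refine le_median hk (lt_two_mul_card_of_bad (h₃ u hu) (h₃ u hu) fun j hj _ => ?_)
    rw [not_lt] at hj
    rw [blockMean_eq hN]
    simp only [blockDeviation, blocks] at hj
    have h5 := hsmall u hu
    rw [hur] at h5
    have h6 : ∀ x, |f x - h x| = s / r * |u x| := by
      intro x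
      have h7 := congrFun hfu x
      simp only [Pi.sub_apply, Pi.smul_apply, smul_eq_mul] at h7
      have hs0 : 0 ≤ s / r := div_nonneg ENNReal.toReal_nonneg hr.le
      rw [h7, abs_mul, abs_of_nonneg hs0]
    simp only [h6]
    rw [← Finset.mul_sum, mul_div_assoc]
    have h8 : γ * r / 2 ≤ (∑ k, |u (D (blockPos hN (j, k))).1|) / ℓ := by
      linarith [(abs_le.1 hj).1]
    calc 2 * r = (4 / γ * r) / r * (γ * r / 2) := by field_simp; norm_num
      _ ≤ s / r * ((∑ k, |u (D (blockPos hN (j, k))).1|) / ℓ) := by gcongr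
  · intro hmed
    by_contra hlt
    rw [not_le] at hlt
    have hmem : MemLp (f - h) 2 μ := (hF f hf).sub (hF h hh)
    have hu : f - h ∈ localization μ F h r := by
      refine mem_localization_iff.2 ⟨f, hf, 1, ⟨zero_le_one, le_rfl⟩, by simp, ?_⟩
      rw [← ENNReal.ofReal_toReal hmem.eLpNorm_ne_top]
      exact ENNReal.ofReal_le_ofReal hlt.le
    refine absurd hmed (not_le.2 (median_lt hk
      (lt_two_mul_card_of_bad (h₃ _ hu) (h₃ _ hu) fun j hj _ => ?_)))
    rw [not_lt] at hj
    rw [blockMean_eq hN]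
    simp only [blockDeviation, blocks] at hj
    -- On a good block the mean is at most `E|f - h| + γ * r / 2`, which is below `3 * r / 2`
    -- because `γ ≤ 1`.
    have h5 := integral_abs_le_eLpNorm hmem
    have h6 := (abs_le.1 hj).2
    simp only [Pi.sub_apply] at h5 h6
    nlinarith

end Matches

/-! ### Probability of the good event -/

section Events

variable {𝒳 : Type*} [MeasurableSpace 𝒳] {μ : Measure 𝒳} {F : Set (𝒳 → ℝ)} {h : 𝒳 → ℝ}
  {r γ A σ : ℝ} {N n ℓ : ℕ}

theorem memLp_of_mem_localization (hF : ∀ f ∈ F, MemLp f 2 μ) (hh : h ∈ F) {u : 𝒳 → ℝ}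
    (hu : u ∈ localization μ F h r) : MemLp u 2 μ := by
  obtain ⟨f, hf, t, _, rfl, _⟩ := mem_localization_iff.1 hu
  exact ((hF f hf).sub (hF h hh)).const_smul t

/-- The uniform estimate for the block means of `|u|` over the localized class. -/
theorem measure_abs_blockDeviation_le [IsProbabilityMeasure μ] {m s : ℕ}
    (hF : ∀ f ∈ F, MemLp f 2 μ) (hh : h ∈ F) (hr : 0 < r) (hγ : 0 < γ) (hN0 : 0 < N) (hn : 0 < n)
    (hm : 0 < m) (hN : s + n * m ≤ N) (hvar : 64 ≤ m * γ ^ 2)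
    (hA : ENNReal.ofReal √(N : ℝ) * signedSup μ N (localization μ F h r) ≤ ENNReal.ofReal (A * r))
    (hA' : 1024 * A ≤ n * m * γ) :
    (Measure.pi fun _ : Fin N => μ) {D | ∃ u ∈ localization μ F h r,
      n ≤ 4 * (Finset.univ.filter fun j => γ * r / 2 <
        |blockDeviation μ (fun x => |u x|) (blocks (blockPos hN) D j)|).card} ≤
      ENNReal.ofReal (Real.exp (-(n / 128))) := by
  have hu2 : ∀ u : localization μ F h r, MemLp u.1 2 μ := fun u =>
    memLp_of_mem_localization hF hh u.2
  refine le_trans (measure_mono ?_) (measure_blockDeviation_le μ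
    (fun u : localization μ F h r => u.1) (φ := fun t => |t|) abs_abs_sub_abs_le_abs_sub abs_zero
    (fun u => (hu2 u).norm) (s := r ^ 2) (fun u => ?_) hn hm (blockPos_injective hN)
    (τ := γ * r / 2) (by positivity) ?_ ?_)
  · rintro D ⟨u, hu, hD⟩
    exact ⟨⟨u, hu⟩, hD⟩
  · simp only [sq_abs]
    rw [integral_sq_eq_eLpNorm_sq (hu2 u)]
    obtain ⟨_, _, _, _, _, hle⟩ := mem_localization_iff.1 u.2
    exact pow_le_pow_left₀ ENNReal.toReal_nonneg (ENNReal.toReal_le_of_le_ofReal hr.le hle) 2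
  -- With `τ = γ * r / 2`, the variance condition `16 * r² ≤ m * τ²` amounts to `64 ≤ m * γ²`, and
  -- the Rademacher threshold is `n * m * γ * r / 1024`.
  · have : 0 ≤ r ^ 2 * (m * γ ^ 2 - 64) := mul_nonneg (by positivity) (by linarith)
    nlinarith
  · refine (rademacherSup_le_signedSup μ hN0 _).trans (hA.trans (ENNReal.ofReal_le_ofReal ?_))
    nlinarith

/-- The uniform estimate for the block means of the multiplier part. -/
theorem measure_multiplier_blockDeviation_le {P : Measure (𝒳 × ℝ)} [IsProbabilityMeasure P]
    {m s : ℕ} (hr : 0 < r) (hγ : 0 < γ)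
    (hL2 : ∀ u ∈ localization μ F h r, MemLp (fun z : 𝒳 × ℝ => u z.1 * (h z.1 - z.2)) 2 P)
    (hsq : ∀ u ∈ localization μ F h r, ∫ z, (u z.1 * (h z.1 - z.2)) ^ 2 ∂P ≤ σ ^ 2 * r ^ 2)
    (hN0 : 0 < N) (hn : 0 < n) (hm : 0 < m) (hN : s + n * m ≤ N)
    (hvar : 4096 * σ ^ 2 ≤ m * γ ^ 4 * r ^ 2)
    (hA : ENNReal.ofReal √(N : ℝ) * signedSup P N
      ((fun (w : 𝒳 → ℝ) (z : 𝒳 × ℝ) => w z.1 * (h z.1 - z.2)) '' localization μ F h r) ≤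
        ENNReal.ofReal (A * r ^ 2))
    (hA' : 8192 * A ≤ n * m * γ ^ 2) :
    (Measure.pi fun _ : Fin N => P) {D | ∃ u ∈ localization μ F h r,
      n ≤ 4 * (Finset.univ.filter fun j => γ ^ 2 * r ^ 2 / 16 <
        |blockDeviation P (fun z => u z.1 * (h z.1 - z.2)) (blocks (blockPos hN) D j)|).card} ≤
      ENNReal.ofReal (Real.exp (-(n / 128))) := by
  set V := (fun (w : 𝒳 → ℝ) (z : 𝒳 × ℝ) => w z.1 * (h z.1 - z.2)) '' localization μ F h r
  refine le_trans (measure_mono ?_) (measure_blockDeviation_le P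
    (fun v : V => v.1) (φ := fun t => t) (fun _ _ => le_rfl) rfl
    ?_ (s := σ ^ 2 * r ^ 2) ?_ hn hm (blockPos_injective hN)
    (τ := γ ^ 2 * r ^ 2 / 16) (by positivity) ?_ ?_)
  · rintro D ⟨u, hu, hD⟩
    exact ⟨⟨_, u, hu, rfl⟩, hD⟩
  · rintro ⟨_, u, hu, rfl⟩
    exact hL2 u hu
  · rintro ⟨_, u, hu, rfl⟩
    exact hsq u hu
  -- With `τ = γ² r² / 16`, the constants are `4096 = 16 * 16²` for the variance and `8192 = 512 *
  -- 16` for the Rademacher term.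
  · have : 0 ≤ r ^ 2 * (m * γ ^ 4 * r ^ 2 - 4096 * σ ^ 2) :=
      mul_nonneg (by positivity) (by linarith)
    linarith [(by ring : r ^ 2 * (m * γ ^ 4 * r ^ 2 - 4096 * σ ^ 2) =
      256 * (m * (γ ^ 2 * r ^ 2 / 16) ^ 2 - 16 * (σ ^ 2 * r ^ 2)))]
  · refine (rademacherSup_le_signedSup P hN0 _).trans (hA.trans (ENNReal.ofReal_le_ofReal ?_))
    have : 0 ≤ r ^ 2 * (n * m * γ ^ 2 - 8192 * A) := mul_nonneg (by positivity) (by linarith)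
    linarith [(by ring : r ^ 2 * (n * m * γ ^ 2 - 8192 * A) =
      8192 * (n * m * (γ ^ 2 * r ^ 2 / 16) / 512 - A * r ^ 2))]

/-- With overwhelming probability `h` loses no match, and defeats all the functions far from it. -/
theorem measure_tournament_fails_le {P : Measure (𝒳 × ℝ)} [IsProbabilityMeasure P]
    (hμ : μ = P.map Prod.fst) (hF : ∀ f ∈ F, MemLp f 2 μ) (hh : h ∈ F) (hr : 0 < r)
    (hγ : 0 < γ) (hγ1 : γ ≤ 1)
    (hsmall : ∀ u ∈ localization μ F h r, γ * (eLpNorm u 2 μ).toReal ≤ ∫ x, |u x| ∂μ)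
    (hL2 : ∀ u ∈ localization μ F h r, MemLp (fun z : 𝒳 × ℝ => u z.1 * (h z.1 - z.2)) 2 P)
    (hmean : ∀ u ∈ localization μ F h r, ∫ z, u z.1 * (h z.1 - z.2) ∂P = 0)
    (hsq : ∀ u ∈ localization μ F h r, ∫ z, (u z.1 * (h z.1 - z.2)) ^ 2 ∂P ≤ σ ^ 2 * r ^ 2)
    (hn : 0 < n) (hm : 0 < N / 3 / n) (hℓ : 0 < ℓ) (hk : 0 < N / 3 / ℓ)
    (hvar₁ : 64 ≤ (N / 3 / n : ℕ) * γ ^ 2)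
    (hvar₂ : 4096 * σ ^ 2 ≤ (N / 3 / n : ℕ) * γ ^ 4 * r ^ 2) (hvar₃ : 64 ≤ ℓ * γ ^ 2)
    (hA₁ : ENNReal.ofReal √(N : ℝ) * signedSup μ N (localization μ F h r) ≤
      ENNReal.ofReal (A * r))
    (hA₂ : ENNReal.ofReal √(N : ℝ) * signedSup P N
      ((fun (w : 𝒳 → ℝ) (z : 𝒳 × ℝ) => w z.1 * (h z.1 - z.2)) '' localization μ F h r) ≤
        ENNReal.ofReal (A * r ^ 2))
    (hA₁' : 1024 * A ≤ n * (N / 3 / n : ℕ) * γ) (hA₂' : 8192 * A ≤ n * (N / 3 / n : ℕ) * γ ^ 2)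
    (hA₃' : 1024 * A ≤ (N / 3 / ℓ : ℕ) * ℓ * γ) :
    (Measure.pi fun _ : Fin N => P)
        {D | ¬ ((∀ f ∈ F, Allowed ℓ 2 r D h f → ¬ Beats n D f h) ∧
          ∀ f ∈ F, 4 / γ * r ≤ (eLpNorm (f - h) 2 μ).toReal →
            Allowed ℓ 2 r D f h ∧ Beats n D h f)} ≤
      ENNReal.ofReal (Real.exp (-(n / 128))) + ENNReal.ofReal (Real.exp (-(n / 128))) +
        ENNReal.ofReal (Real.exp (-((N / 3 / ℓ : ℕ) / 128))) := by
  have hμP : IsProbabilityMeasure μ := hμ ▸ Measure.isProbabilityMeasure_map measurable_fst.aemeasurable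
  have hN0 : 0 < N := by
    rcases Nat.eq_zero_or_pos N with h0 | h0
    · subst h0; simp at hk
    · exact h0
  have hN₂ : N / 3 + n * (N / 3 / n) ≤ N := by
    have := Nat.mul_div_le (N / 3) n
    omega
  have hN₁ : 0 + N / 3 / ℓ * ℓ ≤ N := by
    have := Nat.div_mul_le_self (N / 3) ℓ
    omega
  have hfst : MeasurePreserving (fun (D : Fin N → 𝒳 × ℝ) i => (D i).1)
      (Measure.pi fun _ : Fin N => P) (Measure.pi fun _ : Fin N => μ) :=
    measurePreserving_pi _ _ fun _ => ⟨measurable_fst, hμ.symm⟩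
  have hpull : ∀ S : Set (Fin N → 𝒳), (Measure.pi fun _ : Fin N => P)
      ((fun (D : Fin N → 𝒳 × ℝ) i => (D i).1) ⁻¹' S) ≤ (Measure.pi fun _ : Fin N => μ) S :=
    fun S => hfst.map_eq ▸ Measure.le_map_apply hfst.aemeasurable S
  have hE₁ := measure_abs_blockDeviation_le hF hh hr hγ hN0 hn hm hN₂ hvar₁ hA₁ hA₁'
  have hE₂ := measure_multiplier_blockDeviation_le hr hγ hL2 hsq hN0 hn hm hN₂ hvar₂ hA₂ hA₂'
  have hE₃ := measure_abs_blockDeviation_le hF hh hr hγ hN0 hk hℓ hN₁ hvar₃ hA₁ hA₃'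
  refine le_trans ?_ (add_le_add (add_le_add ((hpull _).trans hE₁) hE₂) ((hpull _).trans hE₃))
  refine le_trans (measure_mono ?_) ((measure_union_le _ _).trans
    (add_le_add (measure_union_le _ _) le_rfl))
  intro D hD
  by_contra hnot
  simp only [Set.mem_union, Set.mem_preimage, Set.mem_ofPred_eq, not_or, not_exists, not_and,
    not_le] at hnot
  obtain ⟨⟨h₁, h₂⟩, h₃⟩ := hnot
  have hbeats : ∀ f ∈ F, r ≤ (eLpNorm (f - h) 2 μ).toReal → Beats n D h f := fun f hf hrf =>
    beats_of_uniform hF hh hr hγ hsmall hmean hm hN₂ rfl h₁ h₂ hf hrf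
  have hdist : ∀ f ∈ F, _ := fun f hf =>
    medDist_of_uniform hF hh hr hγ hγ1 hsmall hℓ hk hN₁ h₃ (f := f) hf
  -- A match against `h` takes place only at distance at least `r`; there `h` beats its opponent and
  -- so cannot be beaten by it.
  refine hD ⟨fun f hf hall => (hbeats f hf ((hdist f hf).2 ?_)).not_symm, fun f hf hfar => ?_⟩
  · rw [medDist_comm]; exact hall
  · have hall := (hdist f hf).1 hfar
    exact ⟨hall, hbeats f hf ((hdist f hf).2 hall)⟩

end Events

/-! ### Independent noise: excess risk and multipliers -/

section Noise

variable {𝒳 Ω : Type*} [MeasurableSpace 𝒳] [MeasurableSpace Ω] {Pr : Measure Ω}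
  {X : Ω → 𝒳} {W : Ω → ℝ} {f₀ h : 𝒳 → ℝ}

theorem integral_noise_mul (hX : Measurable X) (hind : IndepFun X W Pr)
    (hW : Measurable W) (hW0 : ∫ ω, W ω ∂Pr = 0) {u : 𝒳 → ℝ} (hu : Measurable u) :
    ∫ ω, u (X ω) * W ω ∂Pr = 0 := by
  have hi : IndepFun (fun ω => u (X ω)) W Pr := hind.comp hu measurable_id
  have := hi.integral_mul_eq_mul_integral (hu.comp hX).aestronglyMeasurable
    hW.aestronglyMeasurable
  simp only [hW0, mul_zero] at this
  exact this

theorem integral_map_pair {g : 𝒳 × ℝ → ℝ} (hg : Measurable g) (hX : Measurable X)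
    {Y : Ω → ℝ} (hY : Measurable Y) :
    ∫ z, g z ∂(Pr.map fun ω => (X ω, Y ω)) = ∫ ω, g (X ω, Y ω) ∂Pr :=
  integral_map (hX.prodMk hY).aemeasurable hg.aestronglyMeasurable

/-- The excess risk is the squared distance to `f₀`. -/
theorem risk_eq (hX : Measurable X) (hW : Measurable W) (hf₀ : Measurable f₀)
    (hf₀2 : MemLp f₀ 2 (Pr.map X)) (hind : IndepFun X W Pr) (hW0 : ∫ ω, W ω ∂Pr = 0)
    (hW2 : MemLp W 2 Pr) {f : 𝒳 → ℝ} (hf : Measurable f) (hf2 : MemLp f 2 (Pr.map X)) :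
    risk (Pr.map fun ω => (X ω, f₀ (X ω) + W ω)) f =
      (eLpNorm (f - f₀) 2 (Pr.map X)).toReal ^ 2 + ∫ ω, W ω ^ 2 ∂Pr := by
  have hd : MemLp (f - f₀) 2 (Pr.map X) := hf2.sub hf₀2
  have hdX : MemLp (fun ω => (f - f₀) (X ω)) 2 Pr :=
    hd.comp_measurePreserving ⟨hX, rfl⟩
  rw [risk, integral_map_pair (by fun_prop) hX (by fun_prop), ← integral_sq_eq_eLpNorm_sq hd,
    integral_map hX.aemeasurable ((hf.sub hf₀).pow_const 2).aestronglyMeasurable]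
  have hcross : Integrable (fun ω => (f - f₀) (X ω) * W ω) Pr := hdX.integrable_mul hW2
  have hexp : ∀ ω, (f (X ω) - (f₀ (X ω) + W ω)) ^ 2 =
      (f - f₀) (X ω) ^ 2 + W ω ^ 2 - 2 * ((f - f₀) (X ω) * W ω) := by
    intro ω; simp only [Pi.sub_apply]; ring
  simp only [hexp]
  have hs := hdX.integrable_sq.add hW2.integrable_sq
  calc ∫ ω, ((f - f₀) (X ω) ^ 2 + W ω ^ 2 - 2 * ((f - f₀) (X ω) * W ω)) ∂Pr
      = ∫ ω, ((f - f₀) (X ω) ^ 2 + W ω ^ 2) ∂Pr - ∫ ω, 2 * ((f - f₀) (X ω) * W ω) ∂Pr :=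
        integral_sub hs (hcross.const_mul 2)
    _ = _ := by
        rw [integral_const_mul, integral_noise_mul hX hind hW hW0 (hf.sub hf₀), mul_zero, sub_zero,
          integral_add hdX.integrable_sq hW2.integrable_sq]

/-- The multiplier `u(X) (h(X) - Y)`, for a function `h` that agrees with `f₀`. -/
theorem multiplier_properties (hX : Measurable X) (hW : Measurable W) (hf₀ : Measurable f₀)
    (hh : Measurable h) (hhf₀ : h =ᵐ[Pr.map X] f₀) (hind : IndepFun X W Pr)
    (hW0 : ∫ ω, W ω ∂Pr = 0) (hW2 : MemLp W 2 Pr) {u : 𝒳 → ℝ} (hu : Measurable u)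
    (hu2 : MemLp u 2 (Pr.map X)) :
    MemLp (fun z : 𝒳 × ℝ => u z.1 * (h z.1 - z.2)) 2 (Pr.map fun ω => (X ω, f₀ (X ω) + W ω)) ∧
      ∫ z, u z.1 * (h z.1 - z.2) ∂(Pr.map fun ω => (X ω, f₀ (X ω) + W ω)) = 0 ∧
      ∫ z, (u z.1 * (h z.1 - z.2)) ^ 2 ∂(Pr.map fun ω => (X ω, f₀ (X ω) + W ω)) =
        (eLpNorm u 2 (Pr.map X)).toReal ^ 2 * (eLpNorm W 2 Pr).toReal ^ 2 := by
  have hY : Measurable fun ω => f₀ (X ω) + W ω := by fun_prop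
  have hv : Measurable fun z : 𝒳 × ℝ => u z.1 * (h z.1 - z.2) := by fun_prop
  have hae : ∀ᵐ ω ∂Pr, u (X ω) * (h (X ω) - (f₀ (X ω) + W ω)) = -(u (X ω) * W ω) := by
    filter_upwards [ae_of_ae_map hX.aemeasurable hhf₀] with ω hω
    rw [hω]; ring
  have huX : MemLp (fun ω => u (X ω)) 2 Pr := hu2.comp_measurePreserving ⟨hX, rfl⟩
  have hi2 : IndepFun (fun ω => u (X ω) ^ 2) (fun ω => W ω ^ 2) Pr :=
    hind.comp (hu.pow_const 2) (measurable_id.pow_const 2)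
  -- Independence makes the product of these two square-integrable variables square-integrable
  -- again.
  have hint : Integrable (fun ω => u (X ω) ^ 2 * W ω ^ 2) Pr :=
    hi2.integrable_mul huX.integrable_sq hW2.integrable_sq
  have hmem : MemLp (fun ω => u (X ω) * W ω) 2 Pr := by
    refine (memLp_two_iff_integrable_sq ((hu.comp hX).mul hW).aestronglyMeasurable).2 ?_
    exact hint.congr (ae_of_all _ fun ω => (mul_pow (u (X ω)) (W ω) 2).symm)
  refine ⟨?_, ?_, ?_⟩
  · refine (memLp_map_measure_iff hv.aestronglyMeasurable (hX.prodMk hY).aemeasurable).2 ?_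
    refine hmem.neg.ae_eq ?_
    filter_upwards [hae] with ω hω using hω.symm
  · rw [integral_map_pair hv hX hY, integral_congr_ae hae, integral_neg,
      integral_noise_mul hX hind hW hW0 hu, neg_zero]
  · rw [integral_map_pair (hv.pow_const 2) hX hY]
    have hae2 : ∀ᵐ ω ∂Pr, (u (X ω) * (h (X ω) - (f₀ (X ω) + W ω))) ^ 2 =
        u (X ω) ^ 2 * W ω ^ 2 := by
      filter_upwards [hae] with ω hω
      rw [hω]; ring
    rw [integral_congr_ae hae2, ← integral_sq_eq_eLpNorm_sq hW2, ← integral_sq_eq_eLpNorm_sq hu2,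
      integral_map hX.aemeasurable (hu.pow_const 2).aestronglyMeasurable]
    exact hi2.integral_mul_eq_mul_integral huX.integrable_sq.aestronglyMeasurable
      hW2.integrable_sq.aestronglyMeasurable

end Noise

/-! ### Choice of the constants -/

section Constants

/-- The block length of the distance oracle, in terms of the ratio `γ` of the norms. -/
noncomputable def oracleLength (γ : ℝ) : ℕ := ⌈64 / γ ^ 2⌉₊

/-- The proportion of blocks of the preliminary round, in terms of the ratio `γ` of the norms. -/
noncomputable def blockRatio (γ : ℝ) : ℝ := γ ^ 4 / (8192 * oracleLength γ)

variable {γ : ℝ}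

theorem oracleLength_pos (hγ : 0 < γ) : 0 < oracleLength γ := Nat.ceil_pos.2 (by positivity)

theorem le_oracleLength_mul (hγ : 0 < γ) : 64 ≤ oracleLength γ * γ ^ 2 :=
  (div_le_iff₀ (by positivity)).1 (Nat.le_ceil _)

theorem blockRatio_pos (hγ : 0 < γ) : 0 < blockRatio γ := by
  have := oracleLength_pos hγ
  unfold blockRatio; positivity

/-- The first bound makes the blocks of the preliminary round long enough for the variance
conditions. The second makes the oracle's blocks at least as numerous as those of the round. -/
theorem blockRatio_mul_le (hγ : 0 < γ) (hγ1 : γ ≤ 1) :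
    8192 * blockRatio γ ≤ γ ^ 4 ∧ 2 * oracleLength γ * blockRatio γ ≤ 1 := by
  have hℓ : (1 : ℝ) ≤ oracleLength γ := by exact_mod_cast oracleLength_pos hγ
  have h4 : γ ^ 4 ≤ 1 := pow_le_one₀ hγ.le hγ1
  have h4' : 0 < γ ^ 4 := by positivity
  have hid : blockRatio γ * (8192 * oracleLength γ) = γ ^ 4 :=
    div_mul_cancel₀ _ (by positivity)
  have hθ := blockRatio_pos hγ
  constructor <;> nlinarith

/-- The sizes of the blocks, if there are sufficiently many of them. -/
theorem block_sizes (hγ : 0 < γ) (hγ1 : γ ≤ 1) {N n : ℕ} {σ r : ℝ} (hσ : 0 < σ) (hr : 0 < r)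
    (hn : n = numBlocks N (blockRatio γ) σ r) (hn512 : 512 ≤ n) :
    0 < N / 3 / n ∧ 0 < N / 3 / oracleLength γ ∧ n ≤ N / 3 / oracleLength γ ∧
      64 ≤ (N / 3 / n : ℕ) * γ ^ 2 ∧ 4096 * σ ^ 2 ≤ (N / 3 / n : ℕ) * γ ^ 4 * r ^ 2 ∧
      (N : ℝ) ≤ 10 * (n * (N / 3 / n : ℕ)) ∧
      (N : ℝ) ≤ 10 * ((N / 3 / oracleLength γ : ℕ) * oracleLength γ) ∧
      blockRatio γ * N * min 1 (r ^ 2 / σ ^ 2) ≤ 10 * n := by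
  set θ := blockRatio γ
  set ℓ := oracleLength γ
  set K := N / 3 with hK
  set ω := min 1 (r ^ 2 / σ ^ 2)
  have hθ : 0 < θ := blockRatio_pos hγ
  have hℓ : 0 < ℓ := oracleLength_pos hγ
  obtain ⟨hθγ, hθℓ⟩ := blockRatio_mul_le hγ hγ1
  have hω0 : 0 ≤ ω := le_min zero_le_one (by positivity)
  have hω1 : ω ≤ 1 := min_le_left _ _
  have hn' : n = ⌊θ * K * ω⌋₊ := by rw [hn, numBlocks, div_pow]
  have hn0 : (512 : ℝ) ≤ n := by exact_mod_cast hn512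
  have hle : (n : ℝ) ≤ θ * K * ω := by
    rw [hn']; exact Nat.floor_le (by positivity)
  have hlt : θ * K * ω < n + 1 := by rw [hn']; exact Nat.lt_floor_add_one _
  have hle1 : (n : ℝ) ≤ θ * K := hle.trans (mul_le_of_le_one_right (by positivity) hω1)
  have hnℓ : n * ℓ ≤ K := by
    have h1 : (n : ℝ) * ℓ ≤ K := by
      have h2 : (n : ℝ) * ℓ ≤ θ * K * ℓ := by gcongr
      have h3 : (K : ℝ) * (2 * ℓ * θ) ≤ K * 1 := by gcongr
      have h4 : (0 : ℝ) ≤ K := Nat.cast_nonneg _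
      nlinarith
    exact_mod_cast h1
  have hKpos : 0 < K := lt_of_lt_of_le (Nat.mul_pos (by omega) hℓ) hnℓ
  have hK0 : (0 : ℝ) < K := by exact_mod_cast hKpos
  -- `N ≤ 3 * K + 2` and `1 ≤ K`.
  have hNK : (N : ℝ) ≤ 5 * K := by
    have : N ≤ 5 * K := by omega
    exact_mod_cast this
  have hnK : n ≤ K := (Nat.le_mul_of_pos_right n hℓ).trans hnℓ
  have hmpos : 0 < K / n := Nat.div_pos hnK (by omega)
  have hnk : n ≤ K / ℓ := (Nat.le_div_iff_mul_le hℓ).2 hnℓ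
  have hkpos : 0 < K / ℓ := by omega
  set m := K / n
  set k := K / ℓ
  have hm1 : (1 : ℝ) ≤ m := by exact_mod_cast hmpos
  have hk1 : (1 : ℝ) ≤ k := by exact_mod_cast hkpos
  have hKm : (K : ℝ) < n * (m + 1) := by exact_mod_cast Nat.lt_mul_div_succ K (by omega : 0 < n)
  have hKk : (K : ℝ) < ℓ * (k + 1) := by exact_mod_cast Nat.lt_mul_div_succ K hℓ
  -- Rounding the block length down costs at most a factor two, as `m + 1 ≤ 2 * m`.
  have hKnm : (K : ℝ) ≤ 2 * (n * m) := by nlinarith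
  have hKkℓ : (K : ℝ) ≤ 2 * (k * ℓ) := by
    have : (1 : ℝ) ≤ ℓ := by exact_mod_cast hℓ
    nlinarith
  have hθm : 1 ≤ 2 * θ * m := by
    have h1 : (K : ℝ) * 1 ≤ K * (2 * θ * m) := by
      have : (n : ℝ) * m ≤ θ * K * m := by gcongr
      linarith
    exact le_of_mul_le_mul_left h1 hK0
  have hγ4 : γ ^ 4 ≤ γ ^ 2 := pow_le_pow_of_le_one hγ.le hγ1 (by norm_num)
  have hm64 : 64 ≤ m * γ ^ 2 := by
    have h1 : 8192 * θ * m ≤ γ ^ 4 * m := by gcongr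
    have h2 : γ ^ 4 * m ≤ γ ^ 2 * m := by gcongr
    linarith
  refine ⟨hmpos, hkpos, hnk, hm64, ?_, by linarith, by linarith, ?_⟩
  · have h1 : (n : ℝ) * σ ^ 2 ≤ θ * K * r ^ 2 := by
      have h2 : θ * K * ω ≤ θ * K * (r ^ 2 / σ ^ 2) := by
        gcongr; exact min_le_right _ _
      have h3 := hle.trans h2
      rw [← mul_div_assoc, le_div_iff₀ (by positivity)] at h3
      exact h3
    have h4 : σ ^ 2 ≤ 2 * θ * m * r ^ 2 := by
      have h5 : (K : ℝ) * σ ^ 2 ≤ K * (2 * θ * m * r ^ 2) := by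
        calc (K : ℝ) * σ ^ 2 ≤ 2 * (n * m) * σ ^ 2 := by gcongr
          _ = 2 * m * (n * σ ^ 2) := by ring
          _ ≤ 2 * m * (θ * K * r ^ 2) := by gcongr
          _ = _ := by ring
      exact le_of_mul_le_mul_left h5 hK0
    calc 4096 * σ ^ 2 ≤ 4096 * (2 * θ * m * r ^ 2) := by gcongr
      _ = 8192 * θ * (m * r ^ 2) := by ring
      _ ≤ γ ^ 4 * (m * r ^ 2) := by gcongr
      _ = _ := by ring
  · calc θ * N * ω ≤ θ * (5 * K) * ω := by gcongr
      _ = 5 * (θ * K * ω) := by ring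
      _ ≤ 5 * (n + 1) := by gcongr
      _ ≤ 10 * n := by linarith

/-- With few blocks, the thresholds of the packing conditions fall below `log 2`. -/
theorem threshold_lt_log_two (hγ : 0 < γ) (hγ1 : γ ≤ 1) {N : ℕ} {σ r : ℝ}
    (hn512 : numBlocks N (blockRatio γ) σ r < 512) :
    (blockRatio γ * γ ^ 2 / 81920) ^ 2 * N * min 1 (r ^ 2 / σ ^ 2) < Real.log 2 := by
  set θ := blockRatio γ
  set K := N / 3 with hK
  set ω := min 1 (r ^ 2 / σ ^ 2)
  have hθ : 0 < θ := blockRatio_pos hγ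
  have hθ1 : θ ≤ 1 := by
    have := (blockRatio_mul_le hγ hγ1).1
    have h4 : γ ^ 4 ≤ 1 := pow_le_one₀ hγ.le hγ1
    change 8192 * θ ≤ γ ^ 4 at this
    linarith
  have hω0 : 0 ≤ ω := le_min zero_le_one (by positivity)
  have hω1 : ω ≤ 1 := min_le_left _ _
  have hlt : θ * K * ω < 512 := by
    rw [numBlocks, div_pow] at hn512
    exact_mod_cast Nat.lt_of_floor_lt hn512
  have hN : (N : ℝ) ≤ 3 * K + 2 := by
    have : N ≤ 3 * K + 2 := by omega
    exact_mod_cast this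
  have h1 : θ * (N * ω) ≤ 1538 := by
    calc θ * (N * ω) ≤ θ * ((3 * K + 2) * ω) := by gcongr
      _ = 3 * (θ * K * ω) + 2 * (θ * ω) := by ring
      _ ≤ 3 * 512 + 2 * (1 * 1) := by gcongr
      _ = 1538 := by norm_num
  have hg : θ * γ ^ 2 / 81920 ≤ θ / 81920 := by
    gcongr
    exact mul_le_of_le_one_right hθ.le (pow_le_one₀ hγ.le hγ1)
  have hlog := Real.log_two_gt_d9
  calc (θ * γ ^ 2 / 81920) ^ 2 * N * ω ≤ (θ / 81920) ^ 2 * N * ω := by gcongr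
    _ = θ * (θ * (N * ω)) / 81920 ^ 2 := by ring
    _ ≤ 1 * 1538 / 81920 ^ 2 := by gcongr
    _ < Real.log 2 := by norm_num at hlog ⊢; linarith

/-- Three events may fail. Half of the exponent pays for the factor, as `3 ≤ 1 + n / 256 ≤ exp (n /
256)`; this is where the cut-off 512 comes from. -/
theorem three_mul_exp_le {n N : ℕ} {θ ω : ℝ} (hn : 512 ≤ n) (h : θ * N * ω ≤ 10 * n) :
    3 * Real.exp (-(n / 128)) ≤ Real.exp (-(θ / 2560 * N * ω)) := by
  have hn' : (512 : ℝ) ≤ n := by exact_mod_cast hn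
  have h1 : 3 ≤ Real.exp (n / 256) := by
    have := Real.add_one_le_exp ((n : ℝ) / 256)
    linarith
  calc 3 * Real.exp (-(n / 128)) ≤ Real.exp (n / 256) * Real.exp (-(n / 128)) := by gcongr
    _ = Real.exp (-(n / 256)) := by rw [← Real.exp_add]; congr 1; ring
    _ ≤ _ := Real.exp_le_exp.2 (by linarith [(by ring : θ / 2560 * N * ω = θ * N * ω / 2560)])

end Constants

/-! ### Consequences of exceeding the critical level -/

section Critical

variable {𝒳 : Type*} [MeasurableSpace 𝒳] {μ : Measure 𝒳} {P : Measure (𝒳 × ℝ)}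
  {F : Set (𝒳 → ℝ)} {h : 𝒳 → ℝ} {r σ c₁ c₂ : ℝ} {N : ℕ}

/-- The factor two buys strictness. An infimum strictly below `r` yields an admissible level `r' <
r`, whereas the infimum itself need not be attained. -/
theorem lt_of_two_mul_le {x y : ℝ≥0∞} (hxy : x ≤ y) (hr : 0 < r) (h : 2 * y ≤ ENNReal.ofReal r) :
    x < ENNReal.ofReal r := by
  by_contra hge
  have h1 : ENNReal.ofReal (2 * r) ≤ ENNReal.ofReal r := by
    rw [ENNReal.ofReal_mul zero_le_two, ENNReal.ofReal_ofNat]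
    exact (mul_le_mul_right ((not_lt.1 hge).trans hxy) 2).trans h
  rw [ENNReal.ofReal_le_ofReal_iff hr.le] at h1
  linarith

/-- Above the critical level, the Rademacher complexities satisfy their defining bounds. -/
theorem signedSup_le_of_rStar_le (hr : 0 < r) (hc : 0 ≤ c₁)
    (hstar : 2 * rStar μ P F N σ c₁ c₂ h ≤ ENNReal.ofReal r) :
    ENNReal.ofReal √(N : ℝ) * signedSup μ N (localization μ F h r) ≤
        ENNReal.ofReal (c₁ * N * r) ∧
      ENNReal.ofReal √(N : ℝ) * signedSup P N
        ((fun (w : 𝒳 → ℝ) (z : 𝒳 × ℝ) => w z.1 * (h z.1 - z.2)) '' localization μ F h r) ≤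
          ENNReal.ofReal (c₁ * N * r ^ 2) := by
  have hsq : √(N : ℝ) * √(N : ℝ) = N := Real.mul_self_sqrt (Nat.cast_nonneg _)
  constructor
  · obtain ⟨r', hr', hlt, hp⟩ := exists_of_critLevel_lt (lt_of_two_mul_le
      ((le_max_left _ _).trans (le_max_right _ _) : rE μ F N c₁ h ≤ _) hr hstar)
    have h1 := signedSup_le_of_scaled (Q := μ) (N := N) (V := localization μ F h r)
      (c := r / r') (by positivity) fun w hw => exists_localization_scaled hr' hlt.le hw
    calc _ ≤ ENNReal.ofReal √(N : ℝ) * (ENNReal.ofReal (r / r') *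
          ENNReal.ofReal (c₁ * √(N : ℝ) * r')) := by gcongr; exact h1.trans (by gcongr)
      _ = ENNReal.ofReal (c₁ * N * r) := by
        rw [← ENNReal.ofReal_mul (by positivity), ← ENNReal.ofReal_mul (by positivity)]
        have h2 : √(N : ℝ) * (r / r' * (c₁ * √(N : ℝ) * r')) = c₁ * (√(N : ℝ) * √(N : ℝ)) * r := by
          field_simp
        rw [h2, hsq]
  · obtain ⟨r', hr', hlt, hp⟩ := exists_of_critLevel_lt (lt_of_two_mul_le
      ((le_max_right _ _).trans (le_max_right _ _) : rM μ P F N c₁ h ≤ _) hr hstar)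
    have h1 := signedSup_le_of_scaled (Q := P) (N := N)
      (V := (fun (w : 𝒳 → ℝ) (z : 𝒳 × ℝ) => w z.1 * (h z.1 - z.2)) '' localization μ F h r)
      (V' := (fun (w : 𝒳 → ℝ) (z : 𝒳 × ℝ) => w z.1 * (h z.1 - z.2)) '' localization μ F h r')
      (c := r / r') (by positivity) (by
        rintro _ ⟨w, hw, rfl⟩
        obtain ⟨w', hw', rfl⟩ := exists_localization_scaled hr' hlt.le hw
        exact ⟨_, ⟨w', hw', rfl⟩, by funext z; simp [mul_assoc]⟩)
    calc _ ≤ ENNReal.ofReal √(N : ℝ) * (ENNReal.ofReal (r / r') *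
          ENNReal.ofReal (c₁ * √(N : ℝ) * r' ^ 2)) := by gcongr; exact h1.trans (by gcongr)
      _ = ENNReal.ofReal (c₁ * N * (r * r')) := by
        rw [← ENNReal.ofReal_mul (by positivity), ← ENNReal.ofReal_mul (by positivity)]
        have h2 : √(N : ℝ) * (r / r' * (c₁ * √(N : ℝ) * r' ^ 2)) =
            c₁ * (√(N : ℝ) * √(N : ℝ)) * (r * r') := by field_simp
        rw [h2, hsq]
      -- The multiplier bound is quadratic in `r'` but scales linearly, which leaves `r * r' ≤ r²`.
      _ ≤ _ := by
        refine ENNReal.ofReal_le_ofReal ?_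
        rw [sq]
        gcongr

/-- Above the critical level, and if the thresholds are below `log 2`, the class is confined to a
ball of radius `r`. -/
theorem eLpNorm_sub_le_of_rStar_le (hr : 0 < r) (hσ : 0 < σ) (hc₂ : c₂ ≤ 1) (hh : h ∈ F)
    (hF : ∀ f ∈ F, MemLp f 2 μ) (hstar : 2 * rStar μ P F N σ c₁ c₂ h ≤ ENNReal.ofReal r)
    (hlog : c₁ ^ 2 * N * min 1 (r ^ 2 / σ ^ 2) < Real.log 2) :
    ∀ f ∈ F, eLpNorm (f - h) 2 μ ≤ ENNReal.ofReal r := by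
  have hlog2 : ENNReal.log 2 = ((Real.log 2 : ℝ) : EReal) := by
    rw [← ENNReal.log_ofReal_of_pos zero_lt_two]; simp
  -- Whichever term attains the minimum decides which packing condition has its threshold below `log
  -- 2`: `lambdaQ` for the first, `lambdaM` for the second.
  rcases le_total 1 (r ^ 2 / σ ^ 2) with hle | hle
  · rw [min_eq_left hle, mul_one] at hlog
    obtain ⟨r', hr', hlt, hp⟩ := exists_of_critLevel_lt (lt_of_two_mul_le
      ((le_max_left _ _).trans (le_max_left _ _) : lambdaQ μ F N c₁ c₂ h ≤ _) hr hstar)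
    refine eLpNorm_sub_le_of_logPacking_lt hc₂ hh hF hr' hlt.le (hp.trans_lt ?_)
    rw [hlog2]
    exact_mod_cast hlog
  · rw [min_eq_right hle] at hlog
    obtain ⟨r', hr', hlt, hp⟩ := exists_of_critLevel_lt (lt_of_two_mul_le
      ((le_max_right _ _).trans (le_max_left _ _) : lambdaM μ F N (c₁ / σ) c₂ h ≤ _) hr hstar)
    refine eLpNorm_sub_le_of_logPacking_lt hc₂ hh hF hr' hlt.le (hp.trans_lt ?_)
    rw [hlog2, EReal.coe_lt_coe_iff]
    refine lt_of_le_of_lt ?_ hlog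
    calc (c₁ / σ) ^ 2 * N * r' ^ 2 ≤ (c₁ / σ) ^ 2 * N * r ^ 2 := by gcongr
      _ = _ := by field_simp

end Critical

/-! ### The selection rule and the theorem -/

/-- The rule that selects a qualifier whenever there is one. -/
noncomputable def selectQualifier {𝒳 : Type*} {F : Set (𝒳 → ℝ)} (hF : F.Nonempty) (ℓ : ℕ)
    (β θ σ r : ℝ) {N : ℕ} (D : Fin N → 𝒳 × ℝ) : 𝒳 → ℝ :=
  open scoped Classical in
  if hq : (qualifiers F ℓ β θ σ r D).Nonempty then hq.some else hF.some

theorem selectQualifier_mem {𝒳 : Type*} {F : Set (𝒳 → ℝ)} (hF : F.Nonempty) (ℓ : ℕ)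
    (β θ σ r : ℝ) {N : ℕ} (D : Fin N → 𝒳 × ℝ) : selectQualifier hF ℓ β θ σ r D ∈ F := by
  unfold selectQualifier
  split_ifs with hq
  · exact hq.some_mem.1
  · exact hF.some_mem

theorem selectQualifier_mem_qualifiers {𝒳 : Type*} {F : Set (𝒳 → ℝ)} (hF : F.Nonempty) (ℓ : ℕ)
    (β θ σ r : ℝ) {N : ℕ} (D : Fin N → 𝒳 × ℝ) (hq : (qualifiers F ℓ β θ σ r D).Nonempty) :
    selectQualifier hF ℓ β θ σ r D ∈ qualifiers F ℓ β θ σ r D := by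
  unfold selectQualifier
  rw [dif_pos hq]
  exact hq.some_mem

/-- The estimate for any rule that selects a qualifier whenever there is one. -/
theorem measure_rule_fails_le {q L : ℝ} (hq : 2 < q) (hL : 1 < L) {𝒳 Ω : Type*}
    [MeasurableSpace 𝒳] [MeasurableSpace Ω] {F : Set (𝒳 → ℝ)} (hFm : ∀ f ∈ F, Measurable f)
    {N : ℕ} {σ r : ℝ} (hσ : 0 < σ) (hr0 : 0 ≤ r) {Φ : (Fin N → 𝒳 × ℝ) → 𝒳 → ℝ}
    (hΦ : ∀ D, Φ D ∈ F)
    (hΦq : ∀ D, (qualifiers F (oracleLength (l1Ratio q L)) 2 (blockRatio (l1Ratio q L)) σ r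
      D).Nonempty → Φ D ∈ qualifiers F (oracleLength (l1Ratio q L)) 2
        (blockRatio (l1Ratio q L)) σ r D)
    {Pr : Measure Ω} [IsProbabilityMeasure Pr] {X : Ω → 𝒳} {W : Ω → ℝ} {f₀ h : 𝒳 → ℝ}
    (hX : Measurable X) (hW : Measurable W) (hf₀ : f₀ ∈ F)
    (hF2 : ∀ f ∈ F, MemLp f 2 (Pr.map X))
    (hFq : ∀ f ∈ Submodule.span ℝ F, eLpNorm f (ENNReal.ofReal q) (Pr.map X) ≤
      ENNReal.ofReal L * eLpNorm f 2 (Pr.map X))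
    (hind : IndepFun X W Pr) (hW0 : ∫ ω, W ω ∂Pr = 0) (hWσ : eLpNorm W 2 Pr ≤ ENNReal.ofReal σ)
    (hh : h ∈ F)
    (hmin : risk (Pr.map fun ω => (X ω, f₀ (X ω) + W ω)) h ≤
      risk (Pr.map fun ω => (X ω, f₀ (X ω) + W ω)) f₀)
    (hstar : 2 * rStar (Pr.map X) (Pr.map fun ω => (X ω, f₀ (X ω) + W ω)) F N σ
      (blockRatio (l1Ratio q L) * l1Ratio q L ^ 2 / 81920) (1 / 2) h ≤ ENNReal.ofReal r) :
    (Measure.pi fun _ : Fin N => Pr.map fun ω => (X ω, f₀ (X ω) + W ω))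
        {D | ¬ (eLpNorm (Φ D - f₀) 2 (Pr.map X) ≤ ENNReal.ofReal (4 / l1Ratio q L * r) ∧
          risk (Pr.map fun ω => (X ω, f₀ (X ω) + W ω)) (Φ D) ≤
            risk (Pr.map fun ω => (X ω, f₀ (X ω) + W ω)) f₀ + (4 / l1Ratio q L * r) ^ 2)} ≤
      ENNReal.ofReal (Real.exp
        (-(blockRatio (l1Ratio q L) / 2560 * N * min 1 (r ^ 2 / σ ^ 2)))) := by
  set γ := l1Ratio q L
  set μ := Pr.map X
  set P := Pr.map fun ω => (X ω, f₀ (X ω) + W ω)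
  have hγ : 0 < γ := l1Ratio_pos (by linarith)
  have hγ1 : γ ≤ 1 := l1Ratio_le_one hq hL
  have hf₀m := hFm f₀ hf₀
  have hpair : Measurable fun ω => (X ω, f₀ (X ω) + W ω) := by fun_prop
  have : IsProbabilityMeasure μ := Measure.isProbabilityMeasure_map hX.aemeasurable
  have : IsProbabilityMeasure P := Measure.isProbabilityMeasure_map hpair.aemeasurable
  rcases hr0.eq_or_lt with hr | hr
  -- For `r = 0` the exponent vanishes and the bound is trivial.
  · refine prob_le_one.trans ?_
    simp [← hr]
  have hW2 : MemLp W 2 Pr := ⟨hW.aestronglyMeasurable, hWσ.trans_lt ENNReal.ofReal_lt_top⟩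
  have hμP : μ = P.map Prod.fst := by
    rw [Measure.map_map measurable_fst hpair]; rfl
  have hrisk : ∀ f ∈ F, risk P f =
      (eLpNorm (f - f₀) 2 μ).toReal ^ 2 + ∫ ω, W ω ^ 2 ∂Pr := fun f hf =>
    risk_eq hX hW hf₀m (hF2 f₀ hf₀) hind hW0 hW2 (hFm f hf) (hF2 f hf)
  have hhf₀ : h =ᵐ[μ] f₀ := by
    have h1 := hmin
    rw [hrisk h hh, hrisk f₀ hf₀, sub_self, eLpNorm_zero] at h1
    have h2 : (eLpNorm (h - f₀) 2 μ).toReal = 0 := by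
      have : (0 : ℝ) ≤ (eLpNorm (h - f₀) 2 μ).toReal := ENNReal.toReal_nonneg
      simp only [ENNReal.toReal_zero] at h1
      nlinarith
    have hsub : MemLp (h - f₀) 2 μ := (hF2 h hh).sub (hF2 f₀ hf₀)
    have h3 := (ENNReal.toReal_eq_zero_iff _).1 h2
    have h4 := (eLpNorm_eq_zero_iff hsub.aestronglyMeasurable (by norm_num)).1
      (h3.resolve_right hsub.eLpNorm_ne_top)
    filter_upwards [h4] with x hx
    simpa [sub_eq_zero] using hx
  have hdist : ∀ f, eLpNorm (f - f₀) 2 μ = eLpNorm (f - h) 2 μ := fun f =>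
    eLpNorm_congr_ae (Filter.EventuallyEq.rfl.sub hhf₀.symm)
  -- Both conclusions follow from the distance to `h` alone, by the formula for the risk.
  have hfail : {D : Fin N → 𝒳 × ℝ | ¬ (eLpNorm (Φ D - f₀) 2 μ ≤ ENNReal.ofReal (4 / γ * r) ∧
      risk P (Φ D) ≤ risk P f₀ + (4 / γ * r) ^ 2)} ⊆
      {D | 4 / γ * r < (eLpNorm (Φ D - h) 2 μ).toReal} := by
    intro D hD
    by_contra hnot
    have hle : (eLpNorm (Φ D - f₀) 2 μ).toReal ≤ 4 / γ * r := by
      rw [hdist]; exact not_lt.1 hnot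
    have hfin : eLpNorm (Φ D - f₀) 2 μ ≠ ⊤ := ((hF2 _ (hΦ D)).sub (hF2 f₀ hf₀)).eLpNorm_ne_top
    refine hD ⟨(ENNReal.le_ofReal_iff_toReal_le hfin (by positivity)).2 hle, ?_⟩
    rw [hrisk _ (hΦ D), hrisk f₀ hf₀, sub_self, eLpNorm_zero]
    have := pow_le_pow_left₀ ENNReal.toReal_nonneg hle 2
    simp only [ENNReal.toReal_zero]
    linarith
  refine (measure_mono hfail).trans ?_
  set n := numBlocks N (blockRatio γ) σ r with hn
  rcases lt_or_ge n 512 with hn512 | hn512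
  · have hball := eLpNorm_sub_le_of_rStar_le hr hσ (by norm_num) hh hF2 hstar
      (threshold_lt_log_two hγ hγ1 hn512)
    have hempty : {D : Fin N → 𝒳 × ℝ | 4 / γ * r < (eLpNorm (Φ D - h) 2 μ).toReal} = ∅ := by
      refine Set.eq_empty_of_forall_notMem fun D hD => ?_
      have h1 := ENNReal.toReal_le_of_le_ofReal hr.le (hball _ (hΦ D))
      have h2 : 1 ≤ 4 / γ := by rw [one_le_div hγ]; linarith
      have h3 : 4 / γ * r < (eLpNorm (Φ D - h) 2 μ).toReal := hD
      nlinarith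
    rw [hempty, measure_empty]
    exact zero_le
  obtain ⟨hm, hk, hnk, hvar₁, hvar₂, hNm, hNk, hexp⟩ := block_sizes hγ hγ1 hσ hr hn hn512
  set ℓ := oracleLength γ
  set θ := blockRatio γ
  have hθ : 0 < θ := blockRatio_pos hγ
  have hθ1 : 8192 * θ ≤ 1 :=
    (blockRatio_mul_le hγ hγ1).1.trans (pow_le_one₀ hγ.le hγ1)
  have hu : ∀ u ∈ localization μ F h r, Measurable u ∧ MemLp u 2 μ ∧ u ∈ Submodule.span ℝ F ∧
      (eLpNorm u 2 μ).toReal ≤ r := by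
    intro u hu
    obtain ⟨f, hf, t, _, rfl, hle⟩ := mem_localization_iff.1 hu
    exact ⟨((hFm f hf).sub (hFm h hh)).const_smul t, memLp_of_mem_localization hF2 hh hu,
      Submodule.smul_mem _ _ (Submodule.sub_mem _ (Submodule.subset_span hf)
        (Submodule.subset_span hh)), ENNReal.toReal_le_of_le_ofReal hr.le hle⟩
  have hmult : ∀ u ∈ localization μ F h r, _ := fun u hu' =>
    multiplier_properties hX hW hf₀m (hFm h hh) hhf₀ hind hW0 hW2 (hu u hu').1 (hu u hu').2.1
  obtain ⟨hA₁, hA₂⟩ := signedSup_le_of_rStar_le hr (by positivity) hstar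
  have hN0 : (0 : ℝ) ≤ N := Nat.cast_nonneg _
  have hγ2 : γ ^ 2 ≤ γ := by nlinarith
  -- `81920 = 8192 * 10`: the multiplier condition requires 8192, and `N` is at most ten times the
  -- number of sample points in the blocks.
  have hc : 81920 * (θ * γ ^ 2 / 81920 * N) ≤ γ ^ 2 * N := by
    have : θ * (γ ^ 2 * N) ≤ 1 * (γ ^ 2 * N) := by gcongr; linarith
    linarith [(by ring : 81920 * (θ * γ ^ 2 / 81920 * N) = θ * (γ ^ 2 * N))]
  have hA0 : 0 ≤ θ * γ ^ 2 / 81920 * N := by positivity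
  have hmain := measure_tournament_fails_le (P := P) (n := n) (ℓ := ℓ) (σ := σ)
    (A := θ * γ ^ 2 / 81920 * N) hμP hF2 hh hr hγ hγ1
    (fun u hu' => l1Ratio_mul_le_integral_abs hq hL (hu u hu').2.1 (hFq u (hu u hu').2.2.1))
    (fun u hu' => (hmult u hu').1) (fun u hu' => (hmult u hu').2.1)
    (fun u hu' => by
      rw [(hmult u hu').2.2, mul_comm]
      have h1 := ENNReal.toReal_le_of_le_ofReal hσ.le hWσ
      have h2 := (hu u hu').2.2.2
      gcongr)
    (by omega) hm (oracleLength_pos hγ) hk hvar₁ hvar₂ (le_oracleLength_mul hγ)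
    hA₁ hA₂ ?_ ?_ ?_
  · refine (measure_mono ?_).trans (hmain.trans ?_)
    · intro D hD hgood
      -- On the good event `h` qualifies, so the rule does return a qualifier; one far from `h`
      -- would have been defeated by `h`.
      have hqual : h ∈ qualifiers F ℓ 2 θ σ r D := ⟨hh, fun f hf hall => hgood.1 f hf hall⟩
      have hΦD := hΦq D ⟨h, hqual⟩
      obtain ⟨hall, hbeat⟩ := hgood.2 (Φ D) (hΦ D) (le_of_lt hD)
      exact hΦD.2 h hh hall hbeat
    · have hexpk : Real.exp (-((N / 3 / ℓ : ℕ) / 128)) ≤ Real.exp (-(n / 128)) := by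
        have : (n : ℝ) ≤ (N / 3 / ℓ : ℕ) := by exact_mod_cast hnk
        refine Real.exp_le_exp.2 ?_
        linarith
      rw [← ENNReal.ofReal_add (by positivity) (by positivity),
        ← ENNReal.ofReal_add (by positivity) (by positivity)]
      refine ENNReal.ofReal_le_ofReal (le_trans ?_ (three_mul_exp_le hn512 hexp))
      linarith
  · have h1 : γ ^ 2 * N ≤ γ * (10 * (n * (N / 3 / n : ℕ))) := by gcongr
    linarith
  · have h1 : γ ^ 2 * N ≤ γ ^ 2 * (10 * (n * (N / 3 / n : ℕ))) := by gcongr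
    linarith
  · have h1 : γ ^ 2 * N ≤ γ * (10 * ((N / 3 / ℓ : ℕ) * ℓ)) := by gcongr
    linarith

end MoMTournament

open MoMTournament
theorem theorem2p6 (q L : ℝ) (hq : 2 < q) (hL : 1 < L) :
    -- constants that depend only on `q` and `L`; the last three are parameters of the tournament
    ∃ c c₀ c₁ c₂ β θ : ℝ, ∃ ℓ : ℕ,
      0 < c ∧ 0 < c₀ ∧ 0 < c₁ ∧ 0 < c₂ ∧ c₂ < 1 ∧ 1 < β ∧ 0 < θ ∧ θ < 1 / 4 ∧ 0 < ℓ ∧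
      ∀ (𝒳 : Type u) [MeasurableSpace 𝒳] (F : Set (𝒳 → ℝ)), F.Nonempty →
        (∀ f ∈ F, Measurable f) →
      ∀ (N : ℕ) (σ r : ℝ), 0 < σ → 0 ≤ r →
      -- the procedure does not know the laws of `X` and `W`, nor `f₀`
      ∃ Φ : (Fin N → 𝒳 × ℝ) → (𝒳 → ℝ),
        (∀ D, Φ D ∈ F) ∧
        (∀ D, (qualifiers F ℓ β θ σ r D).Nonempty → Φ D ∈ qualifiers F ℓ β θ σ r D) ∧
        ∀ (Ω : Type v) [MeasurableSpace Ω] (Pr : Measure Ω) [IsProbabilityMeasure Pr]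
          (X : Ω → 𝒳) (W Y : Ω → ℝ) (f₀ fstar : 𝒳 → ℝ) (μ : Measure 𝒳) (P : Measure (𝒳 × ℝ)),
          Measurable X → Measurable W →
          f₀ ∈ F →
          Y = (fun ω => f₀ (X ω) + W ω) →
          μ = Pr.map X →
          P = Pr.map (fun ω => (X ω, Y ω)) →
          -- the class is a locally compact subset of `L₂(μ)` with equivalent norms
          (∀ f ∈ F, MemLp f 2 μ) →
          LocallyCompactSpace (l2Class F μ) →
          (∀ f ∈ Submodule.span ℝ F,
            eLpNorm f (ENNReal.ofReal q) μ ≤ ENNReal.ofReal L * eLpNorm f 2 μ) →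
          -- the noise
          IndepFun X W Pr →
          ∫ ω, W ω ∂Pr = 0 →
          eLpNorm W 2 Pr ≤ ENNReal.ofReal σ →
          -- the risk minimizer and the level
          fstar ∈ F → (∀ f ∈ F, risk P fstar ≤ risk P f) →
          2 * rStar μ P F N σ c₁ c₂ fstar ≤ ENNReal.ofReal r →
          (Measure.pi fun _ : Fin N => P)
              {D | ¬ (eLpNorm (Φ D - f₀) 2 μ ≤ ENNReal.ofReal (c * r) ∧
                risk P (Φ D) ≤ risk P f₀ + (c * r) ^ 2)} ≤
            ENNReal.ofReal (Real.exp (-(c₀ * N * min 1 (r ^ 2 / σ ^ 2)))) := by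
  have hγ : 0 < l1Ratio q L := l1Ratio_pos (by linarith)
  have hγ1 : l1Ratio q L ≤ 1 := l1Ratio_le_one hq hL
  have hθ := blockRatio_pos hγ
  have hθ4 : blockRatio (l1Ratio q L) < 1 / 4 := by
    have h1 := (blockRatio_mul_le hγ hγ1).1
    have h2 : l1Ratio q L ^ 4 ≤ 1 := pow_le_one₀ hγ.le hγ1
    linarith
  -- `c = 4 / γ` is the distance beyond which the oracle with `β = 2` always allows a match. For
  -- `c₂`, only `c₂ ≤ 1` matters to the packing argument.
  refine ⟨4 / l1Ratio q L, blockRatio (l1Ratio q L) / 2560,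
    blockRatio (l1Ratio q L) * l1Ratio q L ^ 2 / 81920, 1 / 2, 2, blockRatio (l1Ratio q L),
    oracleLength (l1Ratio q L), by positivity, by positivity, by positivity, by norm_num,
    by norm_num, by norm_num, hθ, hθ4, oracleLength_pos hγ, ?_⟩
  intro 𝒳 _ F hne hFm N σ r hσ hr
  refine ⟨selectQualifier hne _ _ _ σ r, selectQualifier_mem hne _ _ _ σ r,
    selectQualifier_mem_qualifiers hne _ _ _ σ r, ?_⟩
  rintro Ω _ Pr _ X W Y f₀ h μ P hX hW hf₀ rfl rfl rfl hF2 _ hFq hind hW0 hWσ hh hmin hstar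
  exact measure_rule_fails_le hq hL hFm hσ hr (selectQualifier_mem hne _ _ _ σ r)
    (selectQualifier_mem_qualifiers hne _ _ _ σ r) hX hW hf₀ hF2 hFq hind hW0 hWσ hh
    (hmin f₀ hf₀) hstar
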